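/- **Setting.** A directed acyclic graph on $n$ vertices is built online: we are given a starting acyclic graph with a topological order $T$ (a bijection from the vertices to $\{1,\dots,n\}$ with $T(x)<T(y)$ for every edge $x\to y$), and then distinct new edges arrive one at a time, the graph remaining acyclic. Write $u<v$ for $T(u)<T(v)$ and $d(u,v)=|T(u)-T(v)|$. Let $p\ge 0$ be an integer with $p=O(\log n)$ and let $t_0<t_1<\dots<t_{p+1}=n$ be thresholds. The algorithm maintains $T$ as follows. *Insert$(u,v)$*: if $v\le u$, call Reorder$(v,u,0,0)$; then insert the edge $u\to v$. *Reorder$(u,v,f_1,f_2)$*: if $v\le u$, exit. Let $\hat A_i=\{w: u\to w,\ d(u,w)\le t_i,\ w<v\}$ and $\hat B_i=\{w: w\to v,\ d(w,v)\le t_i,\ w>u\}$. If $t_i<d(u,v)\le t_{i+1}$ for some $0\le i\le p$, compute $\hat A_i$ and $\hat B_i$; put $A=\hat A_i$ if $\hat A_i\ne\emptyset$ or $f_1=1$, and otherwise compute $\hat A_{i+1}$ and put $A=\hat A_{i+1}$; put $B=\hat B_i$ if $\hat B_i\neq\emptyset$ or $f_2=1$, and otherwise compute $\hat B_{i+1}$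 and put $B=\hat B_{i+1}$. If $d(u,v)\le t_0$, compute and put $A=\hat A_0$, $B=\hat B_0$. If $A=B=\emptyset$, swap $u$ and $v$ in $T$. Otherwise, for each $u'\in\{u\}\cup A$ in decreasing order, and for each $v'\in B\cup\{v\}$ with $v'>u'$ in increasing order (all with respect to $T$ at the start of the call), call Reorder$(u',v',f_1',f_2')$, where $f_1'=1$ iff $u'=u$ and $A=\emptyset$, and $f_2'=1$ iff $v'=v$ and $B=\emptyset$. *Data structures*: arrays for $T$ and $T^{-1}$; for each vertex, its forward and backward adjacency lists as $n$-bit arrays; and, for each vertex $u$ and each $0\le i\le p+1$, balanced binary search trees ("pails") holding the out-neighbours, respectively the in-neighbours, of $u$ at distance at most $t_i$. The sets $\hat A_i,\hat B_i$ are read off the pails and sorted (by comparisons when $t_i<d(u,v)$, by counting sort when $d(u,v)\le t_i$). An edge insertion updates the adjacency lists and pails; a swap of $u$ and $v$ updates $T$, $T^{-1}$ and, for each $i$, only the pail entries in the $O(d(u,v))$ positions where membership may change. The running time is the number of elementary steps (array accesses, comparisons, tree nodes visited). **Statement.** Let $f(p)=\dfrac{3^{p+1}}{2\cdot 3^{p+1}-2^{p+1}}$,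 and take $t_0=n^{f(p)}$ and $t_i=t_0^{\,2-(2/3)^i}$ for $i=1,\dots,p+1$. Then the total running time of the algorithm while inserting a sequence of edges is $\tilde O(n^{2+f(p)})$. That is, there is an absolute constant $k$ such that for every $K$ there is a constant $C$ such that for all $n\ge 2$, all integers $0\le p\le K\log n$, every starting graph with a topological order and every admissible sequence of edges, the algorithm terminates, and its total running time (including the construction of the data structures for the starting graph) is at most $C\,n^{2+f(p)}(\log n)^k$. -/

import Mathlib

/-! Online topological ordering: the algorithm, written as a program over an explicit store that
counts its elementary steps. -/

namespace OnlineTopo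

/-- The store. The vertices are `0, …, n-1`.
* `pos` is the array `T` (current topological order) and `vert` its inverse array;
* `outList u`, `inList u` are the forward and backward adjacency lists, as `n`-bit arrays;
* `outPails u i`, `inPails u i` (with `i ≤ p + 1`) are the pails, size-balanced binary search trees
  keyed by vertex index; `outPails u i` is meant to hold the `w` with `u → w` and `d(u,w) ≤ t i`,
  and `inPails u i` the `w` with `w → u` and `d(w,u) ≤ t i`;
* `time` is the number of elementary steps executed so far. -/
structure Store (n : ℕ) where
  pos : Fin n → Fin n
  vert : Fin n → Fin n
  outList : Fin n → Fin n → Bool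
  inList : Fin n → Fin n → Bool
  outPails : Fin n → ℕ → Ordnode (Fin n)
  inPails : Fin n → ℕ → Ordnode (Fin n)
  time : ℕ

/-- Programs acting on the store; `none` means that the execution has been
abandoned because the bound on the recursion depth was exceeded. -/
abbrev Prog (n : ℕ) (α : Type) : Type := StateT (Store n) Option α

/-- Execute `k` elementary steps (array accesses, comparisons, visits of tree nodes). A constant
number of arithmetic operations on words between two charges is absorbed in them. -/
def tick {n : ℕ} (k : ℕ) : Prog n Unit := modify fun s => { s with time := s.time + k }

/-! ### Steps of the operations on balanced search trees -/

section Trees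

variable {α : Type}

/-- Nodes visited when walking down the leftmost branch. -/
def leftSteps : Ordnode α → ℕ
  | .nil => 1
  | .node _ l _ _ => leftSteps l + 1

/-- Nodes visited when walking down the rightmost branch. -/
def rightSteps : Ordnode α → ℕ
  | .nil => 1
  | .node _ _ _ r => rightSteps r + 1

/-- Nodes visited by `Ordnode.glue l r`, which extracts the maximum of `l` or the minimum of `r`. -/
def glueSteps (l r : Ordnode α) : ℕ :=
  if r.size < l.size then rightSteps l else leftSteps r

/-- Nodes visited by `Ordnode.insert x`. -/
def insertSteps [LE α] [DecidableLE α] (x : α) : Ordnode α → ℕ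
  | .nil => 1
  | .node _ l y r =>
    match cmpLE x y with
    | .lt => insertSteps x l + 1
    | .eq => 1
    | .gt => insertSteps x r + 1

/-- Nodes visited by `Ordnode.erase x`. -/
def eraseSteps [LE α] [DecidableLE α] (x : α) : Ordnode α → ℕ
  | .nil => 1
  | .node _ l y r =>
    match cmpLE x y with
    | .lt => eraseSteps x l + 1
    | .eq => glueSteps l r + 1
    | .gt => eraseSteps x r + 1

end Trees

variable {n : ℕ}

/-- Insertion into a balanced search tree. -/
def treeInsert (x : Fin n) (tr : Ordnode (Fin n)) : Prog n (Ordnode (Fin n)) := do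
  tick (insertSteps x tr)
  return Ordnode.insert x tr

/-- Deletion from a balanced search tree. -/
def treeErase (x : Fin n) (tr : Ordnode (Fin n)) : Prog n (Ordnode (Fin n)) := do
  tick (eraseSteps x tr)
  return Ordnode.erase x tr

/-- Report all elements of a balanced search tree, in increasing order of keys. -/
def treeCollect (tr : Ordnode (Fin n)) : Prog n (List (Fin n)) := do
  tick (tr.toList.length + 1)
  return tr.toList

/-! ### Array accesses -/

def getPos (u : Fin n) : Prog n ℕ := do
  tick 1
  return ((← get).pos u : ℕ)

def setOutPail (u : Fin n) (i : ℕ) (tr : Ordnode (Fin n)) : Prog n Unit := do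
  tick 1
  modify fun s =>
    { s with outPails := Function.update s.outPails u (Function.update (s.outPails u) i tr) }

def setInPail (u : Fin n) (i : ℕ) (tr : Ordnode (Fin n)) : Prog n Unit := do
  tick 1
  modify fun s =>
    { s with inPails := Function.update s.inPails u (Function.update (s.inPails u) i tr) }

def getOutPail (u : Fin n) (i : ℕ) : Prog n (Ordnode (Fin n)) := do
  tick 1
  return (← get).outPails u i

def getInPail (u : Fin n) (i : ℕ) : Prog n (Ordnode (Fin n)) := do
  tick 1
  return (← get).inPails u i

/-- Search `w` in the forward adjacency list of `u`. -/
def searchOut (u w : Fin n) : Prog n Bool := do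
  tick 1
  return (← get).outList u w

/-- Search `w` in the backward adjacency list of `u`. -/
def searchIn (u w : Fin n) : Prog n Bool := do
  tick 1
  return (← get).inList u w

/-- Record the pair `u → w` in the pails of index `i`. -/
def pailsInsert (u w : Fin n) (i : ℕ) : Prog n Unit := do
  setOutPail u i (← treeInsert w (← getOutPail u i))
  setInPail w i (← treeInsert u (← getInPail w i))

/-- Remove the pair `u → w` from the pails of index `i`. -/
def pailsErase (u w : Fin n) (i : ℕ) : Prog n Unit := do
  setOutPail u i (← treeErase w (← getOutPail u i))
  setInPail w i (← treeErase u (← getInPail w i))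

/-- The vertices `w` with `lo ≤ T(w) < hi`, read off the array `T⁻¹`. -/
def window (lo hi : ℕ) : Prog n (List (Fin n)) := do
  let s ← get
  tick (min hi n - lo + 1)
  return (List.range' lo (min hi n - lo)).filterMap
    fun x => if h : x < n then some (s.vert ⟨x, h⟩) else none

/-! ### The algorithm

`p` is the number of levels and `t 0, …, t (p + 1)` are the thresholds. As every distance
`d(u,v) = |T(v) - T(u)|` is an integer, real thresholds enter only through their integer parts. -/

/-- Insert the edge `u → v` into the graph: update the adjacency lists and the pails. -/
def insertEdge (p : ℕ) (t : ℕ → ℕ) (u v : Fin n) : Prog n Unit := do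
  tick 2
  modify fun s =>
    { s with
      outList := Function.update s.outList u (Function.update (s.outList u) v true)
      inList := Function.update s.inList v (Function.update (s.inList v) u true) }
  let x ← getPos u
  let y ← getPos v
  (List.range (p + 2)).forM fun i => do
    tick 1
    if Nat.dist x y ≤ t i then pailsInsert u v i

/-- Swap `u` and `v` in the order, where `T(u) < T(v)`, and update the pails. -/
def swap (p : ℕ) (t : ℕ → ℕ) (u v : Fin n) : Prog n Unit := do
  let x ← getPos u
  let y ← getPos v
  let d := y - x
  (List.range (p + 2)).forM fun i => do
    tick 1
    (← window (x - t i) (min x (x + d - t i))).forM fun w => pailsErase w u i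
    (← window (max (y + t i - d) y + 1) (y + t i + 1)).forM fun w => pailsErase v w i
    (← window (max y (x + t i) + 1) (x + t i + d + 1)).forM fun w => do
      if ← searchOut u w then pailsInsert u w i
    (← window (y - t i - d) (min x (y + d - t i))).forM fun w => do
      if ← searchIn v w then pailsInsert w v i
  tick 4
  modify fun s =>
    { s with
      pos := Function.update (Function.update s.pos u (s.pos v)) v (s.pos u)
      vert := Function.update (Function.update s.vert (s.pos u) v) (s.pos v) u }

/-- Sort vertices by the topological order, by comparisons: insert their positions into a balanced
search tree and read it off. -/
def comparisonSort (ws : List (Fin n)) : Prog n (List (Fin n)) := do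
  let s ← get
  let tr ← ws.foldlM (fun tr w => do tick 1; treeInsert (s.pos w) tr) Ordnode.nil
  let xs ← treeCollect tr
  tick xs.length
  return xs.map s.vert

/-- Sort vertices whose positions lie between `c` and `c + m` by the topological order, by counting
sort with an array of `m + 1` buckets. -/
def countingSort (c m : ℕ) (ws : List (Fin n)) : Prog n (List (Fin n)) := do
  tick (m + 1)
  let buckets ← ws.foldlM
    (fun b w => do
      let x ← getPos w
      tick 1
      return Function.update b (x - c) (some w))
    (fun _ => none)
  tick (m + 1)
  return (List.range (m + 1)).filterMap buckets

/-- `{w : u → w, d(u,w) ≤ t i, w < v}`, sorted by the topological order. The flag `cmp` selects the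
sorting method: by comparisons if it is set, by counting otherwise. -/
def hatA (t : ℕ → ℕ) (cmp : Bool) (u v : Fin n) (i : ℕ) : Prog n (List (Fin n)) := do
  let x ← getPos u
  let y ← getPos v
  let ws ← treeCollect (← getOutPail u i)
  let sorted ← if cmp then comparisonSort ws else countingSort x (t i) ws
  let s ← get
  tick (sorted.length + 1)
  return sorted.filter fun w => (s.pos w : ℕ) < y

/-- `{w : w → v, d(w,v) ≤ t i, w > u}`, sorted by the topological order. -/
def hatB (t : ℕ → ℕ) (cmp : Bool) (u v : Fin n) (i : ℕ) : Prog n (List (Fin n)) := do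
  let x ← getPos u
  let y ← getPos v
  let ws ← treeCollect (← getInPail v i)
  let sorted ← if cmp then comparisonSort ws else countingSort (y - t i) (t i) ws
  let s ← get
  tick (sorted.length + 1)
  return sorted.filter fun w => x < (s.pos w : ℕ)

/-- The index `i ≤ p` with `t i < d ≤ t (i + 1)`, if there is one. -/
def findLevel (p : ℕ) (t : ℕ → ℕ) (d : ℕ) : Prog n (Option ℕ) := do
  tick (p + 1)
  return (List.range (p + 1)).find? fun i => t i < d ∧ d ≤ t (i + 1)

/-- The pairs `(u', v')` of the two nested loops, in the order in which they are treated, for lists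
`A` and `B` sorted by the topological order: `u'` runs through `{u} ∪ A` in decreasing order and, for
each `u'`, `v'` runs through the elements of `B ∪ {v}` above `u'` in increasing order (these are found
by scanning `B ∪ {v}` downwards until an element below `u'` is met). The order is the one at the time
when the loops are entered. -/
def loopPairs (pos : Fin n → Fin n) (u v : Fin n) (A B : List (Fin n)) :
    List (Fin n × Fin n) :=
  (u :: A).reverse.flatMap fun u' =>
    ((B ++ [v]).reverse.takeWhile fun v' => pos u' < pos v').reverse.map fun v' => (u', v')

/-- The recursive procedure that makes `v` precede `u` in the order. The first argument bounds the depth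
of the recursion: an execution that exceeds it is abandoned with the value `none`. It does not influence
an execution that is not abandoned, so the procedure halts when the value is not `none` for some bound. -/
def reorder (p : ℕ) (t : ℕ → ℕ) : ℕ → Fin n → Fin n → Bool → Bool → Prog n Unit
  | 0, _, _, _, _ => failure
  | depth + 1, u, v, f₁, f₂ => do
    let x ← getPos u
    let y ← getPos v
    tick 1
    if y ≤ x then return ()
    else
      let (A, B) ← match ← findLevel p t (y - x) with
        | some i => do
          let A₀ ← hatA t true u v i
          let B₀ ← hatB t true u v i
          let A ← if A₀ ≠ [] ∨ f₁ = true then pure A₀ else hatA t false u v (i + 1)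
          let B ← if B₀ ≠ [] ∨ f₂ = true then pure B₀ else hatB t false u v (i + 1)
          pure (A, B)
        | none => do
          let A ← hatA t false u v 0
          let B ← hatB t false u v 0
          pure (A, B)
      if A = [] ∧ B = [] then swap p t u v
      else
        let pairs := loopPairs (← get).pos u v A B
        tick (pairs.length + A.length + B.length + 1)
        pairs.forM fun q =>
          reorder p t depth q.1 q.2 (decide (q.1 = u ∧ A = [])) (decide (q.2 = v ∧ B = []))

/-- The procedure called for each new edge `u → v`. -/
def insert (p : ℕ) (t : ℕ → ℕ) (depth : ℕ) (u v : Fin n) : Prog n Unit := do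
  let x ← getPos u
  let y ← getPos v
  tick 1
  if y ≤ x then reorder p t depth v u false false
  insertEdge p t u v

/-- The store for the graph without edges and the order `T₀`. The time is that of allocating the
arrays: `T` and `T⁻¹`, the two adjacency lists and the two arrays of pails of every vertex. -/
def initStore (p : ℕ) (T₀ : Equiv.Perm (Fin n)) : Store n where
  pos := T₀
  vert := T₀.symm
  outList := fun _ _ => false
  inList := fun _ _ => false
  outPails := fun _ _ => .nil
  inPails := fun _ _ => .nil
  time := 2 * n + 2 * n * n + 2 * n * (p + 2)

/-- The whole run. The data structures are built for the starting graph, which has the edges `E₀` and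
the topological order `T₀`; then the edges of `es` are inserted online, one after the other. The result
is the final store, whose field `time` is the total running time (construction included), or `none`
if the recursion depth has exceeded `depth`. -/
def run (p : ℕ) (t : ℕ → ℕ) (depth : ℕ) (T₀ : Equiv.Perm (Fin n))
    (E₀ es : List (Fin n × Fin n)) : Option (Store n) :=
  (do
    E₀.forM fun e => insertEdge p t e.1 e.2
    es.forM fun e => insert p t depth e.1 e.2
    get : Prog n (Store n)).run' (initStore p T₀)

/-- The exponent `f(p) = 3^(p+1) / (2·3^(p+1) - 2^(p+1))`. -/
noncomputable def expo (p : ℕ) : ℝ := 3 ^ (p + 1) / (2 * 3 ^ (p + 1) - 2 ^ (p + 1))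

end OnlineTopo

/-! All work is charged to the swaps, and the swaps are bounded by a potential. Let `d` be the
distance of a swap, `N` the number of swaps, `S` the sum of their `√d`, and `θ` the threshold of
level 0.

Bounding the swaps. The final graph is acyclic, so a numbering `F` increases along all its edges.
While `u → v` is inserted, every swap exchanges a descendant `x` of `v` with a higher ancestor `y`
of `u`. Descendants only rise and ancestors only descend, so a pair is swapped at most once per
insertion, and afterwards the path from `y` through `u → v` to `x` fixes its order for good. The
pair leaves the set of open pairs and releases its weight `1 + n / a`, where `a = F x - F y`. The
same swap raises the scalar product of `F` with the order by `a * d`. As `n / a + a * d / n ≥ 2√d`,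
each swap lowers `potential` by at least `1 + 2√d` (`Moves.cost_le`, `Moves.add_potential_le`). The
weights sum to at most `n² (2 + log n)`, a harmonic sum, and the scalar product divided by `n` is at
most `n²`. Hence `N + 2 S = O(n² log n)` over the whole run.

Charging the work. A swap costs a multiple of `d ≤ √n √d ≤ θ √d`, up to the number of levels and the
tree height. A search by comparisons is paid for by the recursive calls that its output generates. A
counting sort at level `i + 1` costs about `t (i + 1) ≤ θ √(t i + 1)` and happens only if no
neighbour lies within `t i`. In that case all other descendants of `u` lie further than `t i` above
`u`, so `u` itself must cross that distance in order to pass `v` (`Moves.far_up`). By subadditivity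
of the square root, the swaps in calls with first argument `u` then contribute at least `√(t i + 1)`
to `S`.

The same moves of `u` must not be charged at every depth of the recursion. After a counting sort
that has found something, the order of the loops guarantees that calls with first argument `u` see
no out-neighbour (`LoopState.noOut`); one more, empty, counting sort sets the flag, and below it the
search is never repeated. So a move of `u` is charged at most twice on this account. The rates `α, β
∈ {0, 1, 2}` record how many charges remain for `u` and for `v`, and `reorderSpec` proves by
induction that a call takes time at most `κ (3 N - 2 + (α + β + 1) S)`. The `-2` leaves a surplus
that grows with the number of recursive calls and pays for the loops.

Termination: each swap raises the scalar product with `F`, and a call made before any swap concerns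
a shorter interval (`callRank`). -/

namespace OnlineTopo

/-! ### Balanced search trees -/

section Trees

open Ordnode

variable {α : Type}

/-- The height of a tree. -/
def height : Ordnode α → ℕ
  | .nil => 0
  | .node _ l _ r => max (height l) (height r) + 1

theorem leftSteps_le (t : Ordnode α) : leftSteps t ≤ height t + 1 := by
  induction t with
  | nil => simp [leftSteps, height]
  | node _ l _ r hl _ => simp only [leftSteps, height]; omega

theorem rightSteps_le (t : Ordnode α) : rightSteps t ≤ height t + 1 := by
  induction t with
  | nil => simp [rightSteps, height]
  | node _ l _ r _ hr => simp only [rightSteps, height]; omega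

theorem insertSteps_le [LE α] [DecidableLE α] (x : α) (t : Ordnode α) :
    insertSteps x t ≤ height t + 1 := by
  induction t with
  | nil => simp [insertSteps, height]
  | node _ l y r hl hr =>
    simp only [insertSteps, height]
    cases cmpLE x y <;> dsimp only <;> omega

theorem eraseSteps_le [LE α] [DecidableLE α] (x : α) (t : Ordnode α) :
    eraseSteps x t ≤ height t + 1 := by
  induction t with
  | nil => simp [eraseSteps, height]
  | node _ l y r hl hr =>
    have h1 := leftSteps_le r
    have h2 := rightSteps_le l
    simp only [eraseSteps, height, glueSteps]
    cases cmpLE x y <;> dsimp only <;> (try split_ifs) <;> omega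

/-- Weight balance with ratio 3 gives each child at most three quarters of `size + 1`, so the height
is at most logarithmic to base 4/3. The form without division stays in the natural numbers. -/
theorem pow_height_le {t : Ordnode α} (hs : t.Sized) (hb : t.Balanced) :
    4 ^ height t ≤ 3 ^ height t * (t.size + 1) := by
  induction t with
  | nil => simp [height]
  | node s l x r hl hr =>
    obtain ⟨h0, hsl, hsr⟩ := hs
    obtain ⟨h1, hbl, hbr⟩ := hb
    have key : ∀ (c : Ordnode α), 4 ^ height c ≤ 3 ^ height c * (c.size + 1) →
        4 * (c.size + 1) ≤ 3 * (s + 1) →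
        4 ^ (height c + 1) ≤ 3 ^ (height c + 1) * (s + 1) := by
      intro c h2 h3
      calc 4 ^ (height c + 1) = 4 * 4 ^ height c := by ring
        _ ≤ 4 * (3 ^ height c * (c.size + 1)) := by gcongr
        _ = 3 ^ height c * (4 * (c.size + 1)) := by ring
        _ ≤ 3 ^ height c * (3 * (s + 1)) := by gcongr
        _ = 3 ^ (height c + 1) * (s + 1) := by ring
    unfold BalancedSz delta at h1
    simp only [size]
    rcases max_cases (height l) (height r) with ⟨h, _⟩ | ⟨h, _⟩
    · simp only [height, h]
      exact key l (hl hsl hbl) (by omega)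
    · simp only [height, h]
      exact key r (hr hsr hbr) (by omega)

/-! ### Elements of a search tree after insertion and deletion -/

variable [LinearOrder α]

/-- Membership is accessed through `All P` for arbitrary `P`, because rebalancing is known to
preserve `All`. Validity of the modified subtree supplies the size conditions under which this
holds. -/
theorem all_insert {P : α → Prop} (x : α) {t : Ordnode α} {o₁ o₂}
    (h : Valid' o₁ t o₂) (h₁ : Bounded nil o₁ x) (h₂ : Bounded nil x o₂) :
    All P (Ordnode.insert x t) ↔ P x ∧ All P t := by
  induction t generalizing o₁ o₂ with
  | nil => simp only [Ordnode.insert, All, and_true]; exact all_singleton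
  | node s l y r hl hr =>
    unfold Ordnode.insert
    rw [cmpLE]
    split_ifs with h3 h4 <;> dsimp only
    · obtain rfl := le_antisymm h3 h4
      simp only [All]; tauto
    · have hv := insertWith.valid_aux (fun _ => x) x (fun _ _ => ⟨le_rfl, le_rfl⟩) h.left h₁
        (show Bounded nil (x : WithBot α) (y : WithTop α) from lt_of_not_ge h4)
      rw [← insert_eq_insertWith] at hv
      rw [all_balanceL hv.1.3 h.3.2.2 hv.1.2 h.2.2.2 (Or.inl ⟨_, hv.2, h.3.1⟩),
        hl h.left h₁ (show Bounded nil (x : WithBot α) (y : WithTop α) from lt_of_not_ge h4)]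
      simp only [All]; tauto
    · have hv := insertWith.valid_aux (fun _ => x) x (fun _ _ => ⟨le_rfl, le_rfl⟩) h.right
        (show Bounded nil (y : WithBot α) (x : WithTop α) from lt_of_not_ge h3) h₂
      rw [← insert_eq_insertWith] at hv
      rw [all_balanceR h.3.2.1 hv.1.3 h.2.2.1 hv.1.2 (Or.inr ⟨_, hv.2, h.3.1⟩),
        hr h.right (show Bounded nil (y : WithBot α) (x : WithTop α) from lt_of_not_ge h3) h₂]
      simp only [All]; tauto

theorem all_eraseMax {P : α → Prop} {s l r} {x : α} {o₁ o₂} (H : Valid' o₁ (.node s l x r) o₂) :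
    All P (eraseMax (.node s l x r)) ∧ P (findMax' x r) ↔ All P l ∧ P x ∧ All P r := by
  induction r generalizing s l x o₁ with
  | nil => simp [eraseMax, findMax', All]
  | node rs rl rx rr _ ih =>
    have hv := Valid'.eraseMax_aux H.right
    rw [← H.right.2.eq_node'] at hv
    rw [eraseMax, findMax', all_balanceL H.left.3 hv.1.3 H.left.2 hv.1.2
      (Or.inr ⟨_, Or.inr hv.2, H.3.1⟩), and_assoc, and_assoc, ih H.right]
    rfl

theorem all_eraseMin {P : α → Prop} {s l r} {x : α} {o₁ o₂} (H : Valid' o₁ (.node s l x r) o₂) :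
    P (findMin' l x) ∧ All P (eraseMin (.node s l x r)) ↔ All P l ∧ P x ∧ All P r := by
  induction l generalizing s r x o₂ with
  | nil => simp [eraseMin, findMin', All]
  | node ls ll lx lr ih _ =>
    have hv := Valid'.eraseMin_aux H.left
    rw [← H.left.2.eq_node'] at hv
    rw [eraseMin, findMin', all_balanceR hv.1.3 H.right.3 hv.1.2 H.right.2
      (Or.inl ⟨_, Or.inr hv.2, H.3.1⟩), ← and_assoc, ih H.left]
    rfl

theorem all_glue {P : α → Prop} {l r} {x : α} {o₁ o₂} (hl : Valid' o₁ l x) (hr : Valid' x r o₂)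
    (bal : BalancedSz (size l) (size r)) : All P (glue l r) ↔ All P l ∧ All P r := by
  obtain - | ⟨ls, ll, lx, lr⟩ := l
  · simp [glue, All]
  obtain - | ⟨rs, rl, rx, rr⟩ := r
  · simp [glue, All]
  dsimp only [glue]
  split_ifs
  · rw [splitMax_eq]
    have hv := Valid'.eraseMax_aux hl
    rw [← hl.2.eq_node'] at hv
    dsimp only
    rw [all_balanceR hv.1.3 hr.3 hv.1.2 hr.2 (Or.inl ⟨_, Or.inr hv.2, bal⟩), ← and_assoc,
      all_eraseMax hl]
    rfl
  · rw [splitMin_eq]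
    have hv := Valid'.eraseMin_aux hr
    rw [← hr.2.eq_node'] at hv
    dsimp only
    rw [all_balanceL hl.3 hv.1.3 hl.2 hv.1.2 (Or.inr ⟨_, Or.inr hv.2, bal⟩), all_eraseMin hr]
    rfl

theorem all_erase {P : α → Prop} (x : α) {t : Ordnode α} {o₁ o₂} (h : Valid' o₁ t o₂) :
    All P (erase x t) ↔ All (fun y => y ≠ x → P y) t := by
  induction t generalizing o₁ o₂ with
  | nil => simp [erase, All]
  | node s l y r hl hr =>
    -- In the subtree that the search for `x` does not enter, all keys lie strictly on the other
    -- side of `x`, so the clause `y ≠ x` is vacuous there.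
    have gt : ∀ z, y ≤ z → (All (fun y => y ≠ x → P y) l ↔ All P l) ∨ z ≠ x := by
      intro z hz
      by_cases hzx : z = x
      · subst hzx
        refine Or.inl ⟨fun H => ?_, fun H => All.imp (fun a (h : P a) (_ : a ≠ z) => h) H⟩
        have := h.1.1.mem_lt
        rw [all_iff_forall] at H this ⊢
        exact fun w hw => H w hw ((this w hw).trans_le hz).ne
      · exact Or.inr hzx
    have lt : ∀ z, z ≤ y → (All (fun y => y ≠ x → P y) r ↔ All P r) ∨ z ≠ x := by
      intro z hz
      by_cases hzx : z = x
      · subst hzx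
        refine Or.inl ⟨fun H => ?_, fun H => All.imp (fun a (h : P a) (_ : a ≠ z) => h) H⟩
        have := h.1.2.mem_gt
        rw [all_iff_forall] at H this ⊢
        exact fun w hw => H w hw (hz.trans_lt (this w hw)).ne'
      · exact Or.inr hzx
    unfold erase
    rw [cmpLE]
    split_ifs with h3 h4 <;> dsimp only
    · obtain rfl := le_antisymm h3 h4
      rw [all_glue h.left h.right h.3.1]
      have h5 := (gt x le_rfl).resolve_right (by simp)
      have h6 := (lt x le_rfl).resolve_right (by simp)
      simp only [All, h5, h6]; tauto
    · have hv := Valid'.erase_aux x h.left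
      have h6 := (lt x h3).resolve_right (by simp)
      have h7 : y ≠ x := by rintro rfl; exact h4 le_rfl
      rw [all_balanceR hv.1.3 h.right.3 hv.1.2 h.right.2 (Or.inl ⟨_, hv.2, h.3.1⟩), hl h.left]
      simp only [All, h6]; tauto
    · have hv := Valid'.erase_aux x h.right
      have h5 := (gt x (le_of_not_ge h3)).resolve_right (by simp)
      have h7 : y ≠ x := by rintro rfl; exact h3 le_rfl
      rw [all_balanceL h.left.3 hv.1.3 h.left.2 hv.1.2 (Or.inr ⟨_, hv.2, h.3.1⟩), hr h.right]
      simp only [All, h5]; tauto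

/-- An element belongs to a tree iff it satisfies every `P` with `All P`; `all_insert` is applied to
the weakened predicate `P z ∨ z = x`. -/
theorem mem_toList_insert {x y : α} {t : Ordnode α} (h : Valid t) :
    y ∈ (Ordnode.insert x t).toList ↔ y = x ∨ y ∈ t.toList := by
  rw [← emem_iff_mem_toList, ← emem_iff_mem_toList, emem_iff_all, emem_iff_all]
  constructor
  · intro H
    by_contra! hc
    obtain ⟨h1, P, h2, h3⟩ := hc
    exact (H (fun z => P z ∨ z = x) ((all_insert x h ⟨⟩ ⟨⟩).2
      ⟨Or.inr rfl, h2.imp fun _ h => Or.inl h⟩)).elim h3 h1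
  · rintro (rfl | H) P hP
    · exact ((all_insert y h ⟨⟩ ⟨⟩).1 hP).1
    · exact H P ((all_insert x h ⟨⟩ ⟨⟩).1 hP).2

theorem mem_toList_erase {x y : α} {t : Ordnode α} (h : Valid t) :
    y ∈ (Ordnode.erase x t).toList ↔ y ∈ t.toList ∧ y ≠ x := by
  rw [← emem_iff_mem_toList, ← emem_iff_mem_toList, emem_iff_all, emem_iff_all]
  constructor
  · intro H
    refine ⟨fun P hP => H P ((all_erase x h).2 (All.imp (fun a (h : P a) (_ : a ≠ x) => h) hP)),
      H (fun z => z ≠ x) ((all_erase x h).2 ?_)⟩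
    exact all_iff_forall.2 fun _ _ h => h
  · rintro ⟨H, h1⟩ P hP
    exact H _ ((all_erase x h).1 hP) h1

theorem sorted_toList {t : Ordnode α} {o₁ o₂} (h : Bounded t o₁ o₂) :
    t.toList.Pairwise (· < ·) := by
  induction t generalizing o₁ o₂ with
  | nil => simp
  | node s l y r hl hr =>
    have h1 := h.1.mem_lt
    have h2 := h.2.mem_gt
    rw [all_iff_forall] at h1 h2
    simp only [emem_iff_mem_toList] at h1 h2
    rw [toList_node, List.pairwise_append, List.pairwise_cons]
    refine ⟨hl h.1, ⟨h2, hr h.2⟩, fun a ha b hb => ?_⟩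
    rcases List.mem_cons.1 hb with rfl | hb
    · exact h1 a ha
    · exact (h1 a ha).trans (h2 b hb)

end Trees

/-- A bound for the height, plus one, of a balanced search tree with at most `n` nodes. -/
noncomputable def logBound (n : ℕ) : ℕ := ⌊4 * Real.log (n + 1)⌋₊ + 1

theorem one_le_logBound (n : ℕ) : 1 ≤ logBound n := by unfold logBound; omega

theorem height_lt_logBound {n : ℕ} {t : Ordnode (Fin n)} (h : t.Valid) :
    height t + 1 ≤ logBound n := by
  have h1 : t.size ≤ n := by
    have hnd : t.toList.Nodup := (sorted_toList h.1).imp fun h => h.ne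
    rw [← Ordnode.length_toList h.2]
    simpa using hnd.length_le_card
  have h2 := pow_height_le h.2 h.3
  have h3 : (4 / 3 : ℝ) ^ height t ≤ n + 1 := by
    rw [div_pow, div_le_iff₀ (by positivity)]
    have : (4 ^ height t : ℕ) ≤ 3 ^ height t * (n + 1) := h2.trans (by gcongr)
    have h4 : ((4 ^ height t : ℕ) : ℝ) ≤ ((3 ^ height t * (n + 1) : ℕ) : ℝ) := by exact_mod_cast this
    push_cast at h4
    linarith
  have h4 : (height t : ℝ) * Real.log (4 / 3) ≤ Real.log (n + 1) := by
    rw [← Real.log_pow]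
    exact Real.log_le_log (by positivity) h3
  -- From `log x ≥ 1 - 1 / x`; this is the origin of the factor 4 in `logBound`.
  have h5 : (1 / 4 : ℝ) ≤ Real.log (4 / 3) := by
    have := Real.one_sub_inv_le_log_of_pos (show (0 : ℝ) < 4 / 3 by norm_num)
    norm_num at this ⊢
    linarith
  have h6 : (height t : ℝ) ≤ 4 * Real.log (n + 1) := by
    have : (0 : ℝ) ≤ height t := by positivity
    nlinarith
  unfold logBound
  have := Nat.le_floor h6
  omega

end OnlineTopo

namespace OnlineTopo

/-! ### Rules for programs -/

/-- The program `m` started in `s` is not abandoned, and result and final store satisfy `Q`. -/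
def Ends {n : ℕ} {α : Type} (m : Prog n α) (s : Store n) (Q : α → Store n → Prop) : Prop :=
  ∃ a s', m s = some (a, s') ∧ Q a s'

section Rules

variable {n : ℕ} {α β : Type} {s : Store n}

theorem Ends.mono {m : Prog n α} {Q Q' : α → Store n → Prop} (h : Ends m s Q)
    (hQ : ∀ a s', Q a s' → Q' a s') : Ends m s Q' := by
  obtain ⟨a, s', h1, h2⟩ := h
  exact ⟨a, s', h1, hQ _ _ h2⟩

theorem ends_bind {m : Prog n α} {f : α → Prog n β} {Q : β → Store n → Prop} :
    Ends (m >>= f) s Q ↔ Ends m s fun a s' => Ends (f a) s' Q := by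
  have hb : (m >>= f) s = (m s).bind fun x => f x.1 x.2 := rfl
  constructor
  · rintro ⟨b, s2, h1, h2⟩
    rw [hb, Option.bind_eq_some_iff] at h1
    obtain ⟨⟨a, s1⟩, h3, h4⟩ := h1
    exact ⟨a, s1, h3, b, s2, h4, h2⟩
  · rintro ⟨a, s1, h1, b, s2, h2, h3⟩
    exact ⟨b, s2, by rw [hb, h1]; exact h2, h3⟩

theorem ends_pure {a : α} {Q : α → Store n → Prop} :
    Ends (pure a : Prog n α) s Q ↔ Q a s :=
  ⟨fun ⟨_, _, h1, h2⟩ => by cases h1; exact h2, fun h => ⟨a, s, rfl, h⟩⟩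

theorem ends_get {Q : Store n → Store n → Prop} : Ends (get : Prog n (Store n)) s Q ↔ Q s s :=
  ⟨fun ⟨_, _, h1, h2⟩ => by cases h1; exact h2, fun h => ⟨s, s, rfl, h⟩⟩

theorem ends_modify {f : Store n → Store n} {Q : Unit → Store n → Prop} :
    Ends (modify f : Prog n Unit) s Q ↔ Q () (f s) :=
  ⟨fun ⟨_, _, h1, h2⟩ => by cases h1; exact h2, fun h => ⟨(), f s, rfl, h⟩⟩

theorem ends_tick {k : ℕ} {Q : Unit → Store n → Prop} :
    Ends (tick k : Prog n Unit) s Q ↔ Q () { s with time := s.time + k } :=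
  ends_modify

theorem ends_getPos {u : Fin n} {Q : ℕ → Store n → Prop} :
    Ends (getPos u) s Q ↔ Q (s.pos u) { s with time := s.time + 1 } := by
  simp only [getPos, ends_bind, ends_tick, ends_get, ends_pure]

theorem ends_forM_nil {f : α → Prog n Unit} {Q : Unit → Store n → Prop} :
    Ends ([].forM f) s Q ↔ Q () s :=
  ends_pure

theorem ends_forM_cons {f : α → Prog n Unit} {x : α} {l : List α} {Q : Unit → Store n → Prop} :
    Ends ((x :: l).forM f) s Q ↔ Ends (f x) s fun _ s' => Ends (l.forM f) s' Q :=
  ends_bind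

/-- Loop rule: the invariant is indexed by the part of the list that is still to be treated. -/
theorem Ends.forM {ws : List α} {f : α → Prog n Unit} (I : List α → Store n → Prop)
    (h : ∀ x l s, I (x :: l) s → Ends (f x) s fun _ => I l) (h0 : I ws s) :
    Ends (ws.forM f) s fun _ => I [] := by
  induction ws generalizing s with
  | nil => simpa only [ends_forM_nil] using h0
  | cons x l ih =>
    rw [ends_forM_cons]
    exact (h x l s h0).mono fun _ s' hs' => ih hs'

theorem Ends.foldlM {ws : List α} {f : β → α → Prog n β} (I : List α → β → Store n → Prop)
    (h : ∀ x l b s, I (x :: l) b s → Ends (f b x) s (I l)) {b : β} (h0 : I ws b s) :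
    Ends (ws.foldlM f b) s (I []) := by
  induction ws generalizing s b with
  | nil => simpa only [List.foldlM_nil, ends_pure] using h0
  | cons x l ih =>
    rw [List.foldlM_cons, ends_bind]
    exact (h x l b s h0).mono fun b' s' hs' => ih hs'

end Rules

/-! ### The pails -/

/-- The pails of index at most `p + 1` are balanced search trees that represent the relation `R`. -/
def PailsRep {n : ℕ} (p : ℕ) (R : ℕ → Fin n → Fin n → Prop) (s : Store n) : Prop :=
  ∀ i < p + 2, ∀ a,
    ((s.outPails a i).Valid ∧ ∀ b, b ∈ (s.outPails a i).toList ↔ R i a b) ∧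
    ((s.inPails a i).Valid ∧ ∀ b, b ∈ (s.inPails a i).toList ↔ R i b a)

/-- The store `s` has the same arrays as `s₀`, its pails represent `R`, and at most `T` steps have been
executed. -/
structure Rep {n : ℕ} (p : ℕ) (s₀ : Store n) (R : ℕ → Fin n → Fin n → Prop) (T : ℕ)
    (s : Store n) : Prop where
  pos : s.pos = s₀.pos
  vert : s.vert = s₀.vert
  outList : s.outList = s₀.outList
  inList : s.inList = s₀.inList
  time : s.time ≤ T
  pails : PailsRep p R s

section Pails

variable {n p : ℕ} {s₀ s : Store n} {R R' : ℕ → Fin n → Fin n → Prop} {T T' : ℕ}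

theorem Rep.congr (h : Rep p s₀ R T s) (hR : ∀ i < p + 2, ∀ a b, R i a b ↔ R' i a b)
    (hT : T ≤ T') : Rep p s₀ R' T' s where
  pos := h.pos
  vert := h.vert
  outList := h.outList
  inList := h.inList
  time := h.time.trans hT
  pails := fun i hi a =>
    ⟨⟨(h.pails i hi a).1.1, fun b => ((h.pails i hi a).1.2 b).trans (hR i hi a b)⟩,
      (h.pails i hi a).2.1, fun b => ((h.pails i hi a).2.2 b).trans (hR i hi b a)⟩

theorem Rep.addTime (h : Rep p s₀ R T s) (k : ℕ) :
    Rep p s₀ R (T + k) { s with time := s.time + k } :=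
  { h with time := Nat.add_le_add_right h.time k }

/-- Both trees that record a pair change together, so the effect is that of deleting one triple from
the represented relation. An absent pair is allowed, hence no check of adjacency is needed before an
erasure. -/
theorem ends_pailsErase (h : Rep p s₀ R T s) (u w : Fin n) {i : ℕ} (hi : i < p + 2) :
    Ends (pailsErase u w i) s fun _ => Rep p s₀
      (fun j a b => R j a b ∧ ¬ (j = i ∧ a = u ∧ b = w)) (T + (2 * logBound n + 4)) := by
  simp only [pailsErase, getOutPail, getInPail, setOutPail, setInPail, treeErase, ends_bind,
    ends_tick, ends_get, ends_pure, ends_modify]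
  have hu := (h.pails i hi u).1
  have hw := (h.pails i hi w).2
  have h1 := (eraseSteps_le w (s.outPails u i)).trans (height_lt_logBound hu.1)
  have h2 := (eraseSteps_le u (s.inPails w i)).trans (height_lt_logBound hw.1)
  have h3 := h.time
  refine ⟨h.pos, h.vert, h.outList, h.inList, by dsimp only; omega, fun j hj a => ?_⟩
  dsimp only
  have ha := h.pails j hj a
  constructor
  · by_cases hc : a = u ∧ j = i
    · obtain ⟨rfl, rfl⟩ := hc
      simp only [Function.update_self]
      refine ⟨Ordnode.erase.valid _ hu.1, fun b => ?_⟩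
      rw [mem_toList_erase hu.1, hu.2]
      tauto
    · have : Function.update s.outPails u (Function.update (s.outPails u) i
          (Ordnode.erase w (s.outPails u i))) a j = s.outPails a j := by
        by_cases hau : a = u
        · subst hau
          rw [Function.update_self, Function.update_of_ne (by tauto)]
        · rw [Function.update_of_ne hau]
      rw [this]
      refine ⟨ha.1.1, fun b => ?_⟩
      rw [ha.1.2]
      tauto
  · by_cases hc : a = w ∧ j = i
    · obtain ⟨rfl, rfl⟩ := hc
      simp only [Function.update_self]
      refine ⟨Ordnode.erase.valid _ hw.1, fun b => ?_⟩
      rw [mem_toList_erase hw.1, hw.2]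
      tauto
    · have : Function.update s.inPails w (Function.update (s.inPails w) i
          (Ordnode.erase u (s.inPails w i))) a j = s.inPails a j := by
        by_cases hau : a = w
        · subst hau
          rw [Function.update_self, Function.update_of_ne (by tauto)]
        · rw [Function.update_of_ne hau]
      rw [this]
      refine ⟨ha.2.1, fun b => ?_⟩
      rw [ha.2.2]
      tauto

theorem ends_pailsInsert (h : Rep p s₀ R T s) (u w : Fin n) {i : ℕ} (hi : i < p + 2) :
    Ends (pailsInsert u w i) s fun _ => Rep p s₀
      (fun j a b => R j a b ∨ (j = i ∧ a = u ∧ b = w)) (T + (2 * logBound n + 4)) := by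
  simp only [pailsInsert, getOutPail, getInPail, setOutPail, setInPail, treeInsert, ends_bind,
    ends_tick, ends_get, ends_pure, ends_modify]
  have hu := (h.pails i hi u).1
  have hw := (h.pails i hi w).2
  have h1 := (insertSteps_le w (s.outPails u i)).trans (height_lt_logBound hu.1)
  have h2 := (insertSteps_le u (s.inPails w i)).trans (height_lt_logBound hw.1)
  have h3 := h.time
  refine ⟨h.pos, h.vert, h.outList, h.inList, by dsimp only; omega, fun j hj a => ?_⟩
  dsimp only
  have ha := h.pails j hj a
  constructor
  · by_cases hc : a = u ∧ j = i
    · obtain ⟨rfl, rfl⟩ := hc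
      simp only [Function.update_self]
      refine ⟨Ordnode.insert.valid _ hu.1, fun b => ?_⟩
      rw [mem_toList_insert hu.1, hu.2]
      tauto
    · have : Function.update s.outPails u (Function.update (s.outPails u) i
          (Ordnode.insert w (s.outPails u i))) a j = s.outPails a j := by
        by_cases hau : a = u
        · subst hau
          rw [Function.update_self, Function.update_of_ne (by tauto)]
        · rw [Function.update_of_ne hau]
      rw [this]
      refine ⟨ha.1.1, fun b => ?_⟩
      rw [ha.1.2]
      tauto
  · by_cases hc : a = w ∧ j = i
    · obtain ⟨rfl, rfl⟩ := hc
      simp only [Function.update_self]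
      refine ⟨Ordnode.insert.valid _ hw.1, fun b => ?_⟩
      rw [mem_toList_insert hw.1, hw.2]
      tauto
    · have : Function.update s.inPails w (Function.update (s.inPails w) i
          (Ordnode.insert u (s.inPails w i))) a j = s.inPails a j := by
        by_cases hau : a = w
        · subst hau
          rw [Function.update_self, Function.update_of_ne (by tauto)]
        · rw [Function.update_of_ne hau]
      rw [this]
      refine ⟨ha.2.1, fun b => ?_⟩
      rw [ha.2.2]
      tauto

/-- The arrays are compared with a fixed store `s₀`, so that windows computed before and during the
loop agree; only the relation and the time evolve. -/
theorem ends_forM_erase {α : Type} {f : α → Prog n Unit} {g : α → ℕ → Fin n → Fin n → Prop} {c : ℕ}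
    (hf : ∀ w (R : ℕ → Fin n → Fin n → Prop) T s, Rep p s₀ R T s →
      Ends (f w) s fun _ => Rep p s₀ (fun j a b => R j a b ∧ ¬ g w j a b) (T + c))
    (ws : List α) (h : Rep p s₀ R T s) :
    Ends (ws.forM f) s fun _ => Rep p s₀ (fun j a b => R j a b ∧ ¬ ∃ w ∈ ws, g w j a b)
      (T + ws.length * c) := by
  induction ws generalizing s R T with
  | nil => rw [ends_forM_nil]; simpa using h
  | cons w ws ih =>
    rw [ends_forM_cons]
    refine (hf w R T s h).mono fun _ s1 h1 => (ih h1).mono fun _ s2 h2 => h2.congr ?_ ?_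
    · intro i _ a b
      simp only [List.mem_cons, exists_eq_or_imp]
      rw [not_or, and_assoc]
    · rw [List.length_cons]; exact le_of_eq (by ring)

theorem ends_forM_insert {α : Type} {f : α → Prog n Unit} {g : α → ℕ → Fin n → Fin n → Prop} {c : ℕ}
    (hf : ∀ w (R : ℕ → Fin n → Fin n → Prop) T s, Rep p s₀ R T s →
      Ends (f w) s fun _ => Rep p s₀ (fun j a b => R j a b ∨ g w j a b) (T + c))
    (ws : List α) (h : Rep p s₀ R T s) :
    Ends (ws.forM f) s fun _ => Rep p s₀ (fun j a b => R j a b ∨ ∃ w ∈ ws, g w j a b)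
      (T + ws.length * c) := by
  induction ws generalizing s R T with
  | nil => rw [ends_forM_nil]; simpa using h
  | cons w ws ih =>
    rw [ends_forM_cons]
    refine (hf w R T s h).mono fun _ s1 h1 => (ih h1).mono fun _ s2 h2 => h2.congr ?_ ?_
    · intro i _ a b
      simp only [List.mem_cons, exists_eq_or_imp]
      rw [or_assoc]
    · rw [List.length_cons]; exact le_of_eq (by ring)

end Pails

/-- The vertices whose positions lie in `[lo, hi)`. -/
def windowList {n : ℕ} (s : Store n) (lo hi : ℕ) : List (Fin n) :=
  (List.range' lo (min hi n - lo)).filterMap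
    fun x => if h : x < n then some (s.vert ⟨x, h⟩) else none

theorem ends_window {n : ℕ} {s : Store n} {lo hi : ℕ} {Q : List (Fin n) → Store n → Prop} :
    Ends (window lo hi) s Q ↔
      Q (windowList s lo hi) { s with time := s.time + (min hi n - lo + 1) } := by
  simp only [window, ends_bind, ends_tick, ends_get, ends_pure, windowList]

theorem length_windowList_le {n : ℕ} (s : Store n) (lo hi : ℕ) :
    (windowList s lo hi).length ≤ hi - lo := by
  refine (List.length_filterMap_le _ _).trans ?_
  rw [List.length_range']
  omega

/-- The invariant of the algorithm between two updates: `T` and `T⁻¹` are inverse to each other, `T` is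
a topological order, and the pails are what they are meant to be. -/
structure Good {n : ℕ} (p : ℕ) (t : ℕ → ℕ) (s : Store n) : Prop where
  vert_pos : ∀ w, s.vert (s.pos w) = w
  pos_vert : ∀ x, s.pos (s.vert x) = x
  in_out : ∀ a b, s.inList b a = s.outList a b
  topo : ∀ a b, s.outList a b = true → s.pos a < s.pos b
  pails : PailsRep p (fun i a b => s.outList a b = true ∧ (s.pos b : ℕ) ≤ s.pos a + t i) s

section Good

variable {n p : ℕ} {t : ℕ → ℕ} {s : Store n}

theorem Good.injective (h : Good p t s) : Function.Injective s.pos :=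
  Function.LeftInverse.injective h.vert_pos

theorem Good.addTime (h : Good p t s) (k : ℕ) : Good p t { s with time := s.time + k } :=
  ⟨h.vert_pos, h.pos_vert, h.in_out, h.topo, h.pails⟩

theorem Good.rep (h : Good p t s) : Rep p s
    (fun i a b => s.outList a b = true ∧ (s.pos b : ℕ) ≤ s.pos a + t i) s.time s :=
  ⟨rfl, rfl, rfl, rfl, le_rfl, h.pails⟩

theorem mem_windowList (h : ∀ w, s.vert (s.pos w) = w) (h' : ∀ x, s.pos (s.vert x) = x)
    {lo hi : ℕ} {w : Fin n} : w ∈ windowList s lo hi ↔ lo ≤ s.pos w ∧ (s.pos w : ℕ) < hi := by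
  simp only [windowList, List.mem_filterMap, List.mem_range'_1]
  constructor
  · rintro ⟨x, hx, h1⟩
    split_ifs at h1 with hxn
    simp only [Option.some.injEq] at h1
    have : (s.pos w : ℕ) = x := by rw [← h1, h']
    omega
  · rintro ⟨h1, h2⟩
    have := (s.pos w).2
    exact ⟨s.pos w, ⟨h1, by omega⟩, by simp [h]⟩

end Good

end OnlineTopo

namespace OnlineTopo

/-! ### Updates of the order and of the graph -/

section Updates

variable {n p : ℕ} {t : ℕ → ℕ} {s s₀ : Store n} {R : ℕ → Fin n → Fin n → Prop} {T : ℕ}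

theorem Rep.windowList_eq (h : Rep p s₀ R T s) (lo hi : ℕ) :
    windowList s lo hi = windowList s₀ lo hi := by
  unfold windowList
  rw [h.vert]

theorem Rep.ends_searchOut (h : Rep p s₀ R T s) (u w : Fin n) {i : ℕ} (hi : i < p + 2) :
    Ends (do if ← searchOut u w then pailsInsert u w i) s fun _ => Rep p s₀
      (fun j a b => R j a b ∨ (s₀.outList u w = true ∧ j = i ∧ a = u ∧ b = w))
      (T + (2 * logBound n + 5)) := by
  simp only [searchOut, ends_bind, ends_tick, ends_get, ends_pure]
  split_ifs with hc
  · rw [show s.outList = s₀.outList from h.outList] at hc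
    exact (ends_pailsInsert (h.addTime 1) u w hi).mono fun _ _ h => h.congr
      (fun _ _ _ _ => by simp [hc]) (by omega)
  · rw [show s.outList = s₀.outList from h.outList] at hc
    exact ends_pure.2 ((h.addTime 1).congr (fun _ _ _ _ => by simp [hc]) (by omega))

theorem Rep.ends_searchIn (h : Rep p s₀ R T s) (u w : Fin n) {i : ℕ} (hi : i < p + 2) :
    Ends (do if ← searchIn u w then pailsInsert w u i) s fun _ => Rep p s₀
      (fun j a b => R j a b ∨ (s₀.inList u w = true ∧ j = i ∧ a = w ∧ b = u))
      (T + (2 * logBound n + 5)) := by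
  simp only [searchIn, ends_bind, ends_tick, ends_get, ends_pure]
  split_ifs with hc
  · rw [show s.inList = s₀.inList from h.inList] at hc
    exact (ends_pailsInsert (h.addTime 1) w u hi).mono fun _ _ h => h.congr
      (fun _ _ _ _ => by simp [hc]) (by omega)
  · rw [show s.inList = s₀.inList from h.inList] at hc
    exact ends_pure.2 ((h.addTime 1).congr (fun _ _ _ _ => by simp [hc]) (by omega))

theorem mul_length_windowList_le (s : Store n) {lo hi d : ℕ} (h : hi - lo ≤ d) (c : ℕ) :
    (windowList s lo hi).length * c ≤ d * c :=
  Nat.mul_le_mul_right _ ((length_windowList_le s lo hi).trans h)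

/-- The effect of a swap of `u` and `v` on the set of the pairs at distance at most `τ`. -/
theorem close_swap_iff {P new : Fin n → ℕ} {E : Fin n → Fin n → Prop} {u v : Fin n} {d τ : ℕ}
    (huv : P u < P v) (hd : d = P v - P u) (htop : ∀ a b, E a b → P a < P b)
    (hu : ∀ z, E u z → P v < P z) (hv : ∀ z, E z v → P z < P u)
    (newu : new u = P v) (newv : new v = P u) (newo : ∀ w, w ≠ u → w ≠ v → new w = P w)
    (a b : Fin n) :
    ((((E a b ∧ P b ≤ P a + τ) ∧
      ¬ (b = u ∧ P u - τ ≤ P a ∧ P a < min (P u) (P u + d - τ))) ∧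
      ¬ (a = v ∧ max (P v + τ - d) (P v) + 1 ≤ P b ∧ P b < P v + τ + 1)) ∨
      (E a b ∧ a = u ∧ max (P v) (P u + τ) + 1 ≤ P b ∧ P b < P u + τ + d + 1)) ∨
      (E a b ∧ b = v ∧ P v - τ - d ≤ P a ∧ P a < min (P u) (P v + d - τ)) ↔
    E a b ∧ new b ≤ new a + τ := by
  have hne : u ≠ v := by rintro rfl; omega
  by_cases hE : E a b
  · simp only [hE, true_and]
    have hab := htop a b hE
    by_cases hau : a = u
    · subst hau
      have hb := hu b hE
      have hbu : b ≠ a := by rintro rfl; omega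
      have hbv : b ≠ v := by rintro rfl; omega
      simp only [hbu, hbv, hne, newu, newo b hbu hbv, false_and, not_false_iff, and_true,
        true_and, or_false]
      clear newo hu hv htop
      omega
    · by_cases hav : a = v
      · subst hav
        have hbu : b ≠ u := by rintro rfl; omega
        have hba : b ≠ a := by rintro rfl; omega
        simp only [hbu, hba, hau, newv, newo b hbu hba, false_and, not_false_iff, and_true,
          true_and, or_false]
        clear newo hu hv htop
        omega
      · simp only [hau, hav, newo a hau hav, false_and, not_false_iff, and_true, or_false]
        by_cases hbu : b = u
        · subst hbu
          simp only [hne, newu, true_and, false_and, or_false]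
          clear newo hu hv htop
          omega
        · by_cases hbv : b = v
          · subst hbv
            have := hv a hE
            simp only [hbu, newv, true_and, false_and, not_false_iff, and_true]
            clear newo hu hv htop
            omega
          · simp only [hbu, hbv, newo b hbu hbv, false_and, not_false_iff, and_true, or_false]
  · simp only [hE, false_and, or_false]

/-- The bookkeeping for one level of a swap: everything is linear in `d` and `d * L`, and `d ≤ d *
L`, so a generous constant suffices. -/
theorem swap_time_le {L d k x₁ x₂ x₃ x₄ m₁ m₂ m₃ m₄ T : ℕ} (hL : 1 ≤ L) (hd : 1 ≤ d)
    (h₁ : x₁ ≤ d * (2 * L + 4)) (h₂ : x₂ ≤ d * (2 * L + 4)) (h₃ : x₃ ≤ d * (2 * L + 5))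
    (h₄ : x₄ ≤ 2 * d * (2 * L + 5)) (g₁ : m₁ ≤ d) (g₂ : m₂ ≤ d) (g₃ : m₃ ≤ d) (g₄ : m₄ ≤ 2 * d) :
    T + k * (50 * L * d) + 1 + (m₁ + 1) + x₁ + (m₂ + 1) + x₂ + (m₃ + 1) + x₃ + (m₄ + 1) + x₄ ≤
      T + (k + 1) * (50 * L * d) := by
  have hd1 : d ≤ d * L := Nat.le_mul_of_pos_right _ hL
  have hc : (k + 1) * (50 * L * d) = k * (50 * L * d) + 50 * (d * L) := by ring
  have hx : d * (2 * L + 4) = 2 * (d * L) + 4 * d := by ring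
  have hy : d * (2 * L + 5) = 2 * (d * L) + 5 * d := by ring
  have hz : 2 * d * (2 * L + 5) = 4 * (d * L) + 10 * d := by ring
  omega

/-- A swap of two vertices between which `u` has no out-neighbours and `v` no in-neighbours maintains the
invariant. -/
theorem Good.ends_swap (h : Good p t s) {u v : Fin n} (huv : s.pos u < s.pos v)
    (hu : ∀ z, s.outList u z = true → s.pos v < s.pos z)
    (hv : ∀ z, s.outList z v = true → s.pos z < s.pos u) :
    Ends (swap p t u v) s fun _ s' => Good p t s' ∧ s'.outList = s.outList ∧
      s'.pos = s.pos ∘ Equiv.swap u v ∧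
      s'.time ≤ s.time + 60 * (p + 2) * logBound n * (s.pos v - s.pos u : ℕ) := by
  have hL := one_le_logBound n
  have hne : u ≠ v := by rintro rfl; exact lt_irrefl _ huv
  simp only [swap, ends_bind, ends_getPos, ends_tick, ends_modify]
  set L := logBound n
  have hd : ∃ d, d = (s.pos v : ℕ) - s.pos u := ⟨_, rfl⟩
  obtain ⟨d, hd⟩ := hd
  have huv' : (s.pos u : ℕ) < s.pos v := huv
  simp only [← hd]
  set new : Fin n → Fin n := s.pos ∘ Equiv.swap u v with hnew
  have newu : new u = s.pos v := by simp [hnew]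
  have newv : new v = s.pos u := by simp [hnew]
  have newo : ∀ w, w ≠ u → w ≠ v → new w = s.pos w := fun w h1 h2 => by
    simp [hnew, Equiv.swap_apply_of_ne_of_ne h1 h2]
  have hinj := h.injective
  have htop : ∀ a b, s.outList a b = true → (s.pos a : ℕ) < s.pos b := h.topo
  have hu' : ∀ z, s.outList u z = true → (s.pos v : ℕ) < s.pos z := hu
  have hv' : ∀ z, s.outList z v = true → (s.pos z : ℕ) < s.pos u := hv
  let c := 50 * L * d
  -- Levels in `l` still describe the old order, all other levels already describe the new one,
  -- although the arrays `T` and `T⁻¹` are changed only after the loop.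
  refine (Ends.forM (fun l s' => l.Nodup ∧ (∀ i ∈ l, i < p + 2) ∧ ∃ k, k + l.length = p + 2 ∧
    Rep p s (fun i a b => s.outList a b = true ∧ (i ∈ l → (s.pos b : ℕ) ≤ s.pos a + t i) ∧
      (i ∉ l → (new b : ℕ) ≤ new a + t i)) (s.time + 2 + k * c) s') ?_ ?_).mono ?_
  · rintro i l s1 ⟨hnd, hlt, k, hk, h1⟩
    obtain ⟨hil, hnd⟩ := List.nodup_cons.1 hnd
    have hi := hlt i (by simp)
    simp only [ends_bind, ends_tick, ends_window]
    rw [(h1.addTime _).windowList_eq]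
    refine (ends_forM_erase (fun w R T s h => ends_pailsErase h w u hi) _
      ((h1.addTime _).addTime _)).mono fun _ s2 h2 => ?_
    rw [h2.windowList_eq]
    refine (ends_forM_erase (fun w R T s h => ends_pailsErase h v w hi) _
      (h2.addTime _)).mono fun _ s3 h3 => ?_
    rw [h3.windowList_eq]
    refine (ends_forM_insert (fun w R T s h => h.ends_searchOut u w hi) _
      (h3.addTime _)).mono fun _ s4 h4 => ?_
    rw [h4.windowList_eq]
    refine (ends_forM_insert (fun w R T s h => h.ends_searchIn v w hi) _
      (h4.addTime _)).mono fun _ s5 h5 => ?_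
    refine ⟨hnd, fun j hj => hlt j (by simp [hj]), k + 1, by simp at hk; omega, ?_⟩
    refine h5.congr (fun j _ a b => ?_) ?_
    · simp only [mem_windowList h.vert_pos h.pos_vert, h.in_out]
      by_cases hji : j = i
      · subst hji
        simp only [List.mem_cons, true_or, hil, true_and, not_true, false_imp_iff, true_imp_iff,
          not_false_iff, and_true]
        have e1 : (∃ w, ((s.pos u - t j ≤ s.pos w) ∧
            (s.pos w : ℕ) < min (s.pos u : ℕ) (s.pos u + d - t j)) ∧ a = w ∧ b = u) ↔
            b = u ∧ ((s.pos u - t j ≤ s.pos a) ∧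
            (s.pos a : ℕ) < min (s.pos u : ℕ) (s.pos u + d - t j)) := by
          constructor
          · rintro ⟨w, h1, rfl, h2⟩; exact ⟨h2, h1⟩
          · rintro ⟨h2, h1⟩; exact ⟨a, h1, rfl, h2⟩
        have e2 : (∃ w, ((max (s.pos v + t j - d) (s.pos v : ℕ) + 1 ≤ s.pos w) ∧
            (s.pos w : ℕ) < s.pos v + t j + 1) ∧ a = v ∧ b = w) ↔
            a = v ∧ ((max (s.pos v + t j - d) (s.pos v : ℕ) + 1 ≤ s.pos b) ∧
            (s.pos b : ℕ) < s.pos v + t j + 1) := by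
          constructor
          · rintro ⟨w, h1, h2, rfl⟩; exact ⟨h2, h1⟩
          · rintro ⟨h2, h1⟩; exact ⟨b, h1, h2, rfl⟩
        have e3 : (∃ w, ((max (s.pos v : ℕ) (s.pos u + t j) + 1 ≤ s.pos w) ∧
            (s.pos w : ℕ) < s.pos u + t j + d + 1) ∧ s.outList u w = true ∧ a = u ∧ b = w) ↔
            s.outList a b = true ∧ a = u ∧ ((max (s.pos v : ℕ) (s.pos u + t j) + 1 ≤ s.pos b) ∧
            (s.pos b : ℕ) < s.pos u + t j + d + 1) := by
          constructor
          · rintro ⟨w, h1, h3', rfl, rfl⟩; exact ⟨h3', rfl, h1⟩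
          · rintro ⟨h3', rfl, h1⟩; exact ⟨b, h1, h3', rfl, rfl⟩
        have e4 : (∃ w, ((s.pos v - t j - d ≤ s.pos w) ∧
            (s.pos w : ℕ) < min (s.pos u : ℕ) (s.pos v + d - t j)) ∧ s.outList w v = true ∧
            a = w ∧ b = v) ↔
            s.outList a b = true ∧ b = v ∧ ((s.pos v - t j - d ≤ s.pos a) ∧
            (s.pos a : ℕ) < min (s.pos u : ℕ) (s.pos v + d - t j)) := by
          constructor
          · rintro ⟨w, h1, h3', rfl, rfl⟩; exact ⟨h3', rfl, h1⟩
          · rintro ⟨h3', rfl, h1⟩; exact ⟨a, h1, h3', rfl, rfl⟩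
        rw [e1, e2, e3, e4]
        exact close_swap_iff (P := fun w => (s.pos w : ℕ)) (new := fun w => (new w : ℕ))
          (E := fun a b => s.outList a b = true) huv' hd htop hu' hv' (by rw [newu]) (by rw [newv])
          (fun w h1 h2 => by rw [newo w h1 h2]) a b
      · simp only [hji, false_and, and_false, exists_false, not_false_iff, and_true,
          or_false, List.mem_cons, false_or]
    · have w1 := mul_length_windowList_le s (lo := s.pos u - t i)
        (hi := min (s.pos u : ℕ) (s.pos u + d - t i)) (d := d) (by omega) (2 * L + 4)
      have w2 := mul_length_windowList_le s (lo := max (s.pos v + t i - d) (s.pos v : ℕ) + 1)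
        (hi := s.pos v + t i + 1) (d := d) (by omega) (2 * L + 4)
      have w3 := mul_length_windowList_le s (lo := max (s.pos v : ℕ) (s.pos u + t i) + 1)
        (hi := s.pos u + t i + d + 1) (d := d) (by omega) (2 * L + 5)
      -- The last window extends up to `d` positions beyond the pairs that really change; inserting
      -- a pair that is present already is harmless, and the length is still at most `2 * d`.
      have w4 := mul_length_windowList_le s (lo := s.pos v - t i - d)
        (hi := min (s.pos u : ℕ) (s.pos v + d - t i)) (d := 2 * d) (by omega) (2 * L + 5)
      exact swap_time_le hL (by omega) w1 w2 w3 w4 (by omega) (by omega) (by omega) (by omega)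
  · refine ⟨List.nodup_range, fun i hi => List.mem_range.1 hi, 0, by simp, ?_⟩
    refine ((h.rep.addTime 1).addTime 1).congr (fun i hi a b => ?_) (by omega)
    simp [hi]
  · rintro _ s1 ⟨-, -, k, hk, h1⟩
    have hpos : Function.update (Function.update s1.pos u (s1.pos v)) v (s1.pos u) = new := by
      funext w
      rw [h1.pos]
      by_cases hwv : w = v
      · subst hwv; simp [newv]
      · by_cases hwu : w = u
        · subst hwu; simp [newu, hwv]
        · simp [hwv, hwu, newo w hwu hwv]
    have hvert : Function.update (Function.update s1.vert (s1.pos u) v) (s1.pos v) u =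
        Equiv.swap u v ∘ s.vert := by
      funext x
      rw [h1.pos, h1.vert]
      by_cases hxv : x = s.pos v
      · subst hxv; simp [h.vert_pos]
      · by_cases hxu : x = s.pos u
        · subst hxu; simp [h.vert_pos, hxv]
        · simp only [ne_eq, hxv, not_false_eq_true, Function.update_of_ne, hxu, Function.comp]
          rw [Equiv.swap_apply_of_ne_of_ne]
          · rintro rfl; exact hxu (h.pos_vert x).symm
          · rintro rfl; exact hxv (h.pos_vert x).symm
    refine ⟨⟨?_, ?_, ?_, ?_, ?_⟩, h1.outList, hpos, ?_⟩
    · intro w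
      dsimp only
      rw [hpos, hvert]
      simp [hnew, h.vert_pos]
    · intro x
      dsimp only
      rw [hpos, hvert]
      simp [hnew, h.pos_vert]
    · intro a b
      dsimp only
      rw [h1.inList, h1.outList, h.in_out]
    · intro a b hab
      dsimp only at hab ⊢
      rw [h1.outList] at hab
      rw [hpos, Fin.lt_def]
      have hlt := htop a b hab
      by_cases hau : a = u
      · subst hau
        have hb := hu' b hab
        have hbu : b ≠ a := by rintro rfl; omega
        have hbv : b ≠ v := by rintro rfl; omega
        rw [newu, newo b hbu hbv]; exact hb
      · by_cases hav : a = v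
        · subst hav
          have hbu : b ≠ u := by rintro rfl; omega
          have hba : b ≠ a := by rintro rfl; omega
          rw [newv, newo b hbu hba]; omega
        · rw [newo a hau hav]
          by_cases hbu : b = u
          · subst hbu; rw [newu]; omega
          · by_cases hbv : b = v
            · subst hbv; rw [newv]; exact hv' a hab
            · rw [newo b hbu hbv]; exact hlt
    · have := h1.pails
      dsimp only
      rw [h1.outList, hpos]
      simp only [List.not_mem_nil, false_imp_iff, not_false_iff, true_imp_iff, true_and] at this
      exact this
    · have h2 := h1.time
      simp only [List.length_nil, add_zero] at hk
      subst hk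
      have hd0 : 1 ≤ d * L := Nat.mul_pos (by omega) hL
      have e1 : (p + 2) * c = 50 * ((p + 2) * (d * L)) := by simp only [c]; ring
      have e2 : 60 * (p + 2) * L * d = 60 * ((p + 2) * (d * L)) := by ring
      rw [e1] at h2
      rw [e2]
      -- The steps outside the loop over the levels are absorbed in the margin between 50 and 60.
      have e3 : (p + 2) * 1 ≤ (p + 2) * (d * L) := Nat.mul_le_mul_left _ hd0
      omega

/-- The insertion of an edge that agrees with the order maintains the invariant. -/
theorem Good.ends_insertEdge (h : Good p t s) {u v : Fin n} (huv : s.pos u < s.pos v) :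
    Ends (insertEdge p t u v) s fun _ s' => Good p t s' ∧
      (∀ a b, s'.outList a b = true ↔ s.outList a b = true ∨ (a = u ∧ b = v)) ∧
      s'.pos = s.pos ∧ s'.time ≤ s.time + 9 * (p + 2) * logBound n := by
  have hL := one_le_logBound n
  simp only [insertEdge, ends_bind, ends_tick, ends_modify, ends_getPos]
  set L := logBound n
  have huv' : (s.pos u : ℕ) < s.pos v := huv
  set out' := Function.update s.outList u (Function.update (s.outList u) v true) with hout
  set in' := Function.update s.inList v (Function.update (s.inList v) u true) with hin
  have hout' : ∀ a b, out' a b = true ↔ s.outList a b = true ∨ (a = u ∧ b = v) := by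
    intro a b
    by_cases ha : a = u
    · subst ha
      by_cases hb : b = v
      · subst hb; simp [hout]
      · simp [hout, hb]
    · simp [hout, ha]
  have hin' : ∀ a b, in' b a = true ↔ s.outList a b = true ∨ (a = u ∧ b = v) := by
    intro a b
    by_cases hb : b = v
    · subst hb
      by_cases ha : a = u
      · subst ha; simp [hin]
      · simp [hin, ha, h.in_out]
    · simp [hin, hb, h.in_out]
  let s₀ : Store n := { s with outList := out', inList := in' }
  -- The adjacency lists already contain the new edge; in the pails it is present exactly at the
  -- treated levels whose threshold admits it.
  refine (Ends.forM (fun l s' => l.Nodup ∧ (∀ i ∈ l, i < p + 2) ∧ ∃ k, k + l.length = p + 2 ∧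
    Rep p s₀ (fun i a b => (s.outList a b = true ∧ (s.pos b : ℕ) ≤ s.pos a + t i) ∨
      (i ∉ l ∧ (a = u ∧ b = v) ∧ (s.pos b : ℕ) ≤ s.pos a + t i))
      (s.time + 4 + k * (2 * L + 5)) s') ?_ ?_).mono ?_
  · rintro i l s1 ⟨hnd, hlt, k, hk, h1⟩
    obtain ⟨hil, hnd⟩ := List.nodup_cons.1 hnd
    have hi := hlt i (by simp)
    refine Ends.mono (Q := fun _ => Rep p s₀ (fun i a b =>
      (s.outList a b = true ∧ (s.pos b : ℕ) ≤ s.pos a + t i) ∨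
      (i ∉ l ∧ (a = u ∧ b = v) ∧ (s.pos b : ℕ) ≤ s.pos a + t i))
      (s.time + 4 + (k + 1) * (2 * L + 5))) ?_ fun _ s2 h2 =>
      ⟨hnd, fun j hj => hlt j (by simp [hj]), k + 1, by simp at hk; omega, h2⟩
    split_ifs with hc
    · refine (ends_pailsInsert (h1.addTime 1) u v hi).mono fun _ s2 h2 => h2.congr ?_ ?_
      · intro j _ a b
        have hc' : (s.pos v : ℕ) ≤ s.pos u + t i := by unfold Nat.dist at hc; omega
        by_cases hab : a = u ∧ b = v
        · obtain ⟨rfl, rfl⟩ := hab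
          by_cases hji : j = i
          · subst hji; simp [hc', hil]
          · simp [hji]
        · simp only [hab, false_and, and_false, or_false]
      · rw [add_mul]; omega
    · refine ends_pure.2 ((h1.addTime 1).congr ?_ ?_)
      · intro j _ a b
        have hc' : ¬ (s.pos v : ℕ) ≤ s.pos u + t i := by unfold Nat.dist at hc; omega
        by_cases hab : a = u ∧ b = v
        · obtain ⟨rfl, rfl⟩ := hab
          by_cases hji : j = i
          · subst hji; simp [hc', hil]
          · simp [hji]
        · simp only [hab, false_and, and_false, or_false]
      · rw [add_mul]; omega
  · refine ⟨List.nodup_range, fun i hi => List.mem_range.1 hi, 0, by simp, rfl, rfl, rfl, rfl, ?_, ?_⟩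
    · dsimp only; omega
    · intro i hi a
      have := h.pails i hi a
      simpa [hi] using this
  · rintro _ s1 ⟨-, -, k, hk, h1⟩
    simp only [List.length_nil, add_zero] at hk
    subst hk
    refine ⟨⟨?_, ?_, ?_, ?_, ?_⟩, ?_, h1.pos, ?_⟩
    · rw [h1.pos, h1.vert]; exact h.vert_pos
    · rw [h1.pos, h1.vert]; exact h.pos_vert
    · intro a b
      rw [h1.inList, h1.outList, Bool.eq_iff_iff]
      exact (hin' a b).trans (hout' a b).symm
    · intro a b hab
      rw [h1.outList] at hab
      rw [h1.pos]
      rcases (hout' a b).1 hab with hab | ⟨rfl, rfl⟩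
      · exact h.topo a b hab
      · exact huv
    · refine (h1.congr (fun i _ a b => ?_) le_rfl).pails
      rw [h1.pos, h1.outList, show (s₀.outList a b = true) = (out' a b = true) from rfl, hout']
      simp only [List.not_mem_nil, not_false_iff, true_and]
      show _ ↔ _ ∧ (s.pos b : ℕ) ≤ s.pos a + t i
      tauto
    · intro a b
      rw [h1.outList]
      exact hout' a b
    · have h2 := h1.time
      have e1 : (p + 2) * (2 * L + 5) = 2 * ((p + 2) * L) + 5 * (p + 2) := by ring
      have e2 : 9 * (p + 2) * L = 9 * ((p + 2) * L) := by ring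
      have e3 : (p + 2) * 1 ≤ (p + 2) * L := Nat.mul_le_mul_left _ hL
      omega

end Updates

end OnlineTopo

namespace OnlineTopo

/-! ### Reading off the neighbours -/

/-- `s'` differs from `s` only in that at most `T` more steps have been executed. -/
def Later {n : ℕ} (s : Store n) (T : ℕ) (s' : Store n) : Prop :=
  ∃ k ≤ T, s' = { s with time := s.time + k }

section Neighbours

variable {n p : ℕ} {t : ℕ → ℕ} {s s' : Store n} {T : ℕ}

theorem Later.refl (s : Store n) : Later s 0 s := ⟨0, le_rfl, rfl⟩

theorem Later.addTime (h : Later s T s') (k : ℕ) :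
    Later s (T + k) { s' with time := s'.time + k } := by
  obtain ⟨j, hj, rfl⟩ := h
  exact ⟨j + k, by omega, by simp [add_assoc]⟩

theorem Later.mono (h : Later s T s') {T' : ℕ} (hT : T ≤ T') : Later s T' s' := by
  obtain ⟨j, hj, rfl⟩ := h
  exact ⟨j, by omega, rfl⟩

theorem Later.trans {s'' : Store n} {T' : ℕ} (h : Later s T s') (h' : Later s' T' s'') :
    Later s (T + T') s'' := by
  obtain ⟨j, hj, rfl⟩ := h
  obtain ⟨k, hk, rfl⟩ := h'
  exact ⟨j + k, by omega, by simp [add_assoc]⟩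

theorem Later.pos (h : Later s T s') : s'.pos = s.pos := by obtain ⟨j, hj, rfl⟩ := h; rfl

theorem Later.outList (h : Later s T s') : s'.outList = s.outList := by
  obtain ⟨j, hj, rfl⟩ := h; rfl

theorem Later.time (h : Later s T s') : s'.time ≤ s.time + T := by
  obtain ⟨j, hj, rfl⟩ := h
  exact Nat.add_le_add_left hj _

theorem Later.good (h : Later s T s') (hs : Good p t s) : Good p t s' := by
  obtain ⟨j, hj, rfl⟩ := h
  exact hs.addTime j

theorem length_le_of_sorted {ws A : List (Fin n)} {f : Fin n → Fin n}
    (hA : A.Pairwise fun a b => f a < f b) (hmem : ∀ w ∈ A, w ∈ ws) : A.length ≤ ws.length := by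
  have hnd : A.Nodup := hA.imp fun h => by rintro rfl; exact lt_irrefl _ h
  exact (hnd.subperm hmem).length_le

/-- The tree is keyed by positions, so its in-order traversal, translated back by `T⁻¹`, is sorted
by the topological order. -/
theorem ends_comparisonSort (h : ∀ w, s.vert (s.pos w) = w) (h' : ∀ x, s.pos (s.vert x) = x)
    (ws : List (Fin n)) :
    Ends (comparisonSort ws) s fun A s' => Later s (ws.length * (logBound n + 3) + 1) s' ∧
      A.Pairwise (fun a b => s.pos a < s.pos b) ∧ ∀ w, w ∈ A ↔ w ∈ ws := by
  simp only [comparisonSort, ends_bind, ends_get, treeCollect, ends_tick, ends_pure]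
  refine (Ends.foldlM (fun l tr s' => tr.Valid ∧
    (∀ x, (x ∈ tr.toList ∨ x ∈ l.map s.pos) ↔ x ∈ ws.map s.pos) ∧
    ∃ k, k + l.length = ws.length ∧ Later s (k * (logBound n + 1)) s') ?_ ?_).mono ?_
  · rintro w l tr s1 ⟨h1, h2, k, hk, h3⟩
    simp only [treeInsert, ends_bind, ends_tick, ends_pure]
    refine ⟨Ordnode.insert.valid _ h1, fun x => ?_, k + 1, by simp at hk; omega, ?_⟩
    · rw [mem_toList_insert h1, ← h2, List.map_cons, List.mem_cons]
      tauto
    · have := (insertSteps_le (s.pos w) tr).trans (height_lt_logBound h1)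
      exact ((h3.addTime 1).addTime _).mono (by rw [add_mul]; omega)
  · exact ⟨Ordnode.valid_nil, fun x => by simp, 0, by simp, (Later.refl s).mono (by simp)⟩
  · rintro tr s1 ⟨h1, h2, k, hk, h3⟩
    simp only [List.length_nil, add_zero] at hk
    subst hk
    have hsort := sorted_toList h1.1
    have hmem : ∀ x, x ∈ tr.toList ↔ x ∈ ws.map s.pos := fun x => by simpa using h2 x
    have hlen : tr.toList.length ≤ ws.length := by
      have hnd : tr.toList.Nodup := hsort.imp fun h => ne_of_lt h
      simpa using (hnd.subperm fun x hx => (hmem x).1 hx).length_le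
    refine ⟨((h3.addTime _).addTime _).mono (by simp only [mul_add]; omega), ?_, ?_⟩
    · rw [List.pairwise_map]
      exact hsort.imp fun h => by simpa [h'] using h
    · intro w
      rw [List.mem_map]
      constructor
      · rintro ⟨x, hx, rfl⟩
        obtain ⟨w, hw, rfl⟩ := List.mem_map.1 ((hmem x).1 hx)
        rwa [h]
      · intro hw
        exact ⟨s.pos w, (hmem _).2 (List.mem_map_of_mem hw), h w⟩

/-- The buckets hold exactly the treated prefix `k`. The lower bound `c` keeps the truncated
subtraction faithful, and injectivity of the order excludes two vertices in one bucket. -/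
theorem ends_countingSort (h : Function.Injective s.pos) {c m : ℕ} {ws : List (Fin n)}
    (hws : ∀ w ∈ ws, c ≤ s.pos w ∧ (s.pos w : ℕ) ≤ c + m) :
    Ends (countingSort c m ws) s fun A s' => Later s (2 * (m + 1) + 2 * ws.length) s' ∧
      A.Pairwise (fun a b => s.pos a < s.pos b) ∧ ∀ w, w ∈ A ↔ w ∈ ws := by
  simp only [countingSort, ends_bind, ends_tick, ends_pure]
  refine (Ends.foldlM (fun l b s' => ∃ k, k.length + l.length = ws.length ∧ k ++ l = ws ∧
    (∀ x w, b x = some w ↔ w ∈ k ∧ s.pos w - c = x) ∧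
    Later s (m + 1 + 2 * k.length) s') ?_ ?_).mono ?_
  · rintro w l b s1 ⟨k, hk, hkl, hb, h1⟩
    simp only [ends_bind, ends_getPos, ends_tick, ends_pure]
    refine ⟨k ++ [w], by simp at hk ⊢; omega, by simp [hkl], fun x w' => ?_, ?_⟩
    · rw [h1.pos]
      by_cases hx : x = s.pos w - c
      · subst hx
        simp only [Function.update_self, Option.some.injEq, List.mem_append, List.mem_singleton]
        refine ⟨by rintro rfl; simp, fun ⟨h2, h3⟩ => ?_⟩
        have hw := hws w (by rw [← hkl]; simp)
        have hw' := hws w' (by rw [← hkl]; simp only [List.mem_append, List.mem_cons]; tauto)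
        exact h (Fin.ext (by omega))
      · rw [Function.update_of_ne hx, hb, List.mem_append, List.mem_singleton]
        constructor
        · rintro ⟨h2, h3⟩; exact ⟨Or.inl h2, h3⟩
        · rintro ⟨h2 | rfl, h3⟩
          · exact ⟨h2, h3⟩
          · exact absurd h3.symm hx
    · exact ((h1.addTime 1).addTime 1).mono (by simp; omega)
  · exact ⟨[], by simp, by simp, fun x w => by simp, ((Later.refl s).addTime _).mono (by simp)⟩
  · rintro b s1 ⟨k, hk, hkl, hb, h1⟩
    simp only [List.append_nil] at hkl
    subst hkl
    refine ⟨(h1.addTime _).mono (by omega), ?_, ?_⟩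
    · rw [List.pairwise_filterMap]
      refine List.pairwise_lt_range.imp fun {x y} hxy w hw w' hw' => ?_
      have h2 := (hb x w).1 hw
      have h3 := (hb y w').1 hw'
      rw [Fin.lt_def]
      omega
    · intro w
      rw [List.mem_filterMap]
      constructor
      · rintro ⟨x, -, hx⟩
        exact ((hb x w).1 hx).1
      · intro hw
        have := hws w hw
        exact ⟨s.pos w - c, List.mem_range.2 (by omega), (hb _ _).2 ⟨hw, rfl⟩⟩

theorem length_le_of_pos (h : Function.Injective s.pos) {ws : List (Fin n)} (hnd : ws.Nodup)
    {c m : ℕ} (hws : ∀ w ∈ ws, c ≤ s.pos w ∧ (s.pos w : ℕ) < c + m) : ws.length ≤ m := by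
  have h1 : (ws.map fun w => (s.pos w : ℕ)).Nodup :=
    hnd.map fun a b hab => h (Fin.ext hab)
  have h2 : (ws.map fun w => (s.pos w : ℕ)) ⊆ List.range' c m := by
    intro x hx
    obtain ⟨w, hw, rfl⟩ := List.mem_map.1 hx
    exact List.mem_range'_1.2 (hws w hw)
  simpa using (h1.subperm h2).length_le

theorem ends_filter_sorted {sort : Prog n (List (Fin n))} {s₀ : Store n} {T₀ : ℕ}
    {ws : List (Fin n)} (P : (Fin n → Fin n) → Fin n → Bool) (h₀ : Later s T₀ s₀)
    (hs : Ends sort s₀ fun A s' => Later s₀ T s' ∧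
      A.Pairwise (fun a b => s₀.pos a < s₀.pos b) ∧ ∀ w, w ∈ A ↔ w ∈ ws) :
    Ends (do
      let A ← sort
      let s ← get
      tick (A.length + 1)
      return A.filter (P s.pos)) s₀ fun A s' => Later s (T₀ + T + (ws.length + 1)) s' ∧
      A.Pairwise (fun a b => s.pos a < s.pos b) ∧ ∀ w, w ∈ A ↔ w ∈ ws ∧ P s.pos w = true := by
  simp only [ends_bind, ends_get, ends_tick, ends_pure]
  refine hs.mono ?_
  rintro A s' ⟨h1, h2, h3⟩
  rw [h₀.pos] at h2
  have := length_le_of_sorted h2 fun w hw => (h3 w).1 hw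
  have h4 : T₀ + T + (A.length + 1) ≤ T₀ + T + (ws.length + 1) := by omega
  refine ⟨((h₀.trans h1).addTime _).mono h4, ?_⟩
  rw [(h₀.trans h1).pos]
  exact ⟨h2.filter _, fun w => by rw [List.mem_filter, h3]⟩

theorem sort_time_le {L l T : ℕ} (hL : 1 ≤ L) (hT : T = l + 4 + (l * (L + 3) + 1) + (l + 1)) :
    T ≤ 6 * L * (l + 1) := by
  have e1 : l * (L + 3) = l * L + 3 * l := by ring
  have e2 : 6 * L * (l + 1) = 6 * (l * L) + 6 * L := by ring
  have e3 : l * 1 ≤ l * L := Nat.mul_le_mul_left _ hL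
  omega

/-- Two cost bounds are needed: proportional to the output when sorting by comparisons, and
proportional to `t i` when counting. The second holds because a pail of level `i` has at most `t i`
elements, their positions being distinct. -/
theorem Good.ends_hatA (h : Good p t s) (cmp : Bool) (u v : Fin n) {i : ℕ} (hi : i < p + 2) :
    Ends (hatA t cmp u v i) s fun A s' => ∃ T, Later s T s' ∧
      A.Pairwise (fun a b => s.pos a < s.pos b) ∧
      (∀ w, w ∈ A ↔ s.outList u w = true ∧ (s.pos w : ℕ) ≤ s.pos u + t i ∧ s.pos w < s.pos v) ∧
      (cmp = true → s.pos u + t i < s.pos v → T ≤ 6 * logBound n * (A.length + 1)) ∧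
      (cmp = false → T ≤ 10 * (t i + 1)) := by
  have hL := one_le_logBound n
  simp only [hatA, ends_bind, ends_getPos, getOutPail, treeCollect, ends_tick, ends_get, ends_pure]
  obtain ⟨hval, hmem⟩ := (h.pails i hi u).1
  have hnd : (s.outPails u i).toList.Nodup := (sorted_toList hval.1).imp fun h => ne_of_lt h
  generalize (s.outPails u i).toList = ws at *
  have hpos : ∀ w ∈ ws, (s.pos u : ℕ) + 1 ≤ s.pos w ∧ (s.pos w : ℕ) < s.pos u + 1 + t i := by
    intro w hw
    have h1 := (hmem w).1 hw
    have h2 : (s.pos u : ℕ) < s.pos w := h.topo _ _ h1.1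
    omega
  have hlen := length_le_of_pos h.injective hnd hpos
  let s₀ : Store n := { s with time := s.time + 1 + 1 + 1 + (ws.length + 1) }
  have h0 : Later s (ws.length + 4) s₀ := ⟨ws.length + 4, le_rfl, by simp only [s₀]; congr 1; omega⟩
  let P : (Fin n → Fin n) → Fin n → Bool := fun f w => decide ((f w : ℕ) < s.pos v)
  have hP : ∀ w, (w ∈ ws ∧ P s.pos w = true) ↔
      s.outList u w = true ∧ (s.pos w : ℕ) ≤ s.pos u + t i ∧ s.pos w < s.pos v := fun w => by
    rw [hmem, decide_eq_true_eq, Fin.lt_def, and_assoc]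
  cases cmp
  · have := ends_countingSort (s := s₀) h.injective (c := s.pos u) (m := t i) (ws := ws)
      fun w hw => by
        have := hpos w hw
        exact ⟨by show (s.pos u : ℕ) ≤ s.pos w; omega, by show (s.pos w : ℕ) ≤ _; omega⟩
    have := ends_filter_sorted P h0 this
    simp only [Bool.false_eq_true, if_false]
    refine this.mono fun A s' ⟨h1, h2, h3⟩ => ?_
    exact ⟨_, h1, h2, fun w => (h3 w).trans (hP w), by simp, fun _ => by omega⟩
  · have := ends_filter_sorted P h0 (ends_comparisonSort (s := s₀) h.vert_pos h.pos_vert ws)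
    simp only [if_true]
    refine this.mono fun A s' ⟨h1, h2, h3⟩ => ?_
    refine ⟨_, h1, h2, fun w => (h3 w).trans (hP w), fun _ h4 => ?_, by simp⟩
    -- As `t i` is less than the distance of `u` and `v`, the whole pail precedes `v` and the filter
    -- discards nothing; the cost is thus bounded by the output.
    have : ws.length ≤ A.length := (hnd.subperm fun w hw => (h3 w).2 ⟨hw, by
      have := hpos w hw
      exact decide_eq_true (by omega)⟩).length_le
    exact (sort_time_le hL rfl).trans (Nat.mul_le_mul_left _ (by omega))

theorem Good.ends_hatB (h : Good p t s) (cmp : Bool) (u v : Fin n) {i : ℕ} (hi : i < p + 2) :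
    Ends (hatB t cmp u v i) s fun B s' => ∃ T, Later s T s' ∧
      B.Pairwise (fun a b => s.pos a < s.pos b) ∧
      (∀ w, w ∈ B ↔ s.outList w v = true ∧ (s.pos v : ℕ) ≤ s.pos w + t i ∧ s.pos u < s.pos w) ∧
      (cmp = true → s.pos u + t i < s.pos v → T ≤ 6 * logBound n * (B.length + 1)) ∧
      (cmp = false → T ≤ 10 * (t i + 1)) := by
  have hL := one_le_logBound n
  simp only [hatB, ends_bind, ends_getPos, getInPail, treeCollect, ends_tick, ends_get, ends_pure]
  obtain ⟨hval, hmem⟩ := (h.pails i hi v).2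
  have hnd : (s.inPails v i).toList.Nodup := (sorted_toList hval.1).imp fun h => ne_of_lt h
  generalize (s.inPails v i).toList = ws at *
  have hpos : ∀ w ∈ ws, (s.pos v : ℕ) ≤ s.pos w + t i ∧ (s.pos w : ℕ) < s.pos v := by
    intro w hw
    have h1 := (hmem w).1 hw
    have h2 : (s.pos w : ℕ) < s.pos v := h.topo _ _ h1.1
    omega
  have hlen := length_le_of_pos h.injective hnd (c := s.pos v - t i) (m := t i) fun w hw => by
    have := hpos w hw
    omega
  let s₀ : Store n := { s with time := s.time + 1 + 1 + 1 + (ws.length + 1) }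
  have h0 : Later s (ws.length + 4) s₀ := ⟨ws.length + 4, le_rfl, by simp only [s₀]; congr 1; omega⟩
  let P : (Fin n → Fin n) → Fin n → Bool := fun f w => decide ((s.pos u : ℕ) < f w)
  have hP : ∀ w, (w ∈ ws ∧ P s.pos w = true) ↔
      s.outList w v = true ∧ (s.pos v : ℕ) ≤ s.pos w + t i ∧ s.pos u < s.pos w := fun w => by
    rw [hmem, decide_eq_true_eq, Fin.lt_def, and_assoc]
  cases cmp
  · have := ends_countingSort (s := s₀) h.injective (c := s.pos v - t i) (m := t i) (ws := ws)
      fun w hw => by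
        have := hpos w hw
        exact ⟨by show _ ≤ (s.pos w : ℕ); omega, by show (s.pos w : ℕ) ≤ _; omega⟩
    have := ends_filter_sorted P h0 this
    simp only [Bool.false_eq_true, if_false]
    refine this.mono fun B s' ⟨h1, h2, h3⟩ => ?_
    exact ⟨_, h1, h2, fun w => (h3 w).trans (hP w), by simp, fun _ => by omega⟩
  · have := ends_filter_sorted P h0 (ends_comparisonSort (s := s₀) h.vert_pos h.pos_vert ws)
    simp only [if_true]
    refine this.mono fun B s' ⟨h1, h2, h3⟩ => ?_
    refine ⟨_, h1, h2, fun w => (h3 w).trans (hP w), fun _ h4 => ?_, by simp⟩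
    have : ws.length ≤ B.length := (hnd.subperm fun w hw => (h3 w).2 ⟨hw, by
      have := hpos w hw
      exact decide_eq_true (by omega)⟩).length_le
    exact (sort_time_le hL rfl).trans (Nat.mul_le_mul_left _ (by omega))

theorem ends_findLevel {d : ℕ} {Q : Option ℕ → Store n → Prop} :
    Ends (findLevel p t d) s Q ↔ Q ((List.range (p + 1)).find? fun i => t i < d ∧ d ≤ t (i + 1))
      { s with time := s.time + (p + 1) } := by
  simp only [findLevel, ends_bind, ends_tick, ends_pure]

theorem findLevel_some {d i : ℕ}
    (h : ((List.range (p + 1)).find? fun i => t i < d ∧ d ≤ t (i + 1)) = some i) :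
    i < p + 1 ∧ t i < d ∧ d ≤ t (i + 1) := by
  have h1 := List.find?_some h
  have h2 := List.mem_of_find?_eq_some h
  rw [decide_eq_true_eq] at h1
  exact ⟨List.mem_range.1 h2, h1⟩

theorem findLevel_none {d : ℕ} (hd : d ≤ t (p + 1))
    (h : ((List.range (p + 1)).find? fun i => t i < d ∧ d ≤ t (i + 1)) = none) : d ≤ t 0 := by
  rw [List.find?_eq_none] at h
  -- Descent from the top threshold: a first failure would exhibit a level. Monotonicity of `t` is
  -- not needed.
  have : ∀ i ≤ p + 1, d ≤ t (p + 1 - i) := by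
    intro i
    induction i with
    | zero => intro _; exact hd
    | succ i ih =>
      intro hi
      have h1 := ih (by omega)
      have h2 := h (p + 1 - (i + 1)) (List.mem_range.2 (by omega))
      rw [decide_eq_true_eq, show p + 1 - (i + 1) + 1 = p + 1 - i by omega] at h2
      by_contra hc
      exact h2 ⟨by omega, h1⟩
  simpa using this (p + 1) le_rfl

end Neighbours

/-! ### The pairs treated by the nested loops -/

section LoopPairs

variable {n : ℕ} {f : Fin n → Fin n} {u v : Fin n} {A B : List (Fin n)}

theorem mem_takeWhile_of_sorted {l : List (Fin n)} (hl : l.Pairwise fun a b => f b < f a)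
    (c : Fin n) (y : Fin n) :
    (y ∈ l.takeWhile fun w => c < f w) ↔ y ∈ l ∧ c < f y := by
  induction l with
  | nil => simp
  | cons a l ih =>
    obtain ⟨h1, h2⟩ := List.pairwise_cons.1 hl
    by_cases hc : c < f a
    · rw [List.takeWhile_cons_of_pos (by simpa using hc), List.mem_cons, ih h2, List.mem_cons]
      constructor
      · rintro (rfl | h)
        · exact ⟨Or.inl rfl, hc⟩
        · exact ⟨Or.inr h.1, h.2⟩
      · rintro ⟨rfl | h, h'⟩
        · exact Or.inl rfl
        · exact Or.inr ⟨h, h'⟩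
    · rw [List.takeWhile_cons_of_neg (by simpa using hc)]
      simp only [List.not_mem_nil, List.mem_cons, false_iff, not_and]
      rintro (rfl | h)
      · exact hc
      · exact fun h3 => hc (h3.trans (h1 y h))

theorem mem_loopPairs (hB : B.Pairwise fun a b => f a < f b) (hv : ∀ b ∈ B, f b < f v)
    (q : Fin n × Fin n) :
    q ∈ loopPairs f u v A B ↔ (q.1 = u ∨ q.1 ∈ A) ∧ (q.2 ∈ B ∨ q.2 = v) ∧ f q.1 < f q.2 := by
  have hs : (B ++ [v]).reverse.Pairwise fun a b => f b < f a := by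
    rw [List.pairwise_reverse, List.pairwise_append]
    exact ⟨hB, by simp, fun a ha b hb => by rw [List.mem_singleton.1 hb]; exact hv a ha⟩
  simp only [loopPairs, List.mem_flatMap, List.mem_reverse, List.mem_map]
  constructor
  · rintro ⟨x, hx, y, hy, rfl⟩
    rw [mem_takeWhile_of_sorted hs] at hy
    exact ⟨List.mem_cons.1 hx, by simpa [or_comm] using hy.1, hy.2⟩
  · rintro ⟨h1, h2, h3⟩
    exact ⟨q.1, by simpa using h1, q.2, (mem_takeWhile_of_sorted hs _ _).2 ⟨by simpa [or_comm] using h2, h3⟩,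
      rfl⟩

/-- This is the order on which the analysis rests: all pairs of a higher `u'` come before those of a
lower one, and for fixed `u'` the partners ascend. -/
theorem pairwise_loopPairs (hA : A.Pairwise fun a b => f a < f b) (hu : ∀ a ∈ A, f u < f a)
    (hB : B.Pairwise fun a b => f a < f b) (hv : ∀ b ∈ B, f b < f v) :
    (loopPairs f u v A B).Pairwise fun q q' =>
      (q'.1 = q.1 ∧ f q.2 < f q'.2) ∨ f q'.1 < f q.1 := by
  have hs : (B ++ [v]).reverse.Pairwise fun a b => f b < f a := by
    rw [List.pairwise_reverse, List.pairwise_append]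
    exact ⟨hB, by simp, fun a ha b hb => by rw [List.mem_singleton.1 hb]; exact hv a ha⟩
  rw [loopPairs, List.pairwise_flatMap]
  constructor
  · intro a _
    rw [List.pairwise_map, List.pairwise_reverse]
    exact (hs.sublist (List.takeWhile_sublist _)).imp fun h => Or.inl ⟨rfl, h⟩
  · rw [List.pairwise_reverse, List.pairwise_cons]
    have key : ∀ a b, f a < f b →
        ∀ x ∈ ((B ++ [v]).reverse.takeWhile fun v' => f b < f v').reverse.map fun v' => (b, v'),
        ∀ y ∈ ((B ++ [v]).reverse.takeWhile fun v' => f a < f v').reverse.map fun v' => (a, v'),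
        (y.1 = x.1 ∧ f x.2 < f y.2) ∨ f y.1 < f x.1 := by
      intro a b hab x hx y hy
      obtain ⟨x', -, rfl⟩ := List.mem_map.1 hx
      obtain ⟨y', -, rfl⟩ := List.mem_map.1 hy
      exact Or.inr hab
    exact ⟨fun a ha => key _ _ (hu a ha), hA.imp fun h => key _ _ h⟩

/-- The pairs `(a, v)` and the pairs `(u, b)` all occur. Hence the work on `A` and `B` is linear in
the number of recursive calls, and there are at least two calls unless both sets are empty. -/
theorem length_add_one_le_loopPairs (hA : A.Pairwise fun a b => f a < f b)
    (hu : ∀ a ∈ A, f u < f a) (hB : B.Pairwise fun a b => f a < f b) (hv : ∀ b ∈ B, f b < f v)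
    (hAv : ∀ a ∈ A, f a < f v) (hBu : ∀ b ∈ B, f u < f b) (huv : f u < f v) :
    A.length + 1 ≤ (loopPairs f u v A B).length ∧ B.length + 1 ≤ (loopPairs f u v A B).length := by
  have ne : ∀ {a b : Fin n}, f a < f b → a ≠ b := by rintro a _ h rfl; exact lt_irrefl _ h
  constructor
  · have hnd : ((u :: A).map fun a => (a, v)).Nodup := by
      refine List.Nodup.map (fun a b h => (Prod.ext_iff.1 h).1) ?_
      exact List.pairwise_cons.2 ⟨fun a ha => ne (hu a ha), hA.imp fun h => ne h⟩
    refine le_trans (by simp) (hnd.subperm (l₂ := loopPairs f u v A B) fun q hq => ?_).length_le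
    obtain ⟨a, ha, rfl⟩ := List.mem_map.1 hq
    rw [mem_loopPairs hB hv]
    rcases List.mem_cons.1 ha with rfl | ha
    · exact ⟨Or.inl rfl, Or.inr rfl, huv⟩
    · exact ⟨Or.inr ha, Or.inr rfl, hAv a ha⟩
  · have hnd : ((v :: B).map fun b => (u, b)).Nodup := by
      refine List.Nodup.map (fun a b h => (Prod.ext_iff.1 h).2) ?_
      exact List.pairwise_cons.2 ⟨fun a ha => (ne (hv a ha)).symm, hB.imp fun h => ne h⟩
    refine le_trans (by simp) (hnd.subperm (l₂ := loopPairs f u v A B) fun q hq => ?_).length_le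
    obtain ⟨b, hb, rfl⟩ := List.mem_map.1 hq
    rw [mem_loopPairs hB hv]
    rcases List.mem_cons.1 hb with rfl | hb
    · exact ⟨Or.inl rfl, Or.inr rfl, huv⟩
    · exact ⟨Or.inl rfl, Or.inl hb, hBu b hb⟩

end LoopPairs

end OnlineTopo

namespace OnlineTopo

/-! ### Sequences of swaps -/

/-- The order `g` arises from `f` by `N` swaps of a vertex in `U` with a higher vertex in `V`, all at
positions between `lo` and `hi`. The sum of the square roots of the distances is `S`. -/
inductive Moves {n : ℕ} (U V : Fin n → Prop) (lo hi : ℕ) (f : Fin n → Fin n) :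
    (Fin n → Fin n) → ℕ → ℝ → Prop
  | refl : Moves U V lo hi f f 0 0
  | step {g : Fin n → Fin n} {N : ℕ} {S : ℝ} {x y : Fin n} : Moves U V lo hi f g N S → U x → V y →
      lo ≤ g x → g x < g y → g y ≤ hi →
      Moves U V lo hi f (g ∘ Equiv.swap x y) (N + 1) (S + √((g y : ℝ) - g x))

section Moves

variable {n : ℕ} {U V U' V' : Fin n → Prop} {lo hi lo' hi' : ℕ} {f g h : Fin n → Fin n} {N N' : ℕ}
  {S S' : ℝ}

theorem comp_swap_cases (g : Fin n → Fin n) (x y w : Fin n) :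
    (w = x ∧ (g ∘ Equiv.swap x y) w = g y) ∨ (w = y ∧ (g ∘ Equiv.swap x y) w = g x) ∨
      (w ≠ x ∧ w ≠ y ∧ (g ∘ Equiv.swap x y) w = g w) := by
  by_cases hx : w = x
  · subst hx; simp
  · by_cases hy : w = y
    · subst hy; simp
    · simp [hx, hy, Equiv.swap_apply_of_ne_of_ne]

theorem Moves.trans (h₁ : Moves U V lo hi f g N S) (h₂ : Moves U V lo hi g h N' S') :
    Moves U V lo hi f h (N + N') (S + S') := by
  induction h₂ with
  | refl => simpa using h₁
  | step _ hx hy h3 h4 h5 ih => rw [← add_assoc, ← add_assoc]; exact ih.step hx hy h3 h4 h5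

theorem Moves.mono (hm : Moves U V lo hi f g N S) (hU : ∀ x, U x → U' x) (hV : ∀ x, V x → V' x)
    (hlo : lo' ≤ lo) (hhi : hi ≤ hi') : Moves U' V' lo' hi' f g N S := by
  induction hm with
  | refl => exact .refl
  | step _ hx hy h3 h4 h5 ih => exact ih.step (hU _ hx) (hV _ hy) (hlo.trans h3) h4 (h5.trans hhi)

theorem Moves.nonneg (hm : Moves U V lo hi f g N S) : 0 ≤ S := by
  induction hm with
  | refl => exact le_rfl
  | step _ _ _ _ _ _ ih => positivity

theorem Moves.up (hm : Moves U V lo hi f g N S) (hUV : ∀ x, U x → ¬ V x) {w : Fin n} (hw : U w) :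
    f w ≤ g w := by
  induction hm with
  | refl => exact le_rfl
  | @step g N S x y _ hx hy h3 h4 h5 ih =>
    rcases comp_swap_cases g x y w with ⟨rfl, h⟩ | ⟨rfl, h⟩ | ⟨-, -, h⟩ <;> rw [h]
    · exact ih.trans h4.le
    · exact absurd hy (hUV _ hw)
    · exact ih

theorem Moves.down (hm : Moves U V lo hi f g N S) (hUV : ∀ x, U x → ¬ V x) {w : Fin n} (hw : V w) :
    g w ≤ f w := by
  induction hm with
  | refl => exact le_rfl
  | @step g N S x y _ hx hy h3 h4 h5 ih =>
    rcases comp_swap_cases g x y w with ⟨rfl, h⟩ | ⟨rfl, h⟩ | ⟨-, -, h⟩ <;> rw [h]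
    · exact absurd hw (hUV _ hx)
    · exact h4.le.trans ih
    · exact ih

theorem Moves.inside (hm : Moves U V lo hi f g N S) {w : Fin n} (hw : lo ≤ f w ∧ f w ≤ hi) :
    lo ≤ g w ∧ g w ≤ hi := by
  induction hm with
  | refl => exact hw
  | @step g N S x y _ hx hy h3 h4 h5 ih =>
    have h4' : (g x : ℕ) < g y := h4
    rcases comp_swap_cases g x y w with ⟨rfl, h⟩ | ⟨rfl, h⟩ | ⟨-, -, h⟩ <;> rw [h]
    · exact ⟨by omega, h5⟩
    · exact ⟨h3, by omega⟩
    · exact ih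

theorem Moves.outside (hm : Moves U V lo hi f g N S) {w : Fin n} (hw : f w < lo ∨ hi < f w) :
    g w = f w := by
  induction hm with
  | refl => rfl
  | @step g N S x y _ hx hy h3 h4 h5 ih =>
    have h4' : (g x : ℕ) < g y := h4
    rcases comp_swap_cases g x y w with ⟨rfl, h⟩ | ⟨rfl, h⟩ | ⟨-, -, h⟩ <;> rw [h]
    · rw [← ih] at hw; omega
    · rw [← ih] at hw; omega
    · exact ih

theorem sqrt_add_le_add_sqrt {a b : ℝ} (ha : 0 ≤ a) (hb : 0 ≤ b) : √(a + b) ≤ √a + √b := by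
  rw [Real.sqrt_le_left (by positivity), add_sq, Real.sq_sqrt ha, Real.sq_sqrt hb]
  have : 0 ≤ 2 * √a * √b := by positivity
  linarith

theorem sqrt_abs_sub_le (a b c : ℝ) : √|a - c| ≤ √|a - b| + √|b - c| :=
  (Real.sqrt_le_sqrt (abs_sub_le a b c)).trans
    (sqrt_add_le_add_sqrt (abs_nonneg _) (abs_nonneg _))

/-- Subadditivity of the square root, applied along the trajectory of `w`; this turns a net
displacement into a lower bound for `S`. -/
theorem Moves.sqrt_le (hm : Moves U V lo hi f g N S) (w : Fin n) :
    √|(g w : ℝ) - f w| ≤ S := by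
  induction hm with
  | refl => simp
  | @step g N S x y _ hx hy h3 h4 h5 ih =>
    have h4' : (g x : ℝ) < g y := by exact_mod_cast h4
    refine (sqrt_abs_sub_le _ (g w : ℝ) _).trans ?_
    rw [add_comm]
    refine add_le_add ih ?_
    rcases comp_swap_cases g x y w with ⟨rfl, h⟩ | ⟨rfl, h⟩ | ⟨-, -, h⟩ <;> rw [h]
    · rw [abs_of_pos (by linarith)]
    · rw [abs_sub_comm, abs_of_pos (by linarith)]
    · simp

/-- If all vertices in `U` other than `u`, and the vertex `v`, lie beyond position `P`, then `u` moves
beyond `P` when it passes `v`. -/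
theorem Moves.far_up (hm : Moves U V lo hi f g N S) (hUV : ∀ x, U x → ¬ V x) {u v : Fin n}
    (hu : U u) {P : ℕ} (hP : ∀ x, U x → x ≠ u → P < f x) (hv : V v) (hPv : P < f v)
    (hgv : g v < g u) : P < g u := by
  -- At all times `u` or `v` is beyond `P`: if `u` swaps with `v` it takes over its place, and if
  -- another vertex of `U` swaps with `v`, then `v` lands where that vertex was, beyond `P`.
  have key : P < g u ∨ P < g v := by
    clear hgv
    induction hm with
    | refl => exact Or.inr hPv
    | @step g N S x y hm hx hy h3 h4 h5 ih =>
      have h4' : (g x : ℕ) < g y := h4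
      have hPx : x ≠ u → P < g x := fun hxu => (hP x hx hxu).trans_le (hm.up hUV hx)
      rcases comp_swap_cases g x y u with ⟨rfl, h⟩ | ⟨rfl, h⟩ | ⟨h6, -, h⟩
      · rcases comp_swap_cases g u y v with ⟨rfl, h'⟩ | ⟨rfl, h'⟩ | ⟨-, -, h'⟩
        · exact absurd hv (hUV _ hu)
        · rw [h]; left; omega
        · rw [h, h']; omega
      · exact absurd hy (hUV _ hu)
      · rcases comp_swap_cases g x y v with ⟨rfl, h'⟩ | ⟨rfl, h'⟩ | ⟨-, -, h'⟩
        · exact absurd hv (hUV _ hx)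
        · rw [h']; exact Or.inr (hPx h6.symm)
        · rw [h, h']; exact ih
  have : (g v : ℕ) < g u := hgv
  omega

/-- The mirror image of `Moves.far_up`. -/
theorem Moves.far_down (hm : Moves U V lo hi f g N S) (hUV : ∀ x, U x → ¬ V x) {u v : Fin n}
    (hv : V v) {P : ℕ} (hP : ∀ x, V x → x ≠ v → f x < P) (hu : U u) (hPu : f u < P)
    (hgv : g v < g u) : g v < P := by
  have key : g v < P ∨ g u < P := by
    clear hgv
    induction hm with
    | refl => exact Or.inr hPu
    | @step g N S x y hm hx hy h3 h4 h5 ih =>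
      have h4' : (g x : ℕ) < g y := h4
      have hPy : y ≠ v → g y < P := fun hyv => lt_of_le_of_lt (hm.down hUV hy) (hP y hy hyv)
      rcases comp_swap_cases g x y v with ⟨rfl, h⟩ | ⟨rfl, h⟩ | ⟨-, h6, h⟩
      · exact absurd hv (hUV _ hx)
      · rcases comp_swap_cases g x v u with ⟨rfl, h'⟩ | ⟨rfl, h'⟩ | ⟨-, -, h'⟩
        · rw [h]; left; omega
        · exact absurd hv (hUV _ hu)
        · rw [h, h']; omega
      · rcases comp_swap_cases g x y u with ⟨rfl, h'⟩ | ⟨rfl, h'⟩ | ⟨-, -, h'⟩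
        · rw [h']; exact Or.inr (hPy h6.symm)
        · exact absurd hy (hUV _ hu)
        · rw [h, h']; exact ih
  have : (g v : ℕ) < g u := hgv
  omega

/-- The agreement of two orders, as measured by the scalar product. -/
def agreement (F f : Fin n → Fin n) : ℕ := ∑ w, (F w : ℕ) * f w

theorem agreement_le (F f : Fin n → Fin n) : agreement F f ≤ n * (n * n) := by
  refine (Finset.sum_le_card_nsmul _ _ (n * n) fun w _ =>
    Nat.mul_le_mul (F w).2.le (f w).2.le).trans ?_
  simp

theorem agreement_comp_swap {F g : Fin n → Fin n} {x y : Fin n} (hF : F y < F x)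
    (hg : g x < g y) :
    agreement F (g ∘ Equiv.swap x y) = agreement F g + (F x - F y) * (g y - g x) := by
  have hxy : x ≠ y := by rintro rfl; exact lt_irrefl _ hF
  have hF' : (F y : ℕ) < F x := hF
  have hg' : (g x : ℕ) < g y := hg
  have split : ∀ φ : Fin n → ℕ, ∑ w, φ w = φ x + (φ y + ∑ w ∈ (Finset.univ.erase x).erase y, φ w) :=
    fun φ => by
      rw [Finset.add_sum_erase _ _ (Finset.mem_erase.2 ⟨hxy.symm, Finset.mem_univ y⟩),
        Finset.add_sum_erase _ _ (Finset.mem_univ x)]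
  have hrest : ∑ w ∈ (Finset.univ.erase x).erase y, (F w : ℕ) * (g ∘ Equiv.swap x y) w =
      ∑ w ∈ (Finset.univ.erase x).erase y, (F w : ℕ) * g w := by
    refine Finset.sum_congr rfl fun w hw => ?_
    rw [Finset.mem_erase, Finset.mem_erase] at hw
    rw [Function.comp, Equiv.swap_apply_of_ne_of_ne hw.2.1 hw.1]
  unfold agreement
  rw [split, split, hrest]
  simp only [Function.comp, Equiv.swap_apply_left, Equiv.swap_apply_right]
  obtain ⟨a, ha⟩ := Nat.exists_eq_add_of_lt hF'
  obtain ⟨b, hb⟩ := Nat.exists_eq_add_of_lt hg'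
  have e1 : (F x : ℕ) - F y = a + 1 := by omega
  have e2 : (g y : ℕ) - g x = b + 1 := by omega
  rw [e1, e2, ha, hb]
  ring

/-- By the rearrangement identity `agreement_comp_swap` each swap gains a product of two positive
integers. This drives the termination argument. -/
theorem Moves.agreement_add_le (hm : Moves U V lo hi f g N S) {F : Fin n → Fin n}
    (hF : ∀ x y, U x → V y → F y < F x) : agreement F f + N ≤ agreement F g := by
  induction hm with
  | refl => exact le_rfl
  | @step g N S x y _ hx hy h3 h4 h5 ih =>
    rw [agreement_comp_swap (hF x y hx hy) h4]
    have h4' : (g x : ℕ) < g y := h4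
    have h6 : (F y : ℕ) < F x := hF x y hx hy
    have : 1 ≤ ((F x : ℕ) - F y) * (g y - g x) := Nat.mul_pos (by omega) (by omega)
    omega

end Moves

end OnlineTopo

namespace OnlineTopo

/-! ### The neighbours considered by a call -/

/-- The properties of the thresholds that the analysis uses: the thresholds up to level `0` are paid for
by `θ`, and a counting sort at level `i + 1` is paid for by `θ` times the square root of a distance
greater than `t i`. -/
structure Thresholds (n p : ℕ) (t : ℕ → ℕ) (θ : ℝ) : Prop where
  one_le : 1 ≤ θ
  zero_le : (t 0 : ℝ) ≤ θ
  succ_le : ∀ i ≤ p, (t (i + 1) : ℝ) ≤ θ * √((t i : ℝ) + 1)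
  top_le : n ≤ t (p + 1)
  sqrt_le : √(n : ℝ) ≤ θ

section Info

variable {n : ℕ} (E : Fin n → Fin n → Prop) (g : Fin n → Fin n) (u v : Fin n)

/-- No out-neighbour of `u` precedes `v`. -/
def NoOut : Prop := ∀ z, E u z → g v ≤ g z

/-- No in-neighbour of `v` succeeds `u`. -/
def NoIn : Prop := ∀ z, E z v → g z ≤ g u

/-- `A` is a list of out-neighbours of `u` that precede `v`, empty only if there are none. Either `c = 0`,
or `c ^ 2` is less than the distance of `u` and `v`, `A` contains all those out-neighbours, and all
of them are far from `u`. -/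
structure OutInfo (A : List (Fin n)) (flag : Bool) (c : ℝ) : Prop where
  sorted : A.Pairwise fun a b => g a < g b
  mem : ∀ w ∈ A, E u w ∧ g w < g v
  nil : A = [] → NoOut E g u v
  charge : c = 0 ∨ (flag = false ∧ (∀ z, E u z → g z < g v → z ∈ A) ∧
    ∃ τ : ℕ, c = √((τ : ℝ) + 1) ∧ (g u : ℕ) + τ < g v ∧ ∀ w ∈ A, (g u : ℕ) + τ < g w)

/-- The analogue of `OutInfo` for the in-neighbours of `v`. -/
structure InInfo (B : List (Fin n)) (flag : Bool) (c : ℝ) : Prop where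
  sorted : B.Pairwise fun a b => g a < g b
  mem : ∀ w ∈ B, E w v ∧ g u < g w
  nil : B = [] → NoIn E g u v
  charge : c = 0 ∨ (flag = false ∧ (∀ z, E z v → g u < g z → z ∈ B) ∧
    ∃ τ : ℕ, c = √((τ : ℝ) + 1) ∧ (g u : ℕ) + τ < g v ∧ ∀ w ∈ B, (g w : ℕ) + τ < g v)

end Info

/-- What a call of `reorder` does once the sets `A` and `B` have been determined. -/
def reorderBody {n : ℕ} (p : ℕ) (t : ℕ → ℕ) (depth : ℕ) (u v : Fin n) (A B : List (Fin n)) :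
    Prog n Unit := do
  if A = [] ∧ B = [] then swap p t u v
  else
    let pairs := loopPairs (← get).pos u v A B
    tick (pairs.length + A.length + B.length + 1)
    pairs.forM fun q =>
      reorder p t depth q.1 q.2 (decide (q.1 = u ∧ A = [])) (decide (q.2 = v ∧ B = []))

/-! ### The searches of a call and their cost -/

section Neighbours

variable {n p : ℕ} {t : ℕ → ℕ} {s : Store n} {u v : Fin n} {θ : ℝ}

/-- The edges of the graph held in the store. -/
def Store.Edge (s : Store n) (a b : Fin n) : Prop := s.outList a b = true

theorem Store.edge_congr {s s' : Store n} (h : s'.outList = s.outList) : s'.Edge = s.Edge := by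
  funext a b
  rw [Store.Edge, Store.Edge, h]

theorem Thresholds.sort_le (hθ : Thresholds n p t θ) {i T : ℕ} (hi : i ≤ p)
    (hT : T ≤ 10 * (t (i + 1) + 1)) : (T : ℝ) ≤ 20 * θ * √((t i : ℝ) + 1) := by
  have h1 : (T : ℝ) ≤ ((10 * (t (i + 1) + 1) : ℕ) : ℝ) := by exact_mod_cast hT
  push_cast at h1
  have h2 : 1 ≤ √((t i : ℝ) + 1) := Real.one_le_sqrt.2 (by simp)
  have h3 := hθ.succ_le i hi
  nlinarith [hθ.one_le]

/-- A second search takes place only if `A₀` is empty. Then all out-neighbours it finds are further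
than `t i` from `u`, so the charge is `c = √(t i + 1)`; it finds all of them below `v`, since `t (i
+ 1)` covers the distance. -/
theorem Good.ends_chooseOut (h : Good p t s) (hθ : Thresholds n p t θ) {i : ℕ} (hi : i ≤ p)
    (h1 : s.pos u + t i < s.pos v) (h2 : (s.pos v : ℕ) ≤ s.pos u + t (i + 1)) {flag : Bool}
    (hflag : flag = true → NoOut s.Edge s.pos u v) {A₀ : List (Fin n)}
    (hs : A₀.Pairwise fun a b => s.pos a < s.pos b)
    (hm : ∀ w, w ∈ A₀ ↔ s.outList u w = true ∧ (s.pos w : ℕ) ≤ s.pos u + t i ∧ s.pos w < s.pos v) :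
    (A₀ ≠ [] ∨ flag = true → OutInfo s.Edge s.pos u v A₀ flag 0) ∧
    (¬ (A₀ ≠ [] ∨ flag = true) → Ends (hatA t false u v (i + 1)) s fun A s' =>
      ∃ (T : ℕ) (c : ℝ), Later s T s' ∧ (T : ℝ) ≤ 20 * θ * c ∧
        OutInfo s.Edge s.pos u v A flag c) := by
  constructor
  · refine fun h3 => ⟨hs, fun w hw => ⟨((hm w).1 hw).1, ((hm w).1 hw).2.2⟩, fun h4 => hflag ?_,
      Or.inl rfl⟩
    exact h3.resolve_left fun h5 => h5 h4
  · intro h3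
    push Not at h3
    obtain ⟨rfl, h3⟩ := h3
    refine (h.ends_hatA false u v (i := i + 1) (by omega)).mono ?_
    rintro A s' ⟨T, h4, h5, h6, -, h7⟩
    have hall : ∀ z, s.Edge u z → s.pos z < s.pos v → z ∈ A := fun z hz hzv =>
      (h6 z).2 ⟨hz, by have : (s.pos z : ℕ) < s.pos v := hzv; omega, hzv⟩
    refine ⟨T, _, h4, hθ.sort_le hi (h7 rfl), h5, fun w hw => ⟨((h6 w).1 hw).1, ((h6 w).1 hw).2.2⟩,
      fun hnil z hz => ?_, Or.inr ⟨by simpa using h3, hall, _, rfl, h1, fun w hw => ?_⟩⟩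
    · by_contra hc
      have := hall z hz (not_le.1 hc)
      rw [hnil] at this
      exact List.not_mem_nil this
    · by_contra hc
      have h8 := (h6 w).1 hw
      exact List.not_mem_nil ((hm w).2 ⟨h8.1, by omega, h8.2.2⟩)

theorem Good.ends_chooseIn (h : Good p t s) (hθ : Thresholds n p t θ) {i : ℕ} (hi : i ≤ p)
    (h1 : s.pos u + t i < s.pos v) (h2 : (s.pos v : ℕ) ≤ s.pos u + t (i + 1)) {flag : Bool}
    (hflag : flag = true → NoIn s.Edge s.pos u v) {B₀ : List (Fin n)}
    (hs : B₀.Pairwise fun a b => s.pos a < s.pos b)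
    (hm : ∀ w, w ∈ B₀ ↔ s.outList w v = true ∧ (s.pos v : ℕ) ≤ s.pos w + t i ∧ s.pos u < s.pos w) :
    (B₀ ≠ [] ∨ flag = true → InInfo s.Edge s.pos u v B₀ flag 0) ∧
    (¬ (B₀ ≠ [] ∨ flag = true) → Ends (hatB t false u v (i + 1)) s fun B s' =>
      ∃ (T : ℕ) (c : ℝ), Later s T s' ∧ (T : ℝ) ≤ 20 * θ * c ∧
        InInfo s.Edge s.pos u v B flag c) := by
  constructor
  · refine fun h3 => ⟨hs, fun w hw => ⟨((hm w).1 hw).1, ((hm w).1 hw).2.2⟩, fun h4 => hflag ?_,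
      Or.inl rfl⟩
    exact h3.resolve_left fun h5 => h5 h4
  · intro h3
    push Not at h3
    obtain ⟨rfl, h3⟩ := h3
    refine (h.ends_hatB false u v (i := i + 1) (by omega)).mono ?_
    rintro B s' ⟨T, h4, h5, h6, -, h7⟩
    have hall : ∀ z, s.Edge z v → s.pos u < s.pos z → z ∈ B := fun z hz hzv =>
      (h6 z).2 ⟨hz, by have : (s.pos u : ℕ) < s.pos z := hzv; omega, hzv⟩
    refine ⟨T, _, h4, hθ.sort_le hi (h7 rfl), h5, fun w hw => ⟨((h6 w).1 hw).1, ((h6 w).1 hw).2.2⟩,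
      fun hnil z hz => ?_, Or.inr ⟨by simpa using h3, hall, _, rfl, h1, fun w hw => ?_⟩⟩
    · by_contra hc
      have := hall z hz (not_le.1 hc)
      rw [hnil] at this
      exact List.not_mem_nil this
    · by_contra hc
      have h8 := (h6 w).1 hw
      exact List.not_mem_nil ((hm w).2 ⟨h8.1, by omega, h8.2.2⟩)

/-- Separates the searches of a call from what follows: afterwards only the information on `A` and
`B`, the charges `c₁`, `c₂` and the time bound matter, and levels no longer occur. -/
theorem Good.ends_reorder_of_body (h : Good p t s) (hθ : Thresholds n p t θ) {depth : ℕ}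
    {f₁ f₂ : Bool} (huv : s.pos u < s.pos v) (h₁ : f₁ = true → NoOut s.Edge s.pos u v)
    (h₂ : f₂ = true → NoIn s.Edge s.pos u v) {Q : Unit → Store n → Prop}
    (hk : ∀ (A B : List (Fin n)) (s' : Store n) (T : ℕ) (c₁ c₂ : ℝ), Later s T s' →
      OutInfo s.Edge s.pos u v A f₁ c₁ → InInfo s.Edge s.pos u v B f₂ c₂ →
      (T : ℝ) ≤ p + 4 + 40 * θ + 6 * logBound n * (A.length + B.length + 2) + 20 * θ * (c₁ + c₂) →
      Ends (reorderBody p t depth u v A B) s' Q) :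
    Ends (reorder p t (depth + 1) u v f₁ f₂) s Q := by
  have huv' : (s.pos u : ℕ) < s.pos v := huv
  have hL0 : (0 : ℝ) ≤ logBound n := by positivity
  have hθ1 := hθ.one_le
  simp only [reorder, ends_bind, ends_getPos, ends_tick]
  rw [if_neg (not_le.2 huv')]
  simp only [ends_bind, ends_findLevel]
  have hsome := fun i => @findLevel_some p t (s.pos v - s.pos u) i
  have hnone := @findLevel_none p t (s.pos v - s.pos u)
    (le_trans (by have := (s.pos v).2; omega) hθ.top_le)
  generalize List.find? _ _ = o at hsome hnone
  have hl : Later s (p + 4)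
      { s with time := s.time + 1 + 1 + 1 + (p + 1) } := ⟨p + 4, le_rfl, by congr 1; omega⟩
  generalize ({ s with time := s.time + 1 + 1 + 1 + (p + 1) } : Store n) = s₀ at hl
  have hg₀ := hl.good h
  have hp₀ := hl.pos
  have ho₀ := hl.outList
  cases o with
  | none =>
    have hd := hnone rfl
    simp only [ends_bind]
    refine (hg₀.ends_hatA false u v (i := 0) (by omega)).mono ?_
    rintro A s₁ ⟨T₁, hl₁, hs₁, hm₁, -, ht₁⟩
    have hg₁ := hl₁.good hg₀
    refine (hg₁.ends_hatB false u v (i := 0) (by omega)).mono ?_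
    rintro B s₂ ⟨T₂, hl₂, hs₂, hm₂, -, ht₂⟩
    rw [hl₁.pos, hl₁.outList, hp₀, ho₀] at hm₂
    rw [hl₁.pos, hp₀] at hs₂
    rw [hp₀, ho₀] at hm₁
    rw [hp₀] at hs₁
    have ht₁ := ht₁ rfl
    have ht₂ := ht₂ rfl
    refine ends_pure.2 (hk A B s₂ _ 0 0 ((hl.trans hl₁).trans hl₂) ?_ ?_ ?_)
    · refine ⟨hs₁, fun w hw => ⟨((hm₁ w).1 hw).1, ((hm₁ w).1 hw).2.2⟩, fun hnil z hz => ?_,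
        Or.inl rfl⟩
      by_contra hc
      have hc' : (s.pos z : ℕ) < s.pos v := not_le.1 hc
      have : z ∈ A := (hm₁ z).2 ⟨hz, by omega, hc'⟩
      rw [hnil] at this
      exact List.not_mem_nil this
    · refine ⟨hs₂, fun w hw => ⟨((hm₂ w).1 hw).1, ((hm₂ w).1 hw).2.2⟩, fun hnil z hz => ?_,
        Or.inl rfl⟩
      by_contra hc
      have hc' : (s.pos u : ℕ) < s.pos z := not_le.1 hc
      have : z ∈ B := (hm₂ z).2 ⟨hz, by omega, hc'⟩
      rw [hnil] at this
      exact List.not_mem_nil this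
    · have h3 : p + 4 + T₁ + T₂ ≤ p + 4 + 20 * (t 0 + 1) := by omega
      have h4 : ((p + 4 + T₁ + T₂ : ℕ) : ℝ) ≤ ((p + 4 + 20 * (t 0 + 1) : ℕ) : ℝ) := by
        exact_mod_cast h3
      have h5 : (0 : ℝ) ≤ 6 * logBound n * (A.length + B.length + 2) := by positivity
      push_cast at h4 ⊢
      have := hθ.zero_le
      linarith
  | some i =>
    obtain ⟨hi, hd, hd'⟩ := hsome i rfl
    have h1 : s.pos u + t i < s.pos v := by omega
    have h2 : (s.pos v : ℕ) ≤ s.pos u + t (i + 1) := by omega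
    simp only [ends_bind]
    refine (hg₀.ends_hatA true u v (i := i) (by omega)).mono ?_
    rintro A₀ s₁ ⟨T₁, hl₁, hs₁, hm₁, ht₁, -⟩
    have hg₁ := hl₁.good hg₀
    refine (hg₁.ends_hatB true u v (i := i) (by omega)).mono ?_
    rintro B₀ s₂ ⟨T₂, hl₂, hs₂, hm₂, ht₂, -⟩
    rw [hp₀] at ht₁
    rw [hl₁.pos, hp₀] at ht₂
    have ht₁ := ht₁ rfl h1
    have ht₂ := ht₂ rfl h1
    have hl₂' := (hl.trans hl₁).trans hl₂
    have hg₂ := hl₂.good hg₁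
    have hp₂ := hl₂'.pos
    have ho₂ := hl₂'.outList
    have hcost : ((p + 4 + T₁ + T₂ : ℕ) : ℝ) ≤
        p + 4 + 6 * logBound n * (A₀.length + B₀.length + 2) := by
      have h4 : ((p + 4 + T₁ + T₂ : ℕ) : ℝ) ≤ ((p + 4 + 6 * logBound n * (A₀.length + 1) +
          6 * logBound n * (B₀.length + 1) : ℕ) : ℝ) := by exact_mod_cast by omega
      push_cast at h4 ⊢
      linarith
    have hAcost : ∀ A : List (Fin n), (A₀ ≠ [] ∨ f₁ = true → A = A₀) → A₀.length ≤ A.length := by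
      intro A hA
      by_cases hA₀ : A₀ = []
      · simp [hA₀]
      · rw [hA (Or.inl hA₀)]
    have hBcost : ∀ B : List (Fin n), (B₀ ≠ [] ∨ f₂ = true → B = B₀) → B₀.length ≤ B.length := by
      intro B hB
      by_cases hB₀ : B₀ = []
      · simp [hB₀]
      · rw [hB (Or.inl hB₀)]
    have mainB : ∀ (A : List (Fin n)) (s₃ : Store n) (T₃ : ℕ) (c₁ : ℝ), Later s₂ T₃ s₃ →
        OutInfo s.Edge s.pos u v A f₁ c₁ → (T₃ : ℝ) ≤ 20 * θ * c₁ → A₀.length ≤ A.length →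
        ((B₀ ≠ [] ∨ f₂ = true → Ends (reorderBody p t depth u v A B₀) s₃ Q) ∧
        (¬ (B₀ ≠ [] ∨ f₂ = true) → Ends (hatB t false u v (i + 1)) s₃ fun B s' =>
          Ends (reorderBody p t depth u v A B) s' Q)) := by
      intro A s₃ T₃ c₁ hl₃ hA hT₃ hlen
      have hl₃' := hl₂'.trans hl₃
      have hp₃ := hl₃'.pos
      have ho₃ := hl₃'.outList
      have key := (hl₃'.good h).ends_chooseIn (u := u) (v := v) (flag := f₂) (B₀ := B₀) hθ
        (i := i) (by omega) (by rw [hp₃]; exact h1) (by rw [hp₃]; exact h2)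
        (by rw [Store.edge_congr ho₃, hp₃]; exact h₂) (by rw [hp₃]; rwa [hl₁.pos, hp₀] at hs₂)
        (by rw [hp₃, ho₃]; rwa [hl₁.pos, hl₁.outList, hp₀, ho₀] at hm₂)
      rw [Store.edge_congr ho₃, hp₃] at key
      have hbound : ∀ (B : List (Fin n)) (T₄ : ℕ) (c₂ : ℝ), B₀.length ≤ B.length →
          (T₄ : ℝ) ≤ 20 * θ * c₂ → ((p + 4 + T₁ + T₂ + T₃ + T₄ : ℕ) : ℝ) ≤
          p + 4 + 40 * θ + 6 * logBound n * (A.length + B.length + 2) + 20 * θ * (c₁ + c₂) := by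
        intro B T₄ c₂ hlen' hT₄
        have h5 : (6 * logBound n * (A₀.length + B₀.length + 2) : ℝ) ≤
            6 * logBound n * (A.length + B.length + 2) := by gcongr
        push_cast at hcost ⊢
        linarith
      refine ⟨fun hB => ?_, fun hB => (key.2 hB).mono ?_⟩
      · exact hk A B₀ s₃ _ c₁ 0 hl₃' hA (key.1 hB) (by simpa using hbound B₀ 0 0 le_rfl (by simp))
      · rintro B s₄ ⟨T₄, c₂, hl₄, hT₄, hBi⟩
        exact hk A B s₄ _ c₁ c₂ (hl₃'.trans hl₄) hA hBi
          (hbound B T₄ c₂ (hBcost B fun h => absurd h hB) hT₄)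
    have keyA := hg₂.ends_chooseOut (u := u) (v := v) (flag := f₁) (A₀ := A₀) hθ
      (i := i) (by omega) (by rw [hp₂]; exact h1) (by rw [hp₂]; exact h2)
      (by rw [Store.edge_congr ho₂, hp₂]; exact h₁) (by rw [hp₂]; rwa [hp₀] at hs₁)
      (by rw [hp₂, ho₂]; rwa [hp₀, ho₀] at hm₁)
    rw [Store.edge_congr ho₂, hp₂] at keyA
    have finish : ∀ (A : List (Fin n)) (s₃ : Store n) (T₃ : ℕ) (c₁ : ℝ), Later s₂ T₃ s₃ →
        OutInfo s.Edge s.pos u v A f₁ c₁ → (T₃ : ℝ) ≤ 20 * θ * c₁ → A₀.length ≤ A.length →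
        Ends (if B₀ ≠ [] ∨ f₂ = true then pure B₀ >>= fun B => pure (A, B) >>= fun x =>
          reorderBody p t depth u v x.1 x.2
        else hatB t false u v (i + 1) >>= fun B => pure (A, B) >>= fun x =>
          reorderBody p t depth u v x.1 x.2) s₃ Q := by
      intro A s₃ T₃ c₁ hl₃ hA hT₃ hlen
      obtain ⟨k1, k2⟩ := mainB A s₃ T₃ c₁ hl₃ hA hT₃ hlen
      split_ifs with hB
      · simp only [ends_bind, ends_pure]; exact k1 hB
      · simp only [ends_bind, ends_pure]; exact k2 hB
    by_cases hA : A₀ ≠ [] ∨ f₁ = true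
    · rw [if_pos hA]
      simp only [ends_bind, ends_pure]
      exact finish A₀ s₂ 0 0 (Later.refl _) (keyA.1 hA) (by simp) le_rfl
    · rw [if_neg hA]
      refine ends_bind.2 ((keyA.2 hA).mono ?_)
      rintro A s₃ ⟨T₃, c₁, hl₃, hT₃, hAi⟩
      exact finish A s₃ T₃ c₁ hl₃ hAi hT₃ (hAcost A fun h => absurd h hA)

end Neighbours

end OnlineTopo

namespace OnlineTopo

/-! ### The loops -/

section Loop

variable {n : ℕ} {X Y U V : Fin n → Prop} {lo hi N : ℕ} {S : ℝ} {f g g' : Fin n → Fin n}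

/-- The list `qs` of pairs that are still to be treated by the loops over `X` and `Y`, and the current
order `g`. -/
structure LoopInv (X Y : Fin n → Prop) (g : Fin n → Fin n) (qs : List (Fin n × Fin n)) : Prop where
  flipped : ∀ x y, X x → Y y → (x, y) ∈ qs ∨ g y < g x
  mem : ∀ q ∈ qs, X q.1 ∧ Y q.2 ∧ g q.1 < g q.2
  sorted : qs.Pairwise fun q q' => (q'.1 = q.1 ∧ g q.2 < g q'.2) ∨ g q'.1 < g q.1

/-- A call for `(a, b)` only moves vertices between these two. The remaining pairs have the same `a`
and a partner above `b`, which is not touched, or a first vertex below `a`, which is not touched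
either; so none of them is put in order prematurely and their sorting persists. -/
theorem LoopInv.tail {a b : Fin n} {qs : List (Fin n × Fin n)} (h : LoopInv X Y g ((a, b) :: qs))
    (hm : Moves U V (g a) (g b) g g' N S) (hUV : ∀ x, U x → ¬ V x) (hX : ∀ x, X x → U x)
    (hY : ∀ y, Y y → V y) (hab : g' b < g' a) : LoopInv X Y g' qs := by
  obtain ⟨hXa, hYb, hgab⟩ := h.mem (a, b) List.mem_cons_self
  have hgab' : (g a : ℕ) < g b := hgab
  obtain ⟨hhead, htail⟩ := List.pairwise_cons.1 h.sorted
  have hlow : ∀ w, g w < g a → g' w = g w := fun w hw => hm.outside (Or.inl hw)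
  have hhigh : ∀ w, g b < g w → g' w = g w := fun w hw => hm.outside (Or.inr hw)
  have ha : g a ≤ g' a ∧ g' a ≤ g b := hm.inside ⟨le_rfl, hgab'.le⟩
  have hcross : ∀ w, g w < g a → ∀ y, g w < g y → g' w < g' y := by
    intro w hw y hy
    rw [hlow w hw]
    by_cases hr : (g a : ℕ) ≤ g y ∧ (g y : ℕ) ≤ g b
    · have h1 : g a ≤ g' y := (hm.inside hr).1
      exact hw.trans_le h1
    · rwa [hm.outside (w := y) (by omega)]
  refine ⟨fun x y hx hy => ?_, fun q hq => ⟨?_, ?_, ?_⟩, ?_⟩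
  · rcases h.flipped x y hx hy with h1 | h1
    · rcases List.mem_cons.1 h1 with h2 | h2
      · obtain ⟨rfl, rfl⟩ := Prod.mk.inj h2
        exact Or.inr hab
      · exact Or.inl h2
    · exact Or.inr ((hm.down hUV (hY y hy)).trans_lt (h1.trans_le (hm.up hUV (hX x hx))))
  · exact (h.mem q (List.mem_cons_of_mem _ hq)).1
  · exact (h.mem q (List.mem_cons_of_mem _ hq)).2.1
  · have hq' := (h.mem q (List.mem_cons_of_mem _ hq)).2.2
    rcases hhead q hq with ⟨h1, h2⟩ | h1
    · rw [hhigh _ h2, h1]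
      exact ha.2.trans_lt h2
    · exact hcross _ h1 _ hq'
  · refine List.Pairwise.imp_of_mem ?_ htail
    rintro ⟨a₁, b₁⟩ ⟨a₂, b₂⟩ h1 h2 h3
    rcases h3 with ⟨h4, h5⟩ | h4
    · refine Or.inl ⟨h4, ?_⟩
      rcases hhead _ h1 with ⟨h6, h7⟩ | h6
      · rw [hhigh _ h7, hhigh _ (h7.trans h5)]
        exact h5
      -- For partners of a lower vertex, the position of `b₁` relative to `a` decides: if `(a, b₁)`
      -- is still listed, then `b₁` is `b` or above `b`; otherwise `b₁` is below `a` and stays in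
      -- place.
      · rcases h.flipped a b₁ hXa (h.mem _ (List.mem_cons_of_mem _ h1)).2.1 with h7 | h7
        · rcases List.mem_cons.1 h7 with h8 | h8
          · obtain rfl := (Prod.mk.inj h8).2
            rw [hhigh _ h5]
            exact (hm.down hUV (hY _ hYb)).trans_lt h5
          · rcases hhead _ h8 with ⟨-, h9⟩ | h9
            · rw [hhigh _ h9, hhigh _ (h9.trans h5)]
              exact h5
            · exact absurd h9 (lt_irrefl _)
        · exact hcross _ h7 _ h5
    · refine Or.inr ?_
      have h5 : g a₁ ≤ g a := by
        rcases hhead _ h1 with ⟨h6, -⟩ | h6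
        · exact (congrArg g h6).le
        · exact h6.le
      rw [hlow _ (lt_of_lt_of_le h4 h5)]
      exact lt_of_lt_of_le h4 (hm.up hUV (hX _ (h.mem _ (List.mem_cons_of_mem _ h1)).1))

theorem Moves.eq_of_zero (hm : Moves U V lo hi f g 0 S) : g = f := by
  generalize hN : 0 = N at hm
  cases hm with
  | refl => rfl
  | step => omega

end Loop

/-! ### The recursion -/

/-- The factor at which a call pays for its search for out-neighbours. -/
def OutRate {n : ℕ} (E : Fin n → Fin n → Prop) (g : Fin n → Fin n) (u v : Fin n) (flag : Bool)
    (α : ℝ) : Prop :=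
  (flag = true ∧ α = 0) ∨ (NoOut E g u v ∧ α = 1) ∨ α = 2

/-- The factor at which a call pays for its search for in-neighbours. -/
def InRate {n : ℕ} (E : Fin n → Fin n → Prop) (g : Fin n → Fin n) (u v : Fin n) (flag : Bool)
    (β : ℝ) : Prop :=
  (flag = true ∧ β = 0) ∨ (NoIn E g u v ∧ β = 1) ∨ β = 2

/-- The outcome of a call of `reorder`. -/
def Reordered {n : ℕ} (p : ℕ) (t : ℕ → ℕ) (κ : ℝ) (u v : Fin n) (γ : ℝ) (s s' : Store n) : Prop :=
  ∃ (N : ℕ) (S : ℝ), Good p t s' ∧ s'.outList = s.outList ∧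
    Moves (Relation.ReflTransGen s.Edge u) (fun y => Relation.ReflTransGen s.Edge y v)
      (s.pos u) (s.pos v) s.pos s'.pos N S ∧
    1 ≤ N ∧ s'.pos v < s'.pos u ∧ (s'.time : ℝ) ≤ s.time + κ * (3 * N - 2 + γ * S)

/-- A bound on the depth of the recursion. -/
def callRank {n : ℕ} (F g : Fin n → Fin n) (u v : Fin n) : ℕ :=
  (n * (n * n) - agreement F g) * (n + 1) + (g v - g u)

/-- Calls of `reorder` whose rank is less than `depth` behave as intended. -/
def ReorderSpec {n : ℕ} (p : ℕ) (t : ℕ → ℕ) (κ : ℝ) (F : Fin n → Fin n) (depth : ℕ) : Prop :=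
  ∀ (s : Store n) (u v : Fin n) (f₁ f₂ : Bool) (α β : ℝ), Good p t s →
    (∀ a b, s.Edge a b → F a < F b) → F v < F u → s.pos u < s.pos v →
    (f₁ = true → NoOut s.Edge s.pos u v) → (f₂ = true → NoIn s.Edge s.pos u v) →
    OutRate s.Edge s.pos u v f₁ α → InRate s.Edge s.pos u v f₂ β →
    callRank F s.pos u v < depth →
    Ends (reorder p t depth u v f₁ f₂) s fun _ s' => Reordered p t κ u v (α + β + 1) s s'

theorem rank_lt_of_reach {n : ℕ} {E : Fin n → Fin n → Prop} {F : Fin n → Fin n}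
    (hF : ∀ a b, E a b → F a < F b) {a b : Fin n} (h : Relation.ReflTransGen E a b) : F a ≤ F b := by
  induction h with
  | refl => exact le_rfl
  | tail _ h ih => exact ih.trans (hF _ _ h).le

/-- The factor `n + 1` in the rank exceeds every difference of positions, so the rank is
lexicographic: first the missing agreement, then the length of the interval. -/
theorem callRank_lt {n : ℕ} {F g g' : Fin n → Fin n} {u v a b : Fin n} {N : ℕ}
    (h : agreement F g + N ≤ agreement F g')
    (hd : N = 0 → g' = g ∧ (g b : ℕ) - g a < g v - g u) :
    callRank F g' a b < callRank F g u v := by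
  unfold callRank
  rcases Nat.eq_zero_or_pos N with h0 | h0
  · obtain ⟨rfl, h1⟩ := hd h0
    omega
  · have h1 := agreement_le F g'
    have h2 : n * (n * n) - agreement F g' + 1 ≤ n * (n * n) - agreement F g := by omega
    have h3 := Nat.mul_le_mul_right (n + 1) h2
    have h4 := (g' b).2
    rw [add_mul] at h3
    omega

/-- The state of the loops when the list `qs` remains to be treated, `len` being its initial length.
The swaps made by calls with first argument `u` account for the share `SU`, those by calls with second
argument `v` for the share `SV`. -/
structure LoopState {n : ℕ} (p : ℕ) (t : ℕ → ℕ) (κ : ℝ) (s₀ : Store n) (u v : Fin n)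
    (A B : List (Fin n)) (α β : ℝ) (len : ℕ) (qs : List (Fin n × Fin n)) (s : Store n)
    (N : ℕ) (SA SU SB SV : ℝ) : Prop where
  good : Good p t s
  outList : s.outList = s₀.outList
  moves : Moves (Relation.ReflTransGen s₀.Edge u) (fun y => Relation.ReflTransGen s₀.Edge y v)
    (s₀.pos u) (s₀.pos v) s₀.pos s.pos N (SA + SU)
  split : SA + SU = SB + SV
  count : len ≤ N + qs.length
  inv : LoopInv (fun x => x = u ∨ x ∈ A) (fun y => y ∈ B ∨ y = v) s.pos qs
  nonnegA : 0 ≤ SA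
  nonnegB : 0 ≤ SB
  nilA : A = [] → SA = 0
  nilB : B = [] → SB = 0
  shiftU : √|(s.pos u : ℝ) - s₀.pos u| ≤ SU
  shiftV : √|(s.pos v : ℝ) - s₀.pos v| ≤ SV
  time : (s.time : ℝ) ≤ s₀.time +
    κ * (3 * N - 2 * (len - qs.length) + (2 * SA + α * SU) + (2 * SB + β * SV) + (SA + SU))

/-! ### One iteration of the loops -/

section Step

variable {n p : ℕ} {t : ℕ → ℕ} {κ : ℝ} {F : Fin n → Fin n} {s₀ s : Store n} {u v : Fin n}
  {A B : List (Fin n)} {α β : ℝ} {len N : ℕ} {SA SU SB SV : ℝ} {qs : List (Fin n × Fin n)}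

/-- As `u'` decreases, all pairs with first vertex in `A` have been treated when `u` has its turn,
so the vertices of `A` are above `b`. An out-neighbour outside `A` was above `v` from the beginning,
hence has not moved, whereas `b` has stayed at or below the old position of `v`. -/
theorem LoopState.noOut {b : Fin n} (h : LoopState p t κ s₀ u v A B α β len ((u, b) :: qs) s N SA SU SB SV)
    (hall : ∀ z, s₀.Edge u z → s₀.pos z < s₀.pos v → z ∈ A) (huv : s₀.pos u < s₀.pos v)
    (hE : ¬ s₀.Edge u v) (hinj : Function.Injective s₀.pos) (hB : ∀ w ∈ B, s₀.pos u < s₀.pos w ∧ s₀.pos w < s₀.pos v) :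
    NoOut s₀.Edge s.pos u b := by
  intro z hz
  by_cases hzA : z ∈ A
  · obtain ⟨-, hb, -⟩ := h.inv.mem (u, b) List.mem_cons_self
    rcases h.inv.flipped z b (Or.inr hzA) hb with h1 | h1
    · have hz' : s.pos u < s.pos z := h.good.topo u z (by rw [h.outList]; exact hz)
      rcases List.mem_cons.1 h1 with h2 | h2
      · rw [(Prod.mk.inj h2).1] at hz'
        exact absurd hz' (lt_irrefl _)
      · rcases (List.pairwise_cons.1 h.inv.sorted).1 _ h2 with ⟨h3, -⟩ | h3
        · simp only at h3
          rw [h3] at hz'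
          exact absurd hz' (lt_irrefl _)
        · exact absurd hz' h3.not_gt
    · exact h1.le
  · have h1 : s₀.pos v ≤ s₀.pos z := not_lt.1 fun hc => hzA (hall z hz hc)
    have h2 : s₀.pos v < s₀.pos z := lt_of_le_of_ne h1 fun hc => hE (hinj hc ▸ hz)
    have huv' : (s₀.pos u : ℕ) < s₀.pos v := huv
    rw [h.moves.outside (Or.inr h2)]
    refine le_trans ?_ h1
    obtain ⟨-, hb, -⟩ := h.inv.mem (u, b) List.mem_cons_self
    refine (h.moves.inside (w := b) ?_).2
    rcases hb with hb | rfl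
    · obtain ⟨h3, h4⟩ := hB b hb
      exact ⟨h3.le, h4.le⟩
    · exact ⟨huv'.le, le_rfl⟩

theorem LoopState.noIn {a : Fin n} (h : LoopState p t κ s₀ u v A B α β len ((a, v) :: qs) s N SA SU SB SV)
    (hall : ∀ z, s₀.Edge z v → s₀.pos u < s₀.pos z → z ∈ B) (huv : s₀.pos u < s₀.pos v)
    (hE : ¬ s₀.Edge u v) (hinj : Function.Injective s₀.pos) (hA : ∀ w ∈ A, s₀.pos u < s₀.pos w ∧ s₀.pos w < s₀.pos v) :
    NoIn s₀.Edge s.pos a v := by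
  intro z hz
  by_cases hzB : z ∈ B
  · obtain ⟨ha, -, hav⟩ := h.inv.mem (a, v) List.mem_cons_self
    rcases h.inv.flipped a z ha (Or.inl hzB) with h1 | h1
    · have hz' : s.pos z < s.pos v := h.good.topo z v (by rw [h.outList]; exact hz)
      rcases List.mem_cons.1 h1 with h2 | h2
      · rw [(Prod.mk.inj h2).2] at hz'
        exact absurd hz' (lt_irrefl _)
      · rcases (List.pairwise_cons.1 h.inv.sorted).1 _ h2 with ⟨-, h3⟩ | h3
        · exact absurd hz' h3.not_gt
        · exact absurd h3 (lt_irrefl _)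
    · exact h1.le
  · have h1 : s₀.pos z ≤ s₀.pos u := not_lt.1 fun hc => hzB (hall z hz hc)
    have h2 : s₀.pos z < s₀.pos u := lt_of_le_of_ne h1 fun hc => hE (hinj hc ▸ hz)
    have huv' : (s₀.pos u : ℕ) < s₀.pos v := huv
    rw [h.moves.outside (Or.inl h2)]
    refine le_trans h1 ?_
    obtain ⟨ha, -, -⟩ := h.inv.mem (a, v) List.mem_cons_self
    refine (h.moves.inside (w := a) ?_).1
    rcases ha with rfl | ha
    · exact ⟨le_rfl, huv'.le⟩
    · obtain ⟨h3, h4⟩ := hA a ha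
      exact ⟨h3.le, h4.le⟩

/-- The share `S'` of the call is booked under `SU` at rate `α` if its first argument is `u`, and
under `SA` at rate 2 otherwise; independently, under `SV` or `SB` according to its second argument.
Calls with another first argument do not move `u`, which lies below that argument. -/
theorem ends_loop_step {depth : ℕ} (hspec : ReorderSpec p t κ F depth) (hg₀ : Good p t s₀)
    (hF : ∀ a b, s₀.Edge a b → F a < F b) (hFuv : F v < F u) (huv : s₀.pos u < s₀.pos v)
    (hrank : callRank F s₀.pos u v ≤ depth) (hlen : 2 ≤ len)
    (hA : ∀ w ∈ A, s₀.Edge u w ∧ s₀.pos w < s₀.pos v) (hB : ∀ w ∈ B, s₀.Edge w v ∧ s₀.pos u < s₀.pos w)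
    (hA₀ : A = [] → NoOut s₀.Edge s₀.pos u v) (hB₀ : B = [] → NoIn s₀.Edge s₀.pos u v)
    (hα : (A = [] ∧ α = 0) ∨ ((∀ z, s₀.Edge u z → s₀.pos z < s₀.pos v → z ∈ A) ∧ α = 1) ∨ α = 2)
    (hβ : (B = [] ∧ β = 0) ∨ ((∀ z, s₀.Edge z v → s₀.pos u < s₀.pos z → z ∈ B) ∧ β = 1) ∨ β = 2)
    {q : Fin n × Fin n} (h : LoopState p t κ s₀ u v A B α β len (q :: qs) s N SA SU SB SV) :
    Ends (reorder p t depth q.1 q.2 (decide (q.1 = u ∧ A = [])) (decide (q.2 = v ∧ B = []))) s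
      fun _ s' => ∃ N SA SU SB SV, LoopState p t κ s₀ u v A B α β len qs s' N SA SU SB SV := by
  obtain ⟨a, b⟩ := q
  have huv' : (s₀.pos u : ℕ) < s₀.pos v := huv
  have hedge : s.Edge = s₀.Edge := Store.edge_congr h.outList
  have hinj := hg₀.injective
  have hEuv : ¬ s₀.Edge u v := fun hc => absurd (hF u v hc) hFuv.not_gt
  obtain ⟨ha, hb, hab⟩ := h.inv.mem (a, b) List.mem_cons_self
  simp only at ha hb hab
  have hA' : ∀ w ∈ A, s₀.pos u < s₀.pos w ∧ s₀.pos w < s₀.pos v := fun w hw =>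
    ⟨hg₀.topo u w (hA w hw).1, (hA w hw).2⟩
  have hB' : ∀ w ∈ B, s₀.pos u < s₀.pos w ∧ s₀.pos w < s₀.pos v := fun w hw =>
    ⟨(hB w hw).2, hg₀.topo w v (hB w hw).1⟩
  have hUX : ∀ x, (x = u ∨ x ∈ A) → Relation.ReflTransGen s₀.Edge u x := by
    rintro x (rfl | hx)
    · exact .refl
    · exact .single (hA x hx).1
  have hVY : ∀ y, (y ∈ B ∨ y = v) → Relation.ReflTransGen s₀.Edge y v := by
    rintro y (hy | rfl)
    · exact .single (hB y hy).1
    · exact .refl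
  have hFUV : ∀ x y, Relation.ReflTransGen s₀.Edge u x → Relation.ReflTransGen s₀.Edge y v →
      F y < F x := fun x y hx hy =>
    (rank_lt_of_reach hF hy).trans_lt (hFuv.trans_le (rank_lt_of_reach hF hx))
  have hUV : ∀ x, Relation.ReflTransGen s₀.Edge u x → ¬ Relation.ReflTransGen s₀.Edge x v :=
    fun x hx hx' => lt_irrefl _ (hFUV x x hx hx')
  have hXr : ∀ x, (x = u ∨ x ∈ A) → (s₀.pos u : ℕ) ≤ s₀.pos x ∧ (s₀.pos x : ℕ) ≤ s₀.pos v := by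
    rintro x (rfl | hx)
    · exact ⟨le_rfl, huv'.le⟩
    · exact ⟨(hA' x hx).1.le, (hA' x hx).2.le⟩
  have hYr : ∀ x, (x ∈ B ∨ x = v) → (s₀.pos u : ℕ) ≤ s₀.pos x ∧ (s₀.pos x : ℕ) ≤ s₀.pos v := by
    rintro x (hx | rfl)
    · exact ⟨(hB' x hx).1.le, (hB' x hx).2.le⟩
    · exact ⟨huv'.le, le_rfl⟩
  have hallA : A = [] → ∀ z, s₀.Edge u z → s₀.pos z < s₀.pos v → z ∈ A := fun hnil z hz hzv =>
    absurd hzv (hA₀ hnil z hz).not_gt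
  have hallB : B = [] → ∀ z, s₀.Edge z v → s₀.pos u < s₀.pos z → z ∈ B := fun hnil z hz hzv =>
    absurd hzv (hB₀ hnil z hz).not_gt
  have hrank' : callRank F s.pos a b < depth := by
    refine lt_of_lt_of_le (callRank_lt (N := N) (u := u) (v := v)
      (h.moves.agreement_add_le hFUV) fun hN => ?_) hrank
    have hm := h.moves
    rw [hN] at hm
    have hpos := hm.eq_of_zero
    refine ⟨hpos, ?_⟩
    have hcount := h.count
    rw [hN, List.length_cons] at hcount
    -- Without swaps so far this is the first of at least two calls. A later pair extends further up
    -- or starts lower, so the current interval is properly shorter than that of `u` and `v`.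
    obtain ⟨q', hq'⟩ : ∃ q', q' ∈ qs := List.exists_mem_of_length_pos (by omega)
    have h1 := (List.pairwise_cons.1 h.inv.sorted).1 q' hq'
    obtain ⟨h2, h3, h4⟩ := h.inv.mem q' (List.mem_cons_of_mem _ hq')
    rw [hpos] at h1 hab
    have h5 := hXr _ h2
    have h6 := hYr _ h3
    have h7 := hXr _ ha
    have h8 := hYr _ hb
    have hab' : (s₀.pos a : ℕ) < s₀.pos b := hab
    rcases h1 with ⟨-, h1⟩ | h1
    · have h1' : (s₀.pos b : ℕ) < s₀.pos q'.2 := h1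
      omega
    · have h1' : (s₀.pos q'.1 : ℕ) < s₀.pos a := h1
      omega
  have hflag₁ : decide (a = u ∧ A = []) = true → NoOut s.Edge s.pos a b := by
    intro hd
    obtain ⟨rfl, hnil⟩ := of_decide_eq_true hd
    rw [hedge]
    exact h.noOut (hallA hnil) huv hEuv hinj hB'
  have hflag₂ : decide (b = v ∧ B = []) = true → NoIn s.Edge s.pos a b := by
    intro hd
    obtain ⟨rfl, hnil⟩ := of_decide_eq_true hd
    rw [hedge]
    exact h.noIn (hallB hnil) huv hEuv hinj hA'
  have hout : ∃ α', OutRate s.Edge s.pos a b (decide (a = u ∧ A = [])) α' ∧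
      ((a = u ∧ α' = α) ∨ (a ≠ u ∧ α' = 2)) := by
    by_cases hau : a = u
    · subst hau
      refine ⟨α, ?_, Or.inl ⟨rfl, rfl⟩⟩
      rcases hα with ⟨h1, h2⟩ | ⟨h1, h2⟩ | h2
      · exact Or.inl ⟨by simp [h1], h2⟩
      · refine Or.inr (Or.inl ⟨?_, h2⟩)
        rw [hedge]
        exact h.noOut h1 huv hEuv hinj hB'
      · exact Or.inr (Or.inr h2)
    · exact ⟨2, Or.inr (Or.inr rfl), Or.inr ⟨hau, rfl⟩⟩
  have hin : ∃ β', InRate s.Edge s.pos a b (decide (b = v ∧ B = [])) β' ∧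
      ((b = v ∧ β' = β) ∨ (b ≠ v ∧ β' = 2)) := by
    by_cases hbv : b = v
    · subst hbv
      refine ⟨β, ?_, Or.inl ⟨rfl, rfl⟩⟩
      rcases hβ with ⟨h1, h2⟩ | ⟨h1, h2⟩ | h2
      · exact Or.inl ⟨by simp [h1], h2⟩
      · refine Or.inr (Or.inl ⟨?_, h2⟩)
        rw [hedge]
        exact h.noIn h1 huv hEuv hinj hA'
      · exact Or.inr (Or.inr h2)
    · exact ⟨2, Or.inr (Or.inr rfl), Or.inr ⟨hbv, rfl⟩⟩
  obtain ⟨α', hα', hα''⟩ := hout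
  obtain ⟨β', hβ', hβ''⟩ := hin
  refine (hspec s a b _ _ α' β' h.good (by rw [hedge]; exact hF) (hFUV a b (hUX a ha) (hVY b hb)) hab
    hflag₁ hflag₂ hα' hβ' hrank').mono ?_
  rintro - s' ⟨N', S', hg', ho', hm', hN', hba, htime⟩
  rw [hedge] at hm'
  have hmb : Moves (Relation.ReflTransGen s₀.Edge u) (fun y => Relation.ReflTransGen s₀.Edge y v)
      (s.pos a) (s.pos b) s.pos s'.pos N' S' :=
    hm'.mono (fun x hx => (hUX a ha).trans hx) (fun y hy => hy.trans (hVY b hb)) le_rfl le_rfl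
  have hS' := hm'.nonneg
  have hmoves := h.moves.trans (hmb.mono (fun _ h => h) (fun _ h => h)
    (h.moves.inside (hXr a ha)).1 (h.moves.inside (hYr b hb)).2)
  obtain ⟨SA', SU', e1, e2, e3, e4, e5⟩ : ∃ SA' SU' : ℝ, SA' + SU' = SA + SU + S' ∧ 0 ≤ SA' ∧
      (A = [] → SA' = 0) ∧ √|(s'.pos u : ℝ) - s₀.pos u| ≤ SU' ∧
      2 * SA' + α * SU' = 2 * SA + α * SU + α' * S' := by
    rcases hα'' with ⟨rfl, rfl⟩ | ⟨hau, rfl⟩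
    · refine ⟨SA, SU + S', by ring, h.nonnegA, h.nilA, ?_, by ring⟩
      refine (sqrt_abs_sub_le _ (s.pos a : ℝ) _).trans ?_
      linarith [hm'.sqrt_le a, h.shiftU]
    · have haA := ha.resolve_left hau
      refine ⟨SA + S', SU, by ring, add_nonneg h.nonnegA hS', fun hnil => ?_, ?_, by ring⟩
      · rw [hnil] at haA
        exact absurd haA List.not_mem_nil
      · rw [hm'.outside (w := u) (Or.inl (h.good.topo u a (by rw [h.outList]; exact (hA a haA).1)))]
        exact h.shiftU
  obtain ⟨SB', SV', d1, d2, d3, d4, d5⟩ : ∃ SB' SV' : ℝ, SB' + SV' = SB + SV + S' ∧ 0 ≤ SB' ∧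
      (B = [] → SB' = 0) ∧ √|(s'.pos v : ℝ) - s₀.pos v| ≤ SV' ∧
      2 * SB' + β * SV' = 2 * SB + β * SV + β' * S' := by
    rcases hβ'' with ⟨rfl, rfl⟩ | ⟨hbv, rfl⟩
    · refine ⟨SB, SV + S', by ring, h.nonnegB, h.nilB, ?_, by ring⟩
      refine (sqrt_abs_sub_le _ (s.pos b : ℝ) _).trans ?_
      linarith [hm'.sqrt_le b, h.shiftV]
    · have hbB := hb.resolve_right hbv
      refine ⟨SB + S', SV, by ring, add_nonneg h.nonnegB hS', fun hnil => ?_, ?_, by ring⟩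
      · rw [hnil] at hbB
        exact absurd hbB List.not_mem_nil
      · rw [hm'.outside (w := v) (Or.inr (h.good.topo b v (by rw [h.outList]; exact (hB b hbB).1)))]
        exact h.shiftV
  refine ⟨N + N', SA', SU', SB', SV', ⟨hg', ho'.trans h.outList, by rw [e1]; exact hmoves,
    by rw [e1, d1, h.split], ?_, h.inv.tail hmb hUV hUX hVY hba, e2, d2, e3, d3, e4, d4, ?_⟩⟩
  · have := h.count
    rw [List.length_cons] at this
    omega
  · have h1 := h.time
    rw [e5, d5, e1]
    rw [List.length_cons] at h1
    push_cast at h1 ⊢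
    have h2 := add_le_add h1 htime
    linarith

end Step

end OnlineTopo

namespace OnlineTopo

/-! ### The amortised cost of a call -/

section Reorder

variable {n p : ℕ} {t : ℕ → ℕ} {F : Fin n → Fin n} {s s' : Store n} {u v : Fin n}
  {A B : List (Fin n)} {α β θ c₁ c₂ : ℝ} {T : ℕ} {f₁ f₂ : Bool}

/-- The cost that a swap, or a branch of the recursion, has to pay for. -/
noncomputable def unitCost (n p : ℕ) (θ : ℝ) : ℝ := 120 * (p + 2) * logBound n * θ

theorem le_unitCost (hθ : 1 ≤ θ) :
    60 * θ ≤ unitCost n p θ ∧ 60 * (logBound n : ℝ) ≤ unitCost n p θ ∧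
      60 * ((p : ℝ) + 4) ≤ unitCost n p θ ∧ 240 ≤ unitCost n p θ := by
  have hL : (1 : ℝ) ≤ logBound n := by exact_mod_cast one_le_logBound n
  have hp : (0 : ℝ) ≤ p := by positivity
  have h1 : 1 ≤ (logBound n : ℝ) * θ := by nlinarith
  have h2 : θ ≤ (logBound n : ℝ) * θ := by nlinarith
  have h3 : (logBound n : ℝ) ≤ logBound n * θ := by nlinarith
  have h4 : unitCost n p θ = 120 * (p + 2) * (logBound n * θ) := by rw [unitCost]; ring
  rw [h4]
  generalize (logBound n : ℝ) * θ = x at h1 h2 h3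
  refine ⟨?_, ?_, ?_, ?_⟩ <;> nlinarith

/-- Here `N = 1` and `S = √d`. The swap is paid for by the summand 1 in `α + β + 1`, as `d ≤ θ √d`;
each counting sort has charge at most `√d` and occurs only if the flag is not set, when the rate is
at least 1. -/
theorem ends_reorderBody_leaf {depth : ℕ} (hθ : Thresholds n p t θ) (hg : Good p t s)
    (hl : Later s T s') (huv : s.pos u < s.pos v) (hE : ¬ s.Edge u v)
    (hA : OutInfo s.Edge s.pos u v [] f₁ c₁) (hB : InInfo s.Edge s.pos u v [] f₂ c₂)
    (hα : OutRate s.Edge s.pos u v f₁ α) (hβ : InRate s.Edge s.pos u v f₂ β)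
    (hT : (T : ℝ) ≤ p + 4 + 40 * θ + 12 * logBound n + 20 * θ * (c₁ + c₂)) :
    Ends (reorderBody p t depth u v [] []) s' fun _ s'' =>
      Reordered p t (unitCost n p θ) u v (α + β + 1) s s'' := by
  have huv' : (s.pos u : ℕ) < s.pos v := huv
  have hcast : (((s.pos v : ℕ) - s.pos u : ℕ) : ℝ) = (s.pos v : ℝ) - s.pos u :=
    Nat.cast_sub huv'.le
  rw [reorderBody, if_pos ⟨rfl, rfl⟩]
  refine ((hl.good hg).ends_swap (u := u) (v := v) (by rw [hl.pos]; exact huv) ?_ ?_).mono ?_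
  · intro z hz
    rw [hl.outList] at hz
    rw [hl.pos]
    exact lt_of_le_of_ne (hA.nil rfl z hz) fun hc => hE (hg.injective hc ▸ hz)
  · intro z hz
    rw [hl.outList] at hz
    rw [hl.pos]
    exact lt_of_le_of_ne (hB.nil rfl z hz) fun hc => hE (hg.injective hc ▸ hz)
  · rintro - s'' ⟨hg', ho, hp, ht⟩
    rw [hl.outList] at ho
    rw [hl.pos] at hp ht
    have hmv := (Moves.refl (U := Relation.ReflTransGen s.Edge u)
      (V := fun y => Relation.ReflTransGen s.Edge y v) (lo := s.pos u) (hi := s.pos v)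
      (f := s.pos)).step (x := u) (y := v) .refl .refl le_rfl huv le_rfl
    refine ⟨_, _, hg', ho, by rw [hp]; exact hmv, by omega, by rw [hp]; simpa using huv, ?_⟩
    set d : ℝ := (s.pos v : ℝ) - s.pos u with hd
    have hd1 : 1 ≤ d := by
      have : (s.pos u : ℝ) + 1 ≤ s.pos v := by exact_mod_cast huv'
      linarith
    have hdn : d ≤ n := by
      have : (s.pos v : ℝ) ≤ n := by exact_mod_cast (s.pos v).2.le
      have : (0 : ℝ) ≤ (s.pos u : ℕ) := by positivity
      linarith
    have hc : ∀ (c γ : ℝ), (c = 0 ∨ (1 ≤ γ ∧ ∃ τ : ℕ, c = √((τ : ℝ) + 1) ∧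
        (s.pos u : ℕ) + τ < s.pos v)) → 0 ≤ γ → c ≤ γ * √d := by
      rintro c γ (rfl | ⟨h1, τ, rfl, h2⟩) hγ
      · positivity
      · have h3 : (τ : ℝ) + 1 ≤ d := by
          have : ((s.pos u : ℕ) : ℝ) + τ + 1 ≤ s.pos v := by exact_mod_cast h2
          linarith
        have := Real.sqrt_le_sqrt h3
        have := Real.sqrt_nonneg d
        nlinarith
    have hα0 : 0 ≤ α ∧ (f₁ = false → 1 ≤ α) := by
      rcases hα with ⟨h1, h2⟩ | ⟨-, h2⟩ | h2 <;> rw [h2] <;> norm_num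
      simp [h1]
    have hβ0 : 0 ≤ β ∧ (f₂ = false → 1 ≤ β) := by
      rcases hβ with ⟨h1, h2⟩ | ⟨-, h2⟩ | h2 <;> rw [h2] <;> norm_num
      simp [h1]
    have hc₁ : c₁ ≤ α * √d := by
      refine hc _ _ ?_ hα0.1
      rcases hA.charge with h | ⟨h1, -, τ, h2, h3, -⟩
      · exact Or.inl h
      · exact Or.inr ⟨hα0.2 h1, τ, h2, h3⟩
    have hc₂ : c₂ ≤ β * √d := by
      refine hc _ _ ?_ hβ0.1
      rcases hB.charge with h | ⟨h1, -, τ, h2, h3, -⟩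
      · exact Or.inl h
      · exact Or.inr ⟨hβ0.2 h1, τ, h2, h3⟩
    have h1 := hl.time
    have h2 : (s''.time : ℝ) ≤ s.time + T + 60 * (p + 2) * logBound n * d := by
      rw [← hcast]
      exact_mod_cast ht.trans (by omega)
    obtain ⟨k1, k2, k3, k4⟩ := le_unitCost (n := n) (p := p) hθ.one_le
    have hsq : √d * √d = d := Real.mul_self_sqrt (by linarith)
    have hsθ : √d ≤ θ := (Real.sqrt_le_sqrt hdn).trans hθ.sqrt_le
    have hs0 := Real.sqrt_nonneg d
    have h3 : 60 * (p + 2) * logBound n * d ≤ unitCost n p θ * √d := by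
      have : d ≤ θ * √d := by nlinarith
      have h5 : (0 : ℝ) ≤ 60 * (p + 2) * logBound n := by positivity
      have h6 := mul_le_mul_of_nonneg_left this h5
      have h7 : unitCost n p θ * √d = 2 * (60 * (p + 2) * logBound n * (θ * √d)) := by
        rw [unitCost]; ring
      have h8 : 0 ≤ 60 * (p + 2) * logBound n * (θ * √d) := by
        have := hθ.one_le
        positivity
      linarith
    have h4 : 20 * θ * (c₁ + c₂) ≤ unitCost n p θ * ((α + β) * √d) := by
      have h5 : c₁ + c₂ ≤ (α + β) * √d := by linarith
      have h6 : 0 ≤ (α + β) * √d := by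
        have := hα0.1; have := hβ0.1
        positivity
      have h7 := hθ.one_le
      calc 20 * θ * (c₁ + c₂) ≤ 20 * θ * ((α + β) * √d) := by gcongr
        _ ≤ unitCost n p θ * ((α + β) * √d) := by gcongr; linarith
    push_cast
    linarith

/-- The search for out-neighbours is paid for by the upward moves of `u`. -/
theorem OutInfo.exists_rate (hA : OutInfo s.Edge s.pos u v A f₁ c₁) (hg : Good p t s)
    (hUV : ∀ x, Relation.ReflTransGen s.Edge u x → ¬ Relation.ReflTransGen s.Edge x v)
    (h₁ : f₁ = true → NoOut s.Edge s.pos u v) (hα : OutRate s.Edge s.pos u v f₁ α) :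
    ∃ a, ((A = [] ∧ a = 0) ∨ ((∀ z, s.Edge u z → s.pos z < s.pos v → z ∈ A) ∧ a = 1) ∨ a = 2) ∧
      ∀ {g : Fin n → Fin n} {N : ℕ} {S SA SU : ℝ},
        Moves (Relation.ReflTransGen s.Edge u) (fun y => Relation.ReflTransGen s.Edge y v)
          (s.pos u) (s.pos v) s.pos g N S → g v < g u → √|(g u : ℝ) - s.pos u| ≤ SU →
        (A = [] → SA = 0) → 2 * SA + a * SU + c₁ ≤ α * (SA + SU) := by
  have hnil : NoOut s.Edge s.pos u v → A = [] := fun h => List.eq_nil_iff_forall_not_mem.2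
    fun w hw => absurd (hA.mem w hw).2 (h w (hA.mem w hw).1).not_gt
  have hc : ∀ {g : Fin n → Fin n} {N : ℕ} {S SU : ℝ},
      Moves (Relation.ReflTransGen s.Edge u) (fun y => Relation.ReflTransGen s.Edge y v)
        (s.pos u) (s.pos v) s.pos g N S → g v < g u → √|(g u : ℝ) - s.pos u| ≤ SU → c₁ ≤ SU := by
    intro g N S SU hm hvu hSU
    have hSU0 : 0 ≤ SU := (Real.sqrt_nonneg _).trans hSU
    rcases hA.charge with rfl | ⟨-, hall, τ, rfl, h1, h2⟩
    · exact hSU0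
    · refine le_trans (Real.sqrt_le_sqrt ?_) hSU
      have hmono : ∀ x y, Relation.ReflTransGen s.Edge x y → s.pos x ≤ s.pos y := fun x y hxy => by
        induction hxy with
        | refl => exact le_rfl
        | tail _ h ih => exact ih.trans (hg.topo _ _ h).le
      have h3 := hm.far_up hUV (u := u) (v := v) .refl (P := s.pos u + τ) (fun x hx hxu => by
        rcases Relation.ReflTransGen.cases_head hx with h4 | ⟨z, h4, h5⟩
        · exact absurd h4.symm hxu
        · have h6 : (s.pos z : ℕ) ≤ s.pos x := hmono z x h5
          refine lt_of_lt_of_le ?_ h6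
          by_cases hzv : s.pos z < s.pos v
          · exact h2 z (hall z h4 hzv)
          · have h7 : (s.pos v : ℕ) ≤ s.pos z := not_lt.1 hzv
            omega) .refl h1 hvu
      have h4 : ((s.pos u : ℕ) : ℝ) + τ + 1 ≤ g u := by exact_mod_cast h3
      exact le_trans (by linarith) (le_abs_self _)
  -- A paid search lowers the rate of `u` for the recursive calls by one, from 2 to 1 or from 1 to
  -- 0, and the difference `SU` covers `c₁`. Without a charge the rate persists, except that it
  -- becomes 0 when `A` is known to be empty.
  rcases hα with ⟨hf, rfl⟩ | ⟨hno, rfl⟩ | rfl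
  · have hA0 := hnil (h₁ hf)
    have hc0 : c₁ = 0 := hA.charge.resolve_right fun h => by simp [hf] at h
    exact ⟨0, Or.inl ⟨hA0, rfl⟩, fun _ _ _ hSA => by rw [hSA hA0, hc0]; simp⟩
  · have hA0 := hnil hno
    exact ⟨0, Or.inl ⟨hA0, rfl⟩, fun hm hvu hS hSA => by
      rw [hSA hA0]; linarith [hc hm hvu hS]⟩
  · rcases hA.charge with hc0 | ⟨-, hall, -⟩
    · exact ⟨2, Or.inr (Or.inr rfl), fun _ _ _ _ => by rw [hc0]; linarith⟩
    · exact ⟨1, Or.inr (Or.inl ⟨hall, rfl⟩), fun hm hvu hS _ => by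
        linarith [hc hm hvu hS]⟩

/-- The search for in-neighbours is paid for by the downward moves of `v`. -/
theorem InInfo.exists_rate (hB : InInfo s.Edge s.pos u v B f₂ c₂) (hg : Good p t s)
    (hUV : ∀ x, Relation.ReflTransGen s.Edge u x → ¬ Relation.ReflTransGen s.Edge x v)
    (h₂ : f₂ = true → NoIn s.Edge s.pos u v) (hβ : InRate s.Edge s.pos u v f₂ β) :
    ∃ b, ((B = [] ∧ b = 0) ∨ ((∀ z, s.Edge z v → s.pos u < s.pos z → z ∈ B) ∧ b = 1) ∨ b = 2) ∧
      ∀ {g : Fin n → Fin n} {N : ℕ} {S SB SV : ℝ},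
        Moves (Relation.ReflTransGen s.Edge u) (fun y => Relation.ReflTransGen s.Edge y v)
          (s.pos u) (s.pos v) s.pos g N S → g v < g u → √|(g v : ℝ) - s.pos v| ≤ SV →
        (B = [] → SB = 0) → 2 * SB + b * SV + c₂ ≤ β * (SB + SV) := by
  have hnil : NoIn s.Edge s.pos u v → B = [] := fun h => List.eq_nil_iff_forall_not_mem.2
    fun w hw => absurd (hB.mem w hw).2 (h w (hB.mem w hw).1).not_gt
  have hc : ∀ {g : Fin n → Fin n} {N : ℕ} {S SV : ℝ},
      Moves (Relation.ReflTransGen s.Edge u) (fun y => Relation.ReflTransGen s.Edge y v)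
        (s.pos u) (s.pos v) s.pos g N S → g v < g u → √|(g v : ℝ) - s.pos v| ≤ SV → c₂ ≤ SV := by
    intro g N S SV hm hvu hSV
    have hSV0 : 0 ≤ SV := (Real.sqrt_nonneg _).trans hSV
    rcases hB.charge with rfl | ⟨-, hall, τ, rfl, h1, h2⟩
    · exact hSV0
    · refine le_trans (Real.sqrt_le_sqrt ?_) hSV
      have hmono : ∀ x y, Relation.ReflTransGen s.Edge x y → s.pos x ≤ s.pos y := fun x y hxy => by
        induction hxy with
        | refl => exact le_rfl
        | tail _ h ih => exact ih.trans (hg.topo _ _ h).le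
      have h3 := hm.far_down hUV (u := u) (v := v) .refl (P := s.pos v - τ) (fun x hx hxv => by
        rcases Relation.ReflTransGen.cases_tail hx with h4 | ⟨z, h5, h4⟩
        · exact absurd h4.symm hxv
        · have h6 : (s.pos x : ℕ) ≤ s.pos z := hmono x z h5
          refine lt_of_le_of_lt h6 ?_
          by_cases hzu : s.pos u < s.pos z
          · have := h2 z (hall z h4 hzu)
            omega
          · have h7 : (s.pos z : ℕ) ≤ s.pos u := not_lt.1 hzu
            omega) .refl (by omega) hvu
      have h4 : ((g v : ℕ) : ℝ) + τ + 1 ≤ (s.pos v : ℕ) := by exact_mod_cast (by omega)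
      rw [abs_sub_comm]
      exact le_trans (by linarith) (le_abs_self _)
  rcases hβ with ⟨hf, rfl⟩ | ⟨hno, rfl⟩ | rfl
  · have hB0 := hnil (h₂ hf)
    have hc0 : c₂ = 0 := hB.charge.resolve_right fun h => by simp [hf] at h
    exact ⟨0, Or.inl ⟨hB0, rfl⟩, fun _ _ _ hSB => by rw [hSB hB0, hc0]; simp⟩
  · have hB0 := hnil hno
    exact ⟨0, Or.inl ⟨hB0, rfl⟩, fun hm hvu hS hSB => by
      rw [hSB hB0]; linarith [hc hm hvu hS]⟩
  · rcases hB.charge with hc0 | ⟨-, hall, -⟩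
    · exact ⟨2, Or.inr (Or.inr rfl), fun _ _ _ _ => by rw [hc0]; linarith⟩
    · exact ⟨1, Or.inr (Or.inl ⟨hall, rfl⟩), fun hm hvu hS _ => by
        linarith [hc hm hvu hS]⟩

theorem not_reach_of_reach {E : Fin n → Fin n → Prop} (hF : ∀ a b, E a b → F a < F b)
    (hFuv : F v < F u) (x : Fin n) (h : Relation.ReflTransGen E u x) :
    ¬ Relation.ReflTransGen E x v := fun h' =>
  absurd ((rank_lt_of_reach hF h).trans (rank_lt_of_reach hF h')) hFuv.not_ge

/-- Induction on the bound for the rank. The recursive calls together leave `3 N - 2 len` where `3 N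
- 2` is allowed; as `len ≥ 2`, the surplus `2 (len - 1)` units pays for the comparisons, the loops
and the fixed cost of the call, while the counting sorts are paid for by the rates. -/
theorem reorderSpec (hθ : Thresholds n p t θ) (F : Fin n → Fin n) (depth : ℕ) :
    ReorderSpec p t (unitCost n p θ) F depth := by
  induction depth with
  | zero => exact fun _ _ _ _ _ _ _ _ _ _ _ _ _ _ _ hr => absurd hr (Nat.not_lt_zero _)
  | succ depth ih =>
    intro s u v f₁ f₂ α β hg hF hFuv huv h₁ h₂ hα hβ hrank
    have hE : ¬ s.Edge u v := fun hc => absurd (hF u v hc) hFuv.not_gt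
    have hUV := not_reach_of_reach hF hFuv
    obtain ⟨k1, k2, k3, k4⟩ := le_unitCost (n := n) (p := p) hθ.one_le
    refine hg.ends_reorder_of_body hθ huv h₁ h₂ fun A B s' T c₁ c₂ hl hA hB hT => ?_
    by_cases hAB : A = [] ∧ B = []
    · obtain ⟨rfl, rfl⟩ := hAB
      refine ends_reorderBody_leaf hθ hg hl huv hE hA hB hα hβ (hT.trans (le_of_eq ?_))
      simp only [List.length_nil, Nat.cast_zero]
      ring
    · have hAu : ∀ a ∈ A, s.pos u < s.pos a := fun a ha => hg.topo u a (hA.mem a ha).1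
      have hBv : ∀ b ∈ B, s.pos b < s.pos v := fun b hb => hg.topo b v (hB.mem b hb).1
      obtain ⟨hlA, hlB⟩ := length_add_one_le_loopPairs hA.sorted hAu hB.sorted hBv
        (fun a ha => (hA.mem a ha).2) (fun b hb => (hB.mem b hb).2) huv
      have hmem := mem_loopPairs (u := u) (A := A) hB.sorted hBv
      have hpw := pairwise_loopPairs hA.sorted hAu hB.sorted hBv
      obtain ⟨a, ha, hacost⟩ := hA.exists_rate hg hUV h₁ hα
      obtain ⟨b, hb, hbcost⟩ := hB.exists_rate hg hUV h₂ hβ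
      rw [reorderBody, if_neg hAB]
      simp only [ends_bind, ends_get, ends_tick]
      rw [show loopPairs s'.pos u v A B = loopPairs s.pos u v A B by rw [hl.pos]]
      generalize loopPairs s.pos u v A B = qs at hlA hlB hmem hpw
      have hlen : 2 ≤ qs.length := by
        rcases not_and_or.1 hAB with h | h
        · have := List.length_pos_iff.2 h
          omega
        · have := List.length_pos_iff.2 h
          omega
      have hl' := hl.addTime (qs.length + A.length + B.length + 1)
      generalize ({ s' with time := s'.time + (qs.length + A.length + B.length + 1) } : Store n) = s₀
        at hl'
      have hedge : s₀.Edge = s.Edge := Store.edge_congr hl'.outList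
      have hstart : LoopState p t (unitCost n p θ) s₀ u v A B a b qs.length qs s₀ 0 0 0 0 0 := by
        refine ⟨hl'.good hg, rfl, by simpa using Moves.refl, rfl, by omega, ?_, le_rfl, le_rfl,
          fun _ => rfl, fun _ => rfl, by simp, by simp, by simp⟩
        rw [hl'.pos]
        refine ⟨fun x y hx hy => ?_, fun q hq => (hmem q).1 hq, hpw⟩
        by_cases hxy : s.pos x < s.pos y
        · exact Or.inl ((hmem (x, y)).2 ⟨hx, hy, hxy⟩)
        · refine Or.inr (lt_of_le_of_ne (not_lt.1 hxy) fun hc => ?_)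
          have hyx := hg.injective hc
          have hux : Relation.ReflTransGen s.Edge u x := by
            rcases hx with rfl | hx
            · exact .refl
            · exact .single (hA.mem x hx).1
          refine hUV x hux ?_
          rw [← hyx]
          rcases hy with hy | rfl
          · exact .single (hB.mem y hy).1
          · exact .refl
      refine (Ends.forM (fun qs' s' => ∃ N SA SU SB SV,
        LoopState p t (unitCost n p θ) s₀ u v A B a b qs.length qs' s' N SA SU SB SV) ?_
        ⟨_, _, _, _, _, hstart⟩).mono ?_
      · rintro q l s₁ ⟨N, SA, SU, SB, SV, hs₁⟩
        refine ends_loop_step ih (hl'.good hg) (by rw [hedge]; exact hF) hFuv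
          (by rw [hl'.pos]; exact huv) (by rw [hl'.pos]; omega) hlen ?_ ?_ ?_ ?_ ?_ ?_ hs₁ <;>
        rw [hedge, hl'.pos]
        · exact hA.mem
        · exact hB.mem
        · exact hA.nil
        · exact hB.nil
        · exact ha
        · exact hb
      · rintro - s₁ ⟨N, SA, SU, SB, SV, hs₁⟩
        have hm := hs₁.moves
        have hxU := hs₁.shiftU
        have hxV := hs₁.shiftV
        rw [hedge, hl'.pos] at hm
        rw [hl'.pos] at hxU hxV
        have hvu : s₁.pos v < s₁.pos u :=
          (hs₁.inv.flipped u v (Or.inl rfl) (Or.inr rfl)).resolve_left List.not_mem_nil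
        have hN : qs.length ≤ N := by simpa using hs₁.count
        refine ⟨N, SA + SU, hs₁.good, hs₁.outList.trans hl'.outList, hm, by omega, hvu, ?_⟩
        have e1 := hacost hm hvu hxU hs₁.nilA
        have e2 := hbcost hm hvu hxV hs₁.nilB
        have e3 := hs₁.time
        have e4 : (s₀.time : ℝ) ≤ s.time + T + (qs.length + A.length + B.length + 1) := by
          exact_mod_cast (hl'.time.trans (by omega) :
            s₀.time ≤ s.time + T + (qs.length + A.length + B.length + 1))
        have e5 : ((A.length : ℝ) + 1) ≤ qs.length := by exact_mod_cast hlA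
        have e6 : ((B.length : ℝ) + 1) ≤ qs.length := by exact_mod_cast hlB
        have e7 : (2 : ℝ) ≤ qs.length := by exact_mod_cast hlen
        rw [← hs₁.split] at e2
        rw [List.length_nil, Nat.cast_zero, sub_zero] at e3
        set κ := unitCost n p θ
        have hκ : 0 ≤ κ := by linarith
        have hc₁ : 0 ≤ c₁ := by
          rcases hA.charge with h | ⟨-, -, τ, h, -⟩ <;> rw [h]
          positivity
        have hc₂ : 0 ≤ c₂ := by
          rcases hB.charge with h | ⟨-, -, τ, h, -⟩ <;> rw [h]
          positivity
        have e8 : 20 * θ * (c₁ + c₂) ≤ κ * (c₁ + c₂) := by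
          gcongr
          linarith [hθ.one_le]
        have e9 := mul_le_mul_of_nonneg_left (add_le_add e1 e2) hκ
        have e10 : 6 * (logBound n : ℝ) * (A.length + B.length + 2) ≤ κ / 10 * (2 * qs.length) := by
          gcongr
          · linarith
          · linarith
        have e11 : ((p : ℝ) + 4) + 40 * θ ≤ κ := by linarith
        have e12 : (3 : ℝ) * qs.length ≤ κ * qs.length / 10 := by nlinarith
        have e13 : κ * 2 ≤ κ * qs.length := by gcongr
        linarith

end Reorder

end OnlineTopo

namespace OnlineTopo

/-! ### The potential -/

section Potential

variable {n : ℕ} {U V : Fin n → Prop} {lo hi N : ℕ} {S : ℝ} {F f g : Fin n → Fin n}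

/-- The weight of a pair of vertices in the potential. -/
noncomputable def pairWeight (F : Fin n → Fin n) (q : Fin n × Fin n) : ℝ :=
  1 + n / ((F q.1 : ℝ) - F q.2)

theorem pairWeight_nonneg {q : Fin n × Fin n} (hq : F q.2 < F q.1) : 0 ≤ pairWeight F q := by
  have : (F q.2 : ℝ) < F q.1 := by exact_mod_cast hq
  have : (0 : ℝ) < (F q.1 : ℝ) - F q.2 := by linarith
  rw [pairWeight]
  positivity

/-- The arithmetic-geometric mean inequality, which balances the released weight of a pair against
the gain in agreement. -/
theorem two_mul_sqrt_le {a d m : ℝ} (ha : 0 < a) (hd : 0 ≤ d) (hm : 0 < m) :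
    2 * √d ≤ m / a + a * d / m := by
  have h1 : m / a + a * d / m - 2 * √d = (m - a * √d) ^ 2 / (a * m) := by
    have := Real.sq_sqrt hd
    field_simp
    linear_combination (-(a ^ 2)) * this
  have : 0 ≤ (m - a * √d) ^ 2 / (a * m) := by positivity
  linarith

/-- `U` only rises and `V` only descends, so the pairs still in the wrong order shrink. A swap of
`x` and `y` removes at least `(x, y)`, whose weight together with the gain in agreement pays `1 +
2√d`. -/
theorem Moves.cost_le (hm : Moves U V lo hi f g N S) (hF : ∀ x y, U x → V y → F y < F x)
    {D : Finset (Fin n × Fin n)} (hD : ∀ q, q ∈ D ↔ U q.1 ∧ V q.2 ∧ f q.1 < f q.2) :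
    N + 2 * S + ∑ q ∈ D with g q.1 < g q.2, pairWeight F q ≤
      ∑ q ∈ D, pairWeight F q + ((agreement F g : ℝ) - agreement F f) / n := by
  have hUV : ∀ x, U x → ¬ V x := fun x hx hx' => lt_irrefl _ (hF x x hx hx')
  induction hm with
  | refl =>
    simp only [Nat.cast_zero, mul_zero, add_zero, zero_add, sub_self, zero_div]
    refine Finset.sum_le_sum_of_subset_of_nonneg (Finset.filter_subset _ _) fun q hq _ => ?_
    exact pairWeight_nonneg (hF _ _ ((hD q).1 hq).1 ((hD q).1 hq).2.1)
  | @step g N S x y hm hx hy h3 h4 h5 ih =>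
    have hstep := (Moves.refl (f := g)).step hx hy h3 h4 h5
    have hn : (0 : ℝ) < n := by exact_mod_cast x.pos
    have hFxy := hF x y hx hy
    have hFxy' : (F y : ℝ) < F x := by exact_mod_cast hFxy
    have h4' : (g x : ℝ) < g y := by exact_mod_cast h4
    have hxyD : (x, y) ∈ D.filter fun q => g q.1 < g q.2 :=
      Finset.mem_filter.2 ⟨(hD _).2 ⟨hx, hy, (hm.up hUV hx).trans_lt (h4.trans_le (hm.down hUV hy))⟩, h4⟩
    have h6 : ∑ q ∈ D with (g ∘ Equiv.swap x y) q.1 < (g ∘ Equiv.swap x y) q.2, pairWeight F q ≤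
        ∑ q ∈ (D.filter fun q => g q.1 < g q.2).erase (x, y), pairWeight F q := by
      refine Finset.sum_le_sum_of_subset_of_nonneg (fun q hq => ?_) fun q hq _ => ?_
      · obtain ⟨hqD, hq⟩ := Finset.mem_filter.1 hq
        obtain ⟨k1, k2, -⟩ := (hD q).1 hqD
        refine Finset.mem_erase.2 ⟨?_, Finset.mem_filter.2 ⟨hqD,
          (hstep.up hUV k1).trans_lt (hq.trans_le (hstep.down hUV k2))⟩⟩
        rintro rfl
        simp only [Function.comp, Equiv.swap_apply_left, Equiv.swap_apply_right] at hq
        exact absurd hq h4.not_gt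
      · have hqD := (Finset.mem_filter.1 (Finset.mem_of_mem_erase hq)).1
        exact pairWeight_nonneg (hF _ _ ((hD q).1 hqD).1 ((hD q).1 hqD).2.1)
    have h7 := Finset.add_sum_erase _ (pairWeight F) hxyD
    have h8 : (agreement F (g ∘ Equiv.swap x y) : ℝ) =
        agreement F g + ((F x : ℝ) - F y) * ((g y : ℝ) - g x) := by
      rw [agreement_comp_swap hFxy h4]
      push_cast [Nat.cast_sub (show (F y : ℕ) ≤ F x from hFxy.le),
        Nat.cast_sub (show (g x : ℕ) ≤ g y from h4.le)]
      ring
    have h9 := two_mul_sqrt_le (a := (F x : ℝ) - F y) (d := (g y : ℝ) - g x) (m := n)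
      (by linarith) (by linarith) hn
    have h10 : pairWeight F (x, y) = 1 + n / ((F x : ℝ) - F y) := rfl
    have h11 : ((agreement F (g ∘ Equiv.swap x y) : ℝ) - agreement F f) / n =
        ((agreement F g : ℝ) - agreement F f) / n + ((F x : ℝ) - F y) * ((g y : ℝ) - g x) / n := by
      rw [h8]
      ring
    rw [h11]
    push_cast
    linarith

open Classical in
/-- The pairs `(x, y)` that are in the wrong order with respect to `F` and such that there is no path
from `y` to `x` yet. -/
noncomputable def openPairs (F : Fin n → Fin n) (E : Fin n → Fin n → Prop) :
    Finset (Fin n × Fin n) :=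
  Finset.univ.filter fun q => F q.2 < F q.1 ∧ ¬ Relation.TransGen E q.2 q.1

theorem mem_openPairs {E : Fin n → Fin n → Prop} {q : Fin n × Fin n} :
    q ∈ openPairs F E ↔ F q.2 < F q.1 ∧ ¬ Relation.TransGen E q.2 q.1 := by
  simp [openPairs]

/-- The potential of a graph and an order. -/
noncomputable def potential (F : Fin n → Fin n) (E : Fin n → Fin n → Prop) (g : Fin n → Fin n) : ℝ :=
  ∑ q ∈ openPairs F E, pairWeight F q - (agreement F g : ℝ) / n

theorem potential_mono {E E' : Fin n → Fin n → Prop} (h : ∀ a b, E a b → E' a b) :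
    potential F E' g ≤ potential F E g := by
  refine sub_le_sub_right (Finset.sum_le_sum_of_subset_of_nonneg (fun q hq => ?_) fun q hq _ => ?_) _
  · rw [mem_openPairs] at hq ⊢
    exact ⟨hq.1, fun hc => hq.2 (Relation.TransGen.mono h _ _ hc)⟩
  · exact pairWeight_nonneg (mem_openPairs.1 hq).1

theorem lt_of_transGen {E : Fin n → Fin n → Prop} (hf : ∀ a b, E a b → f a < f b) {a b : Fin n}
    (h : Relation.TransGen E a b) : f a < f b := by
  induction h with
  | single h => exact hf _ _ h
  | tail _ h ih => exact ih.trans (hf _ _ h)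

/-- The pairs `D` that may be swapped are open before the insertion, since the old order excludes a
path from `y` to `x`; they are not open afterwards, since the new edge creates the path through `u →
v`. -/
theorem Moves.add_potential_le {E E' : Fin n → Fin n → Prop} {u v : Fin n}
    (hm : Moves (Relation.ReflTransGen E v) (fun y => Relation.ReflTransGen E y u) lo hi f g N S)
    (hF : ∀ a b, E a b → F a < F b) (hFuv : F u < F v) (hf : ∀ a b, E a b → f a < f b)
    (hE : ∀ a b, E a b → E' a b) (huv : E' u v) :
    N + 2 * S + potential F E' g ≤ potential F E f := by
  classical
  have hFUV : ∀ x y, Relation.ReflTransGen E v x → Relation.ReflTransGen E y u → F y < F x :=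
    fun x y hx hy => (rank_lt_of_reach hF hy).trans_lt (hFuv.trans_le (rank_lt_of_reach hF hx))
  set D : Finset (Fin n × Fin n) := Finset.univ.filter fun q =>
    Relation.ReflTransGen E v q.1 ∧ Relation.ReflTransGen E q.2 u ∧ f q.1 < f q.2 with hD
  have h1 := hm.cost_le hFUV (D := D) (by simp [hD])
  have h2 : 0 ≤ ∑ q ∈ D with g q.1 < g q.2, pairWeight F q := Finset.sum_nonneg fun q hq => by
    have hq' := (Finset.mem_filter.1 (Finset.mem_filter.1 hq).1).2
    exact pairWeight_nonneg (hFUV _ _ hq'.1 hq'.2.1)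
  have hdisj : Disjoint D (openPairs F E') := by
    rw [Finset.disjoint_left]
    intro q hq hq'
    obtain ⟨-, h3, h4, -⟩ := Finset.mem_filter.1 hq
    exact (mem_openPairs.1 hq').2 (Relation.TransGen.trans_left
      (Relation.TransGen.trans_right (Relation.ReflTransGen.mono hE _ _ h4) (.single huv)) (Relation.ReflTransGen.mono hE _ _ h3))
  have hsub : D ∪ openPairs F E' ⊆ openPairs F E := by
    intro q hq
    rcases Finset.mem_union.1 hq with hq | hq
    · obtain ⟨-, h3, h4, h5⟩ := Finset.mem_filter.1 hq
      refine mem_openPairs.2 ⟨hFUV _ _ h3 h4, fun hc => ?_⟩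
      exact absurd (lt_of_transGen hf hc) h5.not_gt
    · rw [mem_openPairs] at hq ⊢
      exact ⟨hq.1, fun hc => hq.2 (Relation.TransGen.mono hE _ _ hc)⟩
  have h3 : ∑ q ∈ D, pairWeight F q + ∑ q ∈ openPairs F E', pairWeight F q ≤
      ∑ q ∈ openPairs F E, pairWeight F q := by
    rw [← Finset.sum_union hdisj]
    exact Finset.sum_le_sum_of_subset_of_nonneg hsub fun q hq _ =>
      pairWeight_nonneg (mem_openPairs.1 hq).1
  rw [sub_div] at h1
  unfold potential
  linarith

theorem neg_le_potential {E : Fin n → Fin n → Prop} : -((n : ℝ) * n) ≤ potential F E g := by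
  rcases Nat.eq_zero_or_pos n with rfl | hn
  · simp [potential, openPairs]
  · have hn' : (0 : ℝ) < n := by exact_mod_cast hn
    have h1 : 0 ≤ ∑ q ∈ openPairs F E, pairWeight F q := Finset.sum_nonneg fun q hq =>
      pairWeight_nonneg (mem_openPairs.1 hq).1
    have h2 : (agreement F g : ℝ) / n ≤ n * n := by
      rw [div_le_iff₀ hn']
      have : (agreement F g : ℝ) ≤ n * (n * n) := by exact_mod_cast agreement_le F g
      linarith
    unfold potential
    linarith

/-- The differences `F x - F y` are distinct positive integers at most `n`, so the sum is dominated
by a harmonic number. -/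
theorem sum_inv_sub_le (hF : Function.Injective F) (x : Fin n) :
    ∑ y with F y < F x, ((F x : ℝ) - F y)⁻¹ ≤ 1 + Real.log n := by
  have h1 : ∑ y with F y < F x, ((F x : ℝ) - F y)⁻¹ ≤ ∑ k ∈ Finset.range n, ((k : ℝ) + 1)⁻¹ := by
    have h2 : ∑ y with F y < F x, ((F x : ℝ) - F y)⁻¹ =
        ∑ k ∈ (Finset.univ.filter fun y => F y < F x).image (fun y => (F x : ℕ) - F y - 1),
          ((k : ℝ) + 1)⁻¹ := by
      rw [Finset.sum_image]
      · refine Finset.sum_congr rfl fun y hy => ?_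
        have hy' : (F y : ℕ) < F x := (Finset.mem_filter.1 hy).2
        congr 1
        have : (F x : ℕ) = F y + ((F x : ℕ) - F y - 1) + 1 := by omega
        have h3 : ((F x : ℕ) : ℝ) = (F y : ℕ) + (((F x : ℕ) - F y - 1 : ℕ) : ℝ) + 1 := by
          exact_mod_cast this
        rw [h3]
        ring
      · intro y hy z hz hyz
        have hy' : (F y : ℕ) < F x := (Finset.mem_filter.1 hy).2
        have hz' : (F z : ℕ) < F x := (Finset.mem_filter.1 hz).2
        simp only at hyz
        exact hF (Fin.ext (by omega))
    rw [h2]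
    refine Finset.sum_le_sum_of_subset_of_nonneg (fun k hk => ?_) fun k _ _ => by positivity
    obtain ⟨y, hy, rfl⟩ := Finset.mem_image.1 hk
    have := (F x).2
    have hy' : (F y : ℕ) < F x := (Finset.mem_filter.1 hy).2
    exact Finset.mem_range.2 (by omega)
  refine h1.trans (le_trans (le_of_eq ?_) (harmonic_le_one_add_log n))
  simp [harmonic]

theorem potential_le (hF : Function.Injective F) {E : Fin n → Fin n → Prop} :
    potential F E g ≤ n * n * (2 + Real.log n) := by
  have h1 : ∑ q ∈ openPairs F E, pairWeight F q ≤
      ∑ x : Fin n, ∑ y with F y < F x, pairWeight F (x, y) := by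
    rw [Finset.sum_sigma']
    refine le_trans (le_of_eq (Finset.sum_nbij' (fun q => (⟨q.1, q.2⟩ : (_ : Fin n) × Fin n))
      (t := (openPairs F E).map ⟨fun q => (⟨q.1, q.2⟩ : (_ : Fin n) × Fin n), ?_⟩)
      (g := fun z => pairWeight F (z.1, z.2)) (fun z => (z.1, z.2)) ?_ ?_ ?_ ?_ ?_))
      (Finset.sum_le_sum_of_subset_of_nonneg ?_ ?_)
    · rintro ⟨a, b⟩ ⟨c, d⟩ h
      simpa using h
    · intro q hq
      exact Finset.mem_map_of_mem _ hq
    · intro z hz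
      obtain ⟨q, hq, rfl⟩ := Finset.mem_map.1 hz
      exact hq
    · exact fun _ _ => rfl
    · exact fun _ _ => rfl
    · exact fun _ _ => rfl
    · intro z hz
      obtain ⟨q, hq, rfl⟩ := Finset.mem_map.1 hz
      exact Finset.mem_sigma.2 ⟨Finset.mem_univ _,
        Finset.mem_filter.2 ⟨Finset.mem_univ _, (mem_openPairs.1 hq).1⟩⟩
    · intro z hz _
      exact pairWeight_nonneg (by simpa using hz)
  have h2 : ∀ x : Fin n, ∑ y with F y < F x, pairWeight F (x, y) ≤ n * (2 + Real.log n) := by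
    intro x
    have h3 : ∑ y with F y < F x, pairWeight F (x, y) =
        ((Finset.univ.filter fun y => F y < F x).card : ℝ) +
          n * ∑ y with F y < F x, ((F x : ℝ) - F y)⁻¹ := by
      simp only [pairWeight, Finset.sum_add_distrib, Finset.sum_const, nsmul_eq_mul, mul_one,
        Finset.mul_sum, div_eq_mul_inv]
    have h4 : ((Finset.univ.filter fun y => F y < F x).card : ℝ) ≤ n := by
      exact_mod_cast (Finset.card_le_univ _).trans (by simp)
    have h5 := mul_le_mul_of_nonneg_left (sum_inv_sub_le hF x) (Nat.cast_nonneg (α := ℝ) n)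
    linarith
  have h3 : ∑ x : Fin n, ∑ y with F y < F x, pairWeight F (x, y) ≤ n * (n * (2 + Real.log n)) := by
    refine (Finset.sum_le_card_nsmul _ _ _ fun x _ => h2 x).trans ?_
    simp
  have h4 : 0 ≤ (agreement F g : ℝ) / n := by positivity
  unfold potential
  linarith

end Potential

/-- A relation without cycles on the vertices is compatible with a numbering of the vertices. -/
theorem exists_injective_lt_of_acyclic {n : ℕ} {E : Fin n → Fin n → Prop}
    (hE : ∀ x, ¬ Relation.TransGen E x x) :
    ∃ F : Fin n → Fin n, Function.Injective F ∧ ∀ a b, E a b → F a < F b := by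
  classical
  have : IsPartialOrder (Fin n) (Relation.ReflTransGen E) :=
    { refl := fun _ => .refl
      trans := fun _ _ _ h h' => h.trans h'
      antisymm := fun a b h h' => by
        rcases Relation.reflTransGen_iff_eq_or_transGen.1 h with h1 | h1
        · exact h1.symm
        · exact absurd (h1.trans_left h') (hE a) }
  -- Reachability is extended to a linear order; a vertex is numbered by the count of its strict
  -- predecessors.
  obtain ⟨r, hr, hle⟩ := extend_partialOrder (Relation.ReflTransGen E)
  have hlt : ∀ a, (Finset.univ.filter fun b => r b a ∧ b ≠ a).card < n := fun a => by
    have h1 : (Finset.univ.filter fun b => r b a ∧ b ≠ a) ⊂ Finset.univ :=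
      Finset.ssubset_univ_iff.2 fun h => by
        have := h ▸ Finset.mem_univ a
        simp at this
    simpa using Finset.card_lt_card h1
  have key : ∀ a b, r a b → a ≠ b → (Finset.univ.filter fun c => r c a ∧ c ≠ a).card <
      (Finset.univ.filter fun c => r c b ∧ c ≠ b).card := by
    intro a b hab hne
    refine Finset.card_lt_card ⟨fun c hc => ?_, fun hsub => ?_⟩
    · obtain ⟨h1, h2⟩ := (Finset.mem_filter.1 hc).2
      refine Finset.mem_filter.2 ⟨Finset.mem_univ _, hr.trans _ _ _ h1 hab, ?_⟩
      rintro rfl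
      exact h2 (hr.antisymm _ _ h1 hab)
    · have := hsub (Finset.mem_filter.2 ⟨Finset.mem_univ a, hab, hne⟩)
      simp at this
  refine ⟨fun a => ⟨_, hlt a⟩, fun a b hab => ?_, fun a b hab => ?_⟩
  · by_contra hne
    have h1 := Fin.mk.inj_iff.1 hab
    rcases hr.total a b with h2 | h2
    · exact (key a b h2 hne).ne h1
    · exact (key b a h2 (Ne.symm hne)).ne' h1
  · refine key a b (hle _ _ (.single hab)) ?_
    rintro rfl
    exact hE a (.single hab)

end OnlineTopo

namespace OnlineTopo

/-! ### The whole run -/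

section Run

variable {n p : ℕ} {t : ℕ → ℕ} {s : Store n} {F : Fin n → Fin n} {u v : Fin n} {θ : ℝ}

theorem Good.init (p : ℕ) (t : ℕ → ℕ) (T₀ : Equiv.Perm (Fin n)) : Good p t (initStore p T₀) where
  vert_pos := T₀.symm_apply_apply
  pos_vert := T₀.apply_symm_apply
  in_out := fun _ _ => rfl
  topo := fun _ _ h => absurd h (by simp [initStore])
  pails := fun _ _ _ => by simp [initStore, Ordnode.valid_nil, Ordnode.toList, Ordnode.foldr]

theorem callRank_lt_bound (F g : Fin n → Fin n) (u v : Fin n) :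
    callRank F g u v < n * (n * n) * (n + 1) + n := by
  have h1 := Nat.mul_le_mul_right (n + 1) (Nat.sub_le (n * (n * n)) (agreement F g))
  have h2 := (g v).2
  unfold callRank
  omega

/-- The amortised cost of an insertion. -/
theorem Good.ends_insert (h : Good p t s) (hθ : Thresholds n p t θ)
    (hF : ∀ a b, s.Edge a b → F a < F b) (hFuv : F u < F v) {depth : ℕ}
    (hdepth : n * (n * n) * (n + 1) + n ≤ depth) :
    Ends (insert p t depth u v) s fun _ s' => Good p t s' ∧
      (∀ a b, s'.Edge a b ↔ s.Edge a b ∨ (a = u ∧ b = v)) ∧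
      s'.time + 3 * unitCost n p θ * potential F s'.Edge s'.pos ≤
        s.time + 3 * unitCost n p θ * potential F s.Edge s.pos + (3 + 9 * (p + 2) * logBound n) := by
  have hκ : 0 ≤ unitCost n p θ := by
    have := (le_unitCost (n := n) (p := p) hθ.one_le).2.2.2
    linarith
  have hne : u ≠ v := by rintro rfl; exact lt_irrefl _ hFuv
  simp only [insert, ends_bind, ends_getPos, ends_tick]
  have hl : Later s 3 { s with time := s.time + 1 + 1 + 1 } := ⟨3, le_rfl, by simp [add_assoc]⟩
  have hpos := hl.pos
  have hedge := Store.edge_congr hl.outList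
  have htime := hl.time
  have hg := hl.good h
  generalize ({ s with time := s.time + 1 + 1 + 1 } : Store n) = s₀ at *
  have htime' : (s₀.time : ℝ) ≤ s.time + 3 := by exact_mod_cast htime
  split_ifs with hvu
  · rw [ends_bind]
    have hvu' : s₀.pos v < s₀.pos u := by
      rw [hpos]
      exact lt_of_le_of_ne hvu fun hc => hne (h.injective hc).symm
    refine (reorderSpec hθ F depth s₀ v u false false 2 2 hg (by rw [hedge]; exact hF) hFuv hvu'
      (by simp) (by simp) (Or.inr (Or.inr rfl)) (Or.inr (Or.inr rfl))
      ((callRank_lt_bound F s₀.pos v u).trans_le hdepth)).mono ?_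
    rintro - s₁ ⟨N, S, hg₁, ho₁, hm, hN, huv, ht₁⟩
    refine (hg₁.ends_insertEdge huv).mono ?_
    rintro - s₂ ⟨hg₂, he₂, hp₂, ht₂⟩
    have hedge₁ : s₁.Edge = s.Edge := (Store.edge_congr ho₁).trans hedge
    have he : ∀ a b, s₂.Edge a b ↔ s.Edge a b ∨ (a = u ∧ b = v) := fun a b => by
      rw [← hedge₁]
      exact he₂ a b
    refine ⟨hg₂, he, ?_⟩
    rw [hedge, hpos] at hm
    have hS := hm.nonneg
    have hpot := hm.add_potential_le (E' := s₂.Edge) hF hFuv (fun a b => h.topo a b)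
      (fun a b hab => (he a b).2 (Or.inl hab)) ((he u v).2 (Or.inr ⟨rfl, rfl⟩))
    rw [hp₂]
    have ht₂' : (s₂.time : ℝ) ≤ s₁.time + 9 * (p + 2) * logBound n := by exact_mod_cast ht₂
    -- The initial call has the full rates `α = β = 2`. As `5 S ≤ 6 S`, three times the drop of the
    -- potential suffices.
    have h1 : unitCost n p θ * (3 * N - 2 + (2 + 2 + 1) * S) ≤
        unitCost n p θ * (3 * (N + 2 * S)) := by
      gcongr
      linarith
    have h2 := mul_le_mul_of_nonneg_left hpot hκ
    linarith
  · have huv : s₀.pos u < s₀.pos v := by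
      rw [hpos]
      exact not_le.1 hvu
    refine (hg.ends_insertEdge huv).mono ?_
    rintro - s₂ ⟨hg₂, he₂, hp₂, ht₂⟩
    have he : ∀ a b, s₂.Edge a b ↔ s.Edge a b ∨ (a = u ∧ b = v) := fun a b => by
      rw [← hedge]
      exact he₂ a b
    refine ⟨hg₂, he, ?_⟩
    have ht₂' : (s₂.time : ℝ) ≤ s₀.time + 9 * (p + 2) * logBound n := by exact_mod_cast ht₂
    have hpot := potential_mono (F := F) (g := s.pos) (E := s.Edge) (E' := s₂.Edge)
      fun a b hab => (he a b).2 (Or.inl hab)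
    rw [hp₂, hpos]
    have h2 := mul_le_mul_of_nonneg_left hpot hκ
    linarith

theorem ends_build {T₀ : Equiv.Perm (Fin n)} {E₀ : List (Fin n × Fin n)}
    (hT₀ : ∀ e ∈ E₀, T₀ e.1 < T₀ e.2) :
    Ends (E₀.forM fun e => insertEdge p t e.1 e.2) (initStore p T₀) fun _ s =>
      Good p t s ∧ (∀ a b, s.Edge a b → (a, b) ∈ E₀) ∧
      s.time ≤ 2 * n + 2 * n * n + 2 * n * (p + 2) + E₀.length * (9 * (p + 2) * logBound n) := by
  refine (Ends.forM (fun l s => Good p t s ∧ s.pos = T₀ ∧ (∀ e ∈ l, e ∈ E₀) ∧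
    (∀ a b, s.Edge a b → (a, b) ∈ E₀) ∧ s.time + l.length * (9 * (p + 2) * logBound n) ≤
      2 * n + 2 * n * n + 2 * n * (p + 2) + E₀.length * (9 * (p + 2) * logBound n)) ?_ ?_).mono ?_
  · rintro e l s ⟨hg, hpos, hl, hE, ht⟩
    have he := hl e List.mem_cons_self
    refine (hg.ends_insertEdge (u := e.1) (v := e.2) (by rw [hpos]; exact hT₀ e he)).mono ?_
    rintro - s' ⟨hg', he', hp', ht'⟩
    refine ⟨hg', hp'.trans hpos, fun e h => hl e (List.mem_cons_of_mem _ h), fun a b hab => ?_, ?_⟩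
    · rcases (he' a b).1 hab with h1 | ⟨rfl, rfl⟩
      · exact hE a b h1
      · exact he
    · rw [List.length_cons, add_mul, one_mul] at ht
      omega
  · exact ⟨Good.init p t T₀, rfl, fun _ h => h, fun a b h => absurd h (by simp [Store.Edge, initStore]),
      le_rfl⟩
  · rintro - s ⟨hg, -, -, hE, ht⟩
    exact ⟨hg, hE, by simpa using ht⟩

/-- The running time in terms of the number `n` of vertices, the number `p` of levels and the threshold
`θ`. -/
theorem exists_run_time_le (hθ : Thresholds n p t θ) {T₀ : Equiv.Perm (Fin n)}
    {E₀ es : List (Fin n × Fin n)} (hT₀ : ∀ e ∈ E₀, T₀ e.1 < T₀ e.2) (hnd : (E₀ ++ es).Nodup)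
    (hac : ∀ x : Fin n, ¬ Relation.TransGen (fun a b => (a, b) ∈ E₀ ++ es) x x) :
    ∃ (depth : ℕ) (s : Store n), run p t depth T₀ E₀ es = some s ∧
      (s.time : ℝ) ≤ 2 * n + 2 * n * n + 2 * n * (p + 2) +
        n * n * (3 + 9 * (p + 2) * logBound n) +
        3 * unitCost n p θ * (n * n * (3 + Real.log n)) := by
  obtain ⟨F, hFinj, hF⟩ := exists_injective_lt_of_acyclic hac
  have hκ : 0 ≤ unitCost n p θ := by
    have := (le_unitCost (n := n) (p := p) hθ.one_le).2.2.2
    linarith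
  set κ := unitCost n p θ with hκdef
  set c : ℝ := 3 + 9 * (p + 2) * logBound n with hc
  -- Exceeds every possible `callRank`, hence serves for all insertions at once.
  set depth := n * (n * n) * (n + 1) + n
  have hlen : ((E₀.length : ℝ) + es.length) ≤ n * n := by
    have := hnd.length_le_card
    rw [List.length_append, Fintype.card_prod, Fintype.card_fin] at this
    exact_mod_cast this
  have main : Ends (do
      E₀.forM fun e => insertEdge p t e.1 e.2
      es.forM fun e => insert p t depth e.1 e.2
      get : Prog n (Store n)) (initStore p T₀) fun a _ => (a.time : ℝ) ≤
        2 * n + 2 * n * n + 2 * n * (p + 2) + n * n * c + 3 * κ * (n * n * (3 + Real.log n)) := by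
    rw [ends_bind]
    refine (ends_build hT₀).mono ?_
    rintro - s₀ ⟨hg₀, hE₀, ht₀⟩
    rw [ends_bind]
    simp only [ends_get]
    refine (Ends.forM (fun l s => Good p t s ∧ (∀ e ∈ l, e ∈ E₀ ++ es) ∧
      (∀ a b, s.Edge a b → (a, b) ∈ E₀ ++ es) ∧
      s.time + 3 * κ * potential F s.Edge s.pos + l.length * c ≤
        s₀.time + 3 * κ * potential F s₀.Edge s₀.pos + es.length * c) ?_ ?_).mono ?_
    · rintro e l s ⟨hg, hl, hE, ht⟩
      have he := hl e List.mem_cons_self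
      refine (hg.ends_insert hθ (F := F) (fun a b hab => hF a b (hE a b hab)) (hF _ _ he) le_rfl).mono ?_
      rintro - s' ⟨hg', he', ht'⟩
      refine ⟨hg', fun e h => hl e (List.mem_cons_of_mem _ h), fun a b hab => ?_, ?_⟩
      · rcases (he' a b).1 hab with h1 | ⟨rfl, rfl⟩
        · exact hE a b h1
        · exact he
      · rw [List.length_cons] at ht
        push_cast at ht
        linarith
    · exact ⟨hg₀, fun e h => List.mem_append_right _ h,
        fun a b h => List.mem_append_left _ (hE₀ a b h), le_rfl⟩
    · rintro - s ⟨-, -, -, ht⟩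
      have h1 : (s₀.time : ℝ) ≤ 2 * n + 2 * n * n + 2 * n * (p + 2) +
          E₀.length * (9 * (p + 2) * logBound n) := by exact_mod_cast ht₀
      have h2 : (E₀.length : ℝ) * (9 * (p + 2) * logBound n) ≤ E₀.length * c := by
        gcongr
        linarith
      have h3 : ((E₀.length : ℝ) + es.length) * c ≤ n * n * c := by gcongr
      have h4 := mul_le_mul_of_nonneg_left (potential_le hFinj (E := s₀.Edge) (g := s₀.pos)) hκ
      have h5 := mul_le_mul_of_nonneg_left (neg_le_potential (F := F) (E := s.Edge) (g := s.pos)) hκ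
      simp only [List.length_nil, Nat.cast_zero, zero_mul, add_zero] at ht
      linarith
  obtain ⟨a, s', h1, h2⟩ := main
  refine ⟨depth, a, ?_, h2⟩
  rw [run, StateT.run', h1]
  rfl

end Run

/-! ### The thresholds -/

/-- The exponent is chosen so that the last threshold is exactly `n`. -/
theorem expo_mul (p : ℕ) : expo p * (2 - (2 / 3 : ℝ) ^ (p + 1)) = 1 := by
  have h3 : (0 : ℝ) < 3 ^ (p + 1) := by positivity
  have h1 : (2 : ℝ) ^ (p + 1) ≤ 3 ^ (p + 1) := by gcongr; norm_num
  have h2 : (2 * 3 ^ (p + 1) - 2 ^ (p + 1) : ℝ) ≠ 0 := by linarith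
  rw [expo, div_pow]
  field_simp
  exact div_self (by rwa [mul_comm])

theorem half_le_expo (p : ℕ) : 1 / 2 ≤ expo p := by
  have h := expo_mul p
  have h1 : (2 / 3 : ℝ) ^ (p + 1) ≤ 1 := pow_le_one₀ (by norm_num) (by norm_num)
  have h2 : (0 : ℝ) < (2 / 3 : ℝ) ^ (p + 1) := by positivity
  by_contra hc
  push Not at hc
  rcases le_or_gt (expo p) 0 with h3 | h3 <;> nlinarith

theorem thresholds_floor {n p : ℕ} (hn : 1 ≤ n) {t : ℕ → ℝ} (h0 : t 0 = (n : ℝ) ^ expo p)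
    (h : ∀ i : ℕ, 1 ≤ i → i ≤ p + 1 → t i = t 0 ^ (2 - (2 / 3 : ℝ) ^ i)) :
    Thresholds n p (fun i => ⌊t i⌋₊) (t 0) := by
  have hn' : (1 : ℝ) ≤ n := by exact_mod_cast hn
  have hf := half_le_expo p
  have hone : 1 ≤ t 0 := by
    rw [h0]
    exact Real.one_le_rpow hn' (by linarith)
  have hpos : 0 < t 0 := by linarith
  have h' : ∀ i ≤ p + 1, t i = t 0 ^ (2 - (2 / 3 : ℝ) ^ i) := by
    intro i hi
    rcases Nat.eq_zero_or_pos i with rfl | hi'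
    · norm_num
    · exact h i hi' hi
  have htop : t (p + 1) = n := by
    rw [h' _ le_rfl, h0, ← Real.rpow_mul (by positivity), expo_mul, Real.rpow_one]
  refine ⟨hone, Nat.floor_le hpos.le, fun i hi => ?_, ?_, ?_⟩
  · have h1 : 0 ≤ t (i + 1) := by
      rw [h' _ (by omega)]
      positivity
    refine (Nat.floor_le h1).trans ?_
    have h2 : t (i + 1) ≤ t 0 * √(t i) := by
      rw [h' (i + 1) (by omega), h' i (by omega), Real.sqrt_eq_rpow, ← Real.rpow_mul hpos.le]
      nth_rewrite 2 [← Real.rpow_one (t 0)]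
      rw [← Real.rpow_add hpos]
      -- The exponents compare as `2 - (2/3)^(i+1) ≤ 2 - (1/2) (2/3)^i`, because `1/2 ≤ 2/3`.
      refine Real.rpow_le_rpow_of_exponent_le hone ?_
      have : (0 : ℝ) < (2 / 3) ^ i := by positivity
      rw [pow_succ]
      linarith
    refine h2.trans ?_
    gcongr
    -- Rounding down a threshold is compensated by the summand 1 under the root in
    -- `Thresholds.succ_le`.
    exact (Nat.lt_floor_add_one _).le
  · simp only [htop, Nat.floor_natCast, le_refl]
  · rw [h0, Real.sqrt_eq_rpow]
    exact Real.rpow_le_rpow_of_exponent_le hn' hf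

theorem logBound_le {n : ℕ} (hn : 2 ≤ n) : (logBound n : ℝ) ≤ 10 * Real.log n := by
  have hn' : (2 : ℝ) ≤ n := by exact_mod_cast hn
  have h1 : Real.log 2 ≤ Real.log n := Real.log_le_log (by norm_num) hn'
  have h2 := Real.log_two_gt_d9
  have h3 : Real.log ((n : ℝ) + 1) ≤ 2 * Real.log n := by
    have : (2 : ℝ) * Real.log n = Real.log ((n : ℝ) ^ 2) := by rw [Real.log_pow]; norm_num
    rw [this]
    exact Real.log_le_log (by linarith) (by nlinarith)
  have h4 : (0 : ℝ) ≤ Real.log ((n : ℝ) + 1) := Real.log_nonneg (by linarith)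
  have h5 := Nat.floor_le (a := 4 * Real.log ((n : ℝ) + 1)) (by linarith)
  unfold logBound
  push_cast
  linarith

/-- All terms are dominated by `n² (p + 2) L θ (3 + log n)`, with coefficients adding up to `360 +
18`. As `log n > 1/2`, the factors `p + 2`, `L` and `3 + log n` are at most `K + 4`, 10 and 7 times
`log n`. -/
theorem time_bound_le {n p : ℕ} (hn : 2 ≤ n) {K θ : ℝ} (hθ : 1 ≤ θ) (hp : (p : ℝ) ≤ K * Real.log n) :
    2 * n + 2 * n * n + 2 * n * (p + 2) + n * n * (3 + 9 * (p + 2) * logBound n) +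
        3 * unitCost n p θ * (n * n * (3 + Real.log n)) ≤
      378 * 70 * (K + 4) * (n ^ 2 * θ) * Real.log n ^ 3 := by
  have hn' : (2 : ℝ) ≤ n := by exact_mod_cast hn
  have h1 : Real.log 2 ≤ Real.log n := Real.log_le_log (by norm_num) hn'
  have h2 := Real.log_two_gt_d9
  have hL := logBound_le hn
  have hL1 : (1 : ℝ) ≤ logBound n := by exact_mod_cast one_le_logBound n
  rw [unitCost]
  set ℓ := Real.log n
  set L := (logBound n : ℝ)
  have hp0 : (0 : ℝ) ≤ p := by positivity
  set P : ℝ := (p : ℝ) + 2 with hP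
  set R : ℝ := 3 + ℓ with hR
  set m := (n : ℝ) with hm
  have hR1 : 1 ≤ R := by linarith
  have hP1 : 1 ≤ P := by linarith
  have hm0 : 0 ≤ m := by linarith
  have e1 : m ≤ m * m := by nlinarith
  have e2 : m * m * (P * L) ≤ m * m * (P * L) * (θ * R) :=
    le_mul_of_one_le_right (by positivity) (one_le_mul_of_one_le_of_one_le hθ hR1)
  have e3 : m * m ≤ m * m * (P * L) :=
    le_mul_of_one_le_right (by positivity) (one_le_mul_of_one_le_of_one_le hP1 hL1)
  have e4 : m * P ≤ m * m * (P * L) := by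
    calc m * P ≤ m * m * P := by gcongr
      _ ≤ m * m * (P * L) := by gcongr; exact le_mul_of_one_le_right (by linarith) hL1
  have hPK : P ≤ (K + 4) * ℓ := by linarith
  have hR7 : R ≤ 7 * ℓ := by linarith
  have hK0 : 0 ≤ (K + 4) * ℓ := by linarith
  have hℓ : 0 ≤ 10 * ℓ := by linarith
  have e5 : m * m * (P * L) * (θ * R) ≤ m * m * ((K + 4) * ℓ * (10 * ℓ)) * (θ * (7 * ℓ)) := by
    have h3 : P * L ≤ (K + 4) * ℓ * (10 * ℓ) := mul_le_mul hPK hL (by linarith) hK0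
    have h4 : θ * R ≤ θ * (7 * ℓ) := by gcongr
    refine mul_le_mul (by gcongr) h4 (by positivity) ?_
    exact mul_nonneg (by positivity) (mul_nonneg hK0 hℓ)
  calc 2 * m + 2 * m * m + 2 * m * P + m * m * (3 + 9 * P * L) + 3 * (120 * P * L * θ) * (m * m * R)
      ≤ 378 * (m * m * (P * L) * (θ * R)) := by linarith
    _ ≤ 378 * (m * m * ((K + 4) * ℓ * (10 * ℓ)) * (θ * (7 * ℓ))) := by gcongr
    _ = _ := by ring

end OnlineTopo

theorem mainTheorem10 :
    ∃ k : ℕ, ∀ K : ℝ, ∃ C : ℝ, ∀ n p : ℕ, 2 ≤ n → (p : ℝ) ≤ K * Real.log n →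
      ∀ t : ℕ → ℝ, t 0 = (n : ℝ) ^ OnlineTopo.expo p →
        (∀ i : ℕ, 1 ≤ i → i ≤ p + 1 → t i = t 0 ^ (2 - (2 / 3 : ℝ) ^ i)) →
      ∀ (T₀ : Equiv.Perm (Fin n)) (E₀ es : List (Fin n × Fin n)),
        (∀ e ∈ E₀, T₀ e.1 < T₀ e.2) →
        (E₀ ++ es).Nodup →
        (∀ x : Fin n, ¬ Relation.TransGen (fun a b => (a, b) ∈ E₀ ++ es) x x) →
        ∃ (depth : ℕ) (s : OnlineTopo.Store n),
          OnlineTopo.run p (fun i => ⌊t i⌋₊) depth T₀ E₀ es = some s ∧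
          (s.time : ℝ) ≤ C * (n : ℝ) ^ (2 + OnlineTopo.expo p) * Real.log n ^ k := by
  -- One logarithm each comes from the number of levels, the height of the trees and the harmonic
  -- sum in the potential.
  refine ⟨3, fun K => ⟨378 * 70 * (K + 4), ?_⟩⟩
  intro n p hn hp t h0 ht T₀ E₀ es hT₀ hnd hac
  have hθ := OnlineTopo.thresholds_floor (by omega) h0 ht
  obtain ⟨depth, s, hs, htime⟩ := OnlineTopo.exists_run_time_le hθ hT₀ hnd hac
  refine ⟨depth, s, hs, htime.trans ((OnlineTopo.time_bound_le hn hθ.one_le hp).trans_eq ?_)⟩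
  rw [h0, Real.rpow_add (by positivity), Real.rpow_two]
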